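/- Let $n,m\ge 0$, let $F_n$ be the free group with basis $X=\{x_1,\dots,x_n\}$, and let $G=F_n\times\mathbb Z^m$, generated by $x_1,\dots,x_n$ and the standard basis $t_1,\dots,t_m$ of $\mathbb Z^m$; let $\pi\colon G\to F_n$ be the projection. For a group $\Gamma$, a subset $S\subseteq \Gamma$ and $g\in \Gamma$, the order $\mathrm{Ord}_S(g)$ is the least $k\ge 1$ with $g^k\in S$ if such a $k$ exists, and $0$ otherwise; the spectrum of $\Gamma$ with respect to $S$ is $\mathrm{Ord}_S(\Gamma)=\{\mathrm{Ord}_S(g): g\in \Gamma\}\subseteq\mathbb N$. For $K\le F_n$, the Schreier automaton of $K$ has the right cosets $Kw$ as vertices, an arc labelled $x$ from $Kw$ to $Kwx$ for every $x\in X^{\pm1}$, and basepoint $K$; the Stallings automaton of $K$ is its full subgraph on the vertices that lie on some reduced closed walk at the basepoint (the trivial walk included); the restricted Stallings automaton $\mathcal A^*_K$ is obtained from the Stallings automaton by forgetting the basepoint and removing all hanging trees (so it is a single vertex if $K$ is trivial). For a subgroup $H\le G$ put $L_H=H\cap\mathbb Z^m$, and let $d_H$ be the largest elementary divisor of $L_H$,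 i.e. $d_H=d_r$ where $d_1\mid\cdots\mid d_r$ are the positive integers such that $L_H$ has a basis $d_1q_1,\dots,d_rq_r$ for some basis $q_1,\dots,q_m$ of $\mathbb Z^m$; put $d_H=1$ if $L_H=0$. 1. For every finitely generated $H\le G$, $$\mathrm{Ord}_H(G)\subseteq \mathrm{Ord}_{H\pi}(F_n)\cdot \mathrm{Ord}_{L_H}(\mathbb Z^m)=\{ab : a\in \mathrm{Ord}_{H\pi}(F_n),\ b\in \mathrm{Ord}_{L_H}(\mathbb Z^m)\},$$ the automaton $\mathcal A^*_{H\pi}$ is finite, and every $k\in\mathrm{Ord}_H(G)$ satisfies $k\le |V(\mathcal A^*_{H\pi})|\cdot d_H$. In particular, $G$ has bounded spectrum with respect to each of its finitely generated subgroups. 2. In the following, elements of $G$ are given as words in $x_i^{\pm1},t_j^{\pm1}$, and finitely generated subgroups as finite lists of such words that generate them. (a) The bound $|V(\mathcal A^*_{H\pi})|\cdot d_H$ is a computable function of $H$; in particular, the spectrum boundability problem of $G$ (given $H$, output an upper bound for $\mathrm{Ord}_H(G)$ if this set is finite, and $\infty$ otherwise) is computable. (b) The order problem of $G$ is computable: there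 is an algorithm that, given $H$ and $g\in G$, outputs $\mathrm{Ord}_H(g)$. (c) The spectrum membership problem of $G$ is computable: there is an algorithm that, given $H$ and $k\in\mathbb N$, decides whether $k\in \mathrm{Ord}_H(G)$. (d) There is an algorithm that, given $H$, outputs the (finite) spectrum $\mathrm{Ord}_H(G)$; in particular, the finite spectrum problem of $G$ (given $H$, decide whether $\mathrm{Ord}_H(G)$ is finite and, if so, output it) is computable. -/

import Mathlib

open scoped Pointwise

/-! ## Relative orders and relative spectra -/

/-- The order of `g` in the subset `S`: the least `k ≥ 1` with `g ^ k ∈ S`, and `0` if there is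
none (the infimum of the empty set of natural numbers is `0`). -/
noncomputable def relOrder {G : Type*} [Group G] (S : Set G) (g : G) : ℕ :=
  sInf {k : ℕ | 1 ≤ k ∧ g ^ k ∈ S}

/-- The spectrum of `G` with respect to `S`: the set of the orders in `S` of the elements of `G`. -/
def relSpectrum {G : Type*} [Group G] (S : Set G) : Set ℕ :=
  Set.range (relOrder S)

/-- The spectrum of `G` with respect to every finitely generated subgroup is bounded. -/
def HasBoundedSubgroupSpectra (G : Type*) [Group G] : Prop :=
  ∀ H : Subgroup G, H.FG → BddAbove (relSpectrum (H : Set G))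

/-! ## Algorithmic problems

The group `G` is given through generators `gen x`, `x : X`. Elements are input as words in the
generators and their formal inverses (`(x, true)` stands for `x` and `(x, false)` for its inverse),
and finitely generated subgroups are input as finite lists of such words. -/

/-- The element of `G` that a word represents. -/
def wordEval {X G : Type*} [Group G] (gen : X → G) (w : List (X × Bool)) : G :=
  FreeGroup.lift gen (FreeGroup.mk w)

/-- The subgroup of `G` generated by the elements that the words in a list represent. -/
def subgroupOfWords {X G : Type*} [Group G] (gen : X → G) (W : List (List (X × Bool))) :
    Subgroup G :=
  Subgroup.closure {g | ∃ w ∈ W, wordEval gen w = g}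

/-- The order problem is computable: given `H` and `g`, output the order of `g` in `H`. -/
def OrderProblemComputable {X G : Type*} [Primcodable X] [Group G] (gen : X → G) : Prop :=
  Computable fun p : List (List (X × Bool)) × List (X × Bool) =>
    relOrder (subgroupOfWords gen p.1 : Set G) (wordEval gen p.2)

/-- The spectrum membership problem is computable: given `H` and `k`, decide whether `k` belongs to
the spectrum of `G` with respect to `H`. -/
def SpectrumMembershipComputable {X G : Type*} [Primcodable X] [Group G] (gen : X → G) : Prop :=
  ComputablePred fun p : List (List (X × Bool)) × ℕ =>
    p.2 ∈ relSpectrum (subgroupOfWords gen p.1 : Set G)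

/-- The finite spectrum problem is computable: given `H`, decide whether the spectrum with respect
to `H` is finite and, if so, output it (`none` is the answer "infinite"). -/
def FiniteSpectrumComputable {X G : Type*} [Primcodable X] [Group G] (gen : X → G) : Prop :=
  ∃ f : List (List (X × Bool)) → Option (List ℕ), Computable f ∧
    ∀ W : List (List (X × Bool)),
      (f W = none ↔ (relSpectrum (subgroupOfWords gen W : Set G)).Infinite) ∧
      ∀ l : List ℕ, f W = some l →
        ∀ k : ℕ, k ∈ l ↔ k ∈ relSpectrum (subgroupOfWords gen W : Set G)

/-- The spectrum boundability problem is computable: given `H`, output an upper bound for the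
spectrum with respect to `H` if it is finite, and `∞` (that is, `none`) otherwise. -/
def SpectrumBoundabilityComputable {X G : Type*} [Primcodable X] [Group G] (gen : X → G) : Prop :=
  ∃ f : List (List (X × Bool)) → Option ℕ, Computable f ∧
    ∀ W : List (List (X × Bool)),
      (f W = none ↔ (relSpectrum (subgroupOfWords gen W : Set G)).Infinite) ∧
      ∀ b : ℕ, f W = some b → ∀ k ∈ relSpectrum (subgroupOfWords gen W : Set G), k ≤ b

/-! ## Involutive deterministic labelled digraphs and (restricted) Stallings automata -/

/-- An involutive and deterministic labelled digraph over the alphabet `X`. The letter `(x, true)`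
is `x` and `(x, false)` is its inverse. By determinism an arc is determined by its origin, its label
and its end, so that a relation is enough to describe the arcs. -/
structure InvDigraph (X V : Type*) where
  /-- the set of vertices -/
  verts : Set V
  /-- `arc p a q`: there is an arc from `p` to `q` with label `a` -/
  arc : V → X × Bool → V → Prop
  mem_verts : ∀ {p a q}, arc p a q → p ∈ verts
  arc_inv : ∀ {p a q}, arc p a q → arc q (a.1, !a.2) p
  deterministic : ∀ {p a q r}, arc p a q → arc p a r → q = r

namespace InvDigraph

variable {X V : Type*}

/-- `A.Walk p w q`: the word `w` is the label of a walk from `p` to `q` in `A`. (By determinism,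
the walk is determined by `p` and `w`; it has no backtracking if and only if `w` is reduced.) -/
inductive Walk (A : InvDigraph X V) : V → List (X × Bool) → V → Prop
  | nil {p : V} : p ∈ A.verts → Walk A p [] p
  | cons {p q r : V} {a : X × Bool} {w : List (X × Bool)} :
      A.arc p a q → Walk A q w r → Walk A p (a :: w) r

/-- The subgraph with vertex set `S ∩ A.verts` and those arcs between its vertices that have an end
outside `E`; for `E = ∅` this is the full subgraph on `S`. -/
def restrict (A : InvDigraph X V) (S E : Set V) : InvDigraph X V where
  verts := S ∩ A.verts
  arc p a q := A.arc p a q ∧ p ∈ S ∧ q ∈ S ∧ (p ∉ E ∨ q ∉ E)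
  mem_verts h := ⟨h.2.1, A.mem_verts h.1⟩
  arc_inv h := ⟨A.arc_inv h.1, h.2.2.1, h.2.1, h.2.2.2.symm⟩
  deterministic h h' := A.deterministic h.1 h'.1

/-- A tree: a nonempty graph in which any two vertices are joined by exactly one reduced walk. -/
def IsTree (A : InvDigraph X V) : Prop :=
  A.verts.Nonempty ∧ ∀ p ∈ A.verts, ∀ q ∈ A.verts,
    ∃! w : List (X × Bool), FreeGroup.IsReduced w ∧ A.Walk p w q

/-- The core of `A` with basepoint `b`: the full subgraph on the vertices that appear in some
reduced closed walk at `b`. -/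
def core (A : InvDigraph X V) (b : V) : InvDigraph X V :=
  A.restrict {v | ∃ w₁ w₂ : List (X × Bool),
    FreeGroup.IsReduced (w₁ ++ w₂) ∧ A.Walk b w₁ v ∧ A.Walk v w₂ b} ∅

/-- `B` is the set of the vertices other than `p` of a hanging tree of `A` that is attached at `p`:
the arcs at vertices of `B` stay in `B ∪ {p}`, and they form a tree on `B ∪ {p}` (arcs from `p` to
`p` do not belong to the hanging tree). -/
def IsHangingTree (A : InvDigraph X V) (p : V) (B : Set V) : Prop :=
  p ∈ A.verts ∧ B ⊆ A.verts ∧ p ∉ B ∧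
    (∀ q ∈ B, ∀ a r, A.arc q a r → r ∈ insert p B) ∧
    (A.restrict (insert p B) {p}).IsTree

/-- The restricted core of `A`: forget the basepoint and remove all the hanging trees. -/
def restrictedCore (A : InvDigraph X V) : InvDigraph X V :=
  A.restrict {v | ¬ ∃ (p : V) (B : Set V), A.IsHangingTree p B ∧ v ∈ B} ∅

end InvDigraph

/-- The set of right cosets `H w` of the free group modulo `H`. -/
abbrev RightCosets {X : Type*} (H : Subgroup (FreeGroup X)) : Type _ :=
  Quotient (QuotientGroup.rightRel H)

/-- The right coset `H w`. -/
def rightCoset {X : Type*} (H : Subgroup (FreeGroup X)) (w : FreeGroup X) : RightCosets H :=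
  Quotient.mk (QuotientGroup.rightRel H) w

theorem rightCoset_mul {X : Type*} {H : Subgroup (FreeGroup X)} {u v : FreeGroup X}
    (h : rightCoset H u = rightCoset H v) (g : FreeGroup X) :
    rightCoset H (u * g) = rightCoset H (v * g) := by
  have h1 : (QuotientGroup.rightRel H) u v := Quotient.exact h
  rw [QuotientGroup.rightRel_apply] at h1
  refine Quotient.sound (s := QuotientGroup.rightRel H) ?_
  change (QuotientGroup.rightRel H) (u * g) (v * g)
  rw [QuotientGroup.rightRel_apply]
  simpa [mul_assoc] using h1

/-- The (right) Schreier automaton of `H`: the vertices are the right cosets `H w`, with an arc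
from `H w` to `H w x` labelled `x` for every letter `x`. Its basepoint is the coset `H`. -/
def schreier {X : Type*} (H : Subgroup (FreeGroup X)) : InvDigraph X (RightCosets H) where
  verts := Set.univ
  arc p a q := ∃ w : FreeGroup X, p = rightCoset H w ∧ q = rightCoset H (w * FreeGroup.mk [a])
  mem_verts _ := Set.mem_univ _
  arc_inv := by
    rintro p a q ⟨w, rfl, rfl⟩
    refine ⟨w * FreeGroup.mk [a], rfl, ?_⟩
    have h : FreeGroup.mk [a] * FreeGroup.mk [(a.1, !a.2)] = (1 : FreeGroup X) := by
      have : FreeGroup.mk [(a.1, !a.2)] = (FreeGroup.mk [a])⁻¹ := by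
        simp [FreeGroup.inv_mk, FreeGroup.invRev]
      rw [this, mul_inv_cancel]
    rw [mul_assoc, h, mul_one]
  deterministic := by
    rintro p a q r ⟨w, hp, rfl⟩ ⟨w', hp', rfl⟩
    exact rightCoset_mul (hp.symm.trans hp') _

/-- The Stallings automaton of `H`: the core of the Schreier automaton, with basepoint `H`. -/
def stallings {X : Type*} (H : Subgroup (FreeGroup X)) : InvDigraph X (RightCosets H) :=
  (schreier H).core (rightCoset H 1)

/-- The restricted Stallings automaton of `H`. -/
def restrictedStallings {X : Type*} (H : Subgroup (FreeGroup X)) : InvDigraph X (RightCosets H) :=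
  (stallings H).restrictedCore

/-! ## Elementary divisors of subgroups of `ℤ ^ m` -/

/-- The set of the elementary divisors `d₁ ∣ ⋯ ∣ dᵣ` of a subgroup `L` of `ℤ ^ m`, the positive
integers in the Smith normal form of `L`: there are a basis `q` of `ℤ ^ m` and a basis of `L` of the
form `d₁ q₁, …, dᵣ qᵣ`. -/
def elementaryDivisors {m : ℕ} (L : Submodule ℤ (Fin m → ℤ)) : Set ℕ :=
  {d | ∃ (r : ℕ) (s : Module.Basis.SmithNormalForm L (Fin m) r),
    (∀ i, 0 < s.a i) ∧ (∀ i j, i ≤ j → s.a i ∣ s.a j) ∧ ∃ i, s.a i = (d : ℤ)}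

/-- The largest elementary divisor of `L`, with the value `1` for `L = 0`, which has no elementary
divisors. -/
noncomputable def largestElementaryDivisor {m : ℕ} (L : Submodule ℤ (Fin m → ℤ)) : ℕ :=
  sSup (insert 1 (elementaryDivisors L))

/-! ## Free times free-abelian groups -/

/-- The group `F_n × ℤ ^ m` (with `ℤ ^ m` written multiplicatively). -/
abbrev FTA (n m : ℕ) : Type :=
  FreeGroup (Fin n) × Multiplicative (Fin m → ℤ)

namespace FTA

variable {n m : ℕ}

/-- The standard generators `x₁, …, xₙ, t₁, …, tₘ`. -/
def gen (n m : ℕ) : Fin n ⊕ Fin m → FTA n m :=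
  Sum.elim (fun i => (FreeGroup.of i, 1)) (fun j => (1, Multiplicative.ofAdd (Pi.single j 1)))

/-- The image of `H` under the projection to the free part. -/
def freePart (H : Subgroup (FTA n m)) : Subgroup (FreeGroup (Fin n)) :=
  H.map (MonoidHom.fst _ _)

/-- The intersection of `H` with `ℤ ^ m`, as a subgroup of `ℤ ^ m` (written multiplicatively). -/
def baseSubgroup (H : Subgroup (FTA n m)) : Subgroup (Multiplicative (Fin m → ℤ)) :=
  H.comap (MonoidHom.inr _ _)

/-- The intersection of `H` with `ℤ ^ m`, as a submodule of `ℤ ^ m`. -/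
def baseSubmodule (H : Subgroup (FTA n m)) : Submodule ℤ (Fin m → ℤ) :=
  AddSubgroup.toIntSubmodule (Subgroup.toAddSubgroup' (baseSubgroup H))

/-- The number of vertices of the restricted Stallings automaton of the projection of `H` to the
free part, times the largest elementary divisor of the intersection of `H` with `ℤ ^ m`. -/
noncomputable def spectrumBound (H : Subgroup (FTA n m)) : ℕ :=
  (restrictedStallings (freePart H)).verts.ncard * largestElementaryDivisor (baseSubmodule H)

end FTA

/-! Bounds. Write `K` for the projection of `H`, let `g = (u, s)`, and let `a` be the order of `u`
in `K`. Some `h ∈ H` has the same free part as `g ^ a`, so `g ^ a = h * (1, y)` with a central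
second factor, and `g ^ (a * i) ∈ H` exactly when `y ^ i` lies in the intersection of `H` with `ℤ ^
m`. Hence the order of `g` is `a` times the order of `y` (`FTA.relOrder_eq_mul`). A positive order
of `y` is at most the largest elementary divisor, because this number annihilates the torsion of the
quotient. A positive order `a` is bounded by a count of vertices. Conjugate `u` to a cyclically
reduced `c`; if `c` is nonempty, the `a` cosets `K v c ^ i`, `i < a`, are distinct and lie on the
closed walk labelled `c ^ a`, which is cyclically reduced and so avoids all hanging trees
(`relOrder_le_ncard_verts`). The automaton is finite because reduced closed walks at the basepoint
stay in a ball of the Schreier automaton.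

Algorithms. A total relation that is semi-decidable has a computable choice function, found by
unbounded search, and a predicate is decidable if it and its negation are semi-decidable. So each
positive or negative fact only needs a checkable certificate. Membership in `H` is certified by a
product of generators. Negative facts about `K` are certified by a finite cover: Marshall Hall's
theorem completes a ball of the Schreier automaton to a finite permutation automaton, here with arcs
labelled in `ℤ ^ m` (`FTA.CoverTable.exists_complete`). The labels also bound `H ∩ ℤ ^ m` from
above, which certifies a diagonal basis for it (`FTA.IsDiagonalCert`). Together these certify
non-membership in `H` (`FTA.semiDec_not_mem_span`).

The vertices of the restricted Stallings automaton of a nontrivial `K` are exactly those on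
nontrivial cyclically reduced closed walks (`restrictedStallings_verts`); a shortest such walk has
bounded length, so the vertices can be counted. With the bound computed, orders follow by testing
finitely many powers.

For the spectrum the infinitely many `g` must be reduced to finitely many. The order `0` is absent
exactly when `H` has finite index, certified by a list of cosets. If `k ≥ 1` is an order, then it is
the order of an element whose free part is short: words acting alike on the finitely many cosets
modulo `H` and `k`-th powers that lie over the ball are interchangeable, and a pumping argument
shortens them (`FTA.exists_short_of_mem_relSpectrum`). For a fixed free part, the central parts that
can give order `k` form finitely many classes modulo `H` (`FTA.omitsOrder_iff`). -/

/-! ## Semi-decidable predicates -/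

section SemiDec

variable {α β σ : Type*} [Primcodable α] [Primcodable β] [Primcodable σ]

/-- A predicate is semi-decidable if it is the projection of a primitive recursive predicate. -/
def SemiDec (p : α → Prop) : Prop :=
  ∃ q : α × ℕ → Prop, PrimrecPred q ∧ ∀ a, p a ↔ ∃ k, q (a, k)

theorem PrimrecPred.semiDec {p : α → Prop} (hp : PrimrecPred p) : SemiDec p :=
  ⟨fun x => p x.1, hp.comp Primrec.fst, fun a => by simp⟩

namespace SemiDec

theorem of_eq {p q : α → Prop} (hp : SemiDec p) (h : ∀ a, p a ↔ q a) : SemiDec q := by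
  obtain ⟨r, hr, hpr⟩ := hp
  exact ⟨r, hr, fun a => (h a).symm.trans (hpr a)⟩

theorem comp {p : β → Prop} (hp : SemiDec p) {f : α → β} (hf : Primrec f) :
    SemiDec fun a => p (f a) := by
  obtain ⟨r, hr, hpr⟩ := hp
  exact ⟨fun x => r (f x.1, x.2), hr.comp ((hf.comp Primrec.fst).pair Primrec.snd),
    fun a => hpr (f a)⟩

theorem and {p q : α → Prop} (hp : SemiDec p) (hq : SemiDec q) : SemiDec fun a => p a ∧ q a := by
  obtain ⟨r, hr, hpr⟩ := hp
  obtain ⟨s, hs, hqs⟩ := hq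
  refine ⟨fun x => r (x.1, x.2.unpair.1) ∧ s (x.1, x.2.unpair.2), ?_, fun a => ?_⟩
  · have h := Primrec.unpair.comp (Primrec.snd (α := α) (β := ℕ))
    exact (hr.comp (Primrec.fst.pair (Primrec.fst.comp h))).and
      (hs.comp (Primrec.fst.pair (Primrec.snd.comp h)))
  · simp only [hpr, hqs]
    constructor
    · rintro ⟨⟨i, hi⟩, j, hj⟩
      exact ⟨Nat.pair i j, by simpa using ⟨hi, hj⟩⟩
    · rintro ⟨k, h1, h2⟩
      exact ⟨⟨_, h1⟩, _, h2⟩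

theorem or {p q : α → Prop} (hp : SemiDec p) (hq : SemiDec q) : SemiDec fun a => p a ∨ q a := by
  obtain ⟨r, hr, hpr⟩ := hp
  obtain ⟨s, hs, hqs⟩ := hq
  refine ⟨fun x => r x ∨ s x, hr.or hs, fun a => ?_⟩
  simp only [hpr, hqs, exists_or]

/-- A single search parameter codes both the witness `b` and the stage at which `r a b` is
confirmed. -/
theorem ex {r : α → β → Prop} (h : SemiDec fun x : α × β => r x.1 x.2) :
    SemiDec fun a => ∃ b, r a b := by
  obtain ⟨s, hs, hrs⟩ := h
  obtain ⟨_, hs'⟩ := hs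
  refine ⟨fun x => ∃ b, Encodable.decode (α := β) x.2.unpair.1 = some b ∧
      s ((x.1, b), x.2.unpair.2), ?_, fun a => ?_⟩
  · classical
    refine Primrec.primrecPred ?_
    have h := Primrec.unpair.comp (Primrec.snd (α := α) (β := ℕ))
    have h1 : Primrec fun x : α × ℕ =>
        (Encodable.decode (α := β) x.2.unpair.1).bind
          fun b => if decide (s ((x.1, b), x.2.unpair.2)) = true then some () else none := by
      refine Primrec.option_bind (Primrec.decode.comp (Primrec.fst.comp h)) ?_
      refine Primrec.ite (Primrec.eq.comp (hs'.comp ?_) (Primrec.const true))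
        (Primrec.const _) (Primrec.const _)
      exact ((Primrec.fst.comp Primrec.fst).pair Primrec.snd).pair
        (Primrec.snd.comp (h.comp Primrec.fst))
    refine (Primrec.option_isSome.comp h1).of_eq fun x => ?_
    rw [Bool.eq_iff_iff, decide_eq_true_iff, Option.isSome_iff_exists]
    constructor
    · rintro ⟨u, hu⟩
      obtain ⟨b, hb, hb'⟩ := Option.bind_eq_some_iff.1 hu
      refine ⟨b, hb, ?_⟩
      by_contra hcon
      simp [hcon] at hb'
    · rintro ⟨b, hb, hb'⟩
      exact ⟨(), Option.bind_eq_some_iff.2 ⟨b, hb, by simp [hb']⟩⟩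
  · constructor
    · rintro ⟨b, hb⟩
      obtain ⟨k, hk⟩ := (hrs (a, b)).1 hb
      exact ⟨Nat.pair (Encodable.encode b) k, b, by simp, by simpa using hk⟩
    · rintro ⟨k, b, _, hk⟩
      exact ⟨b, (hrs (a, b)).2 ⟨_, hk⟩⟩

/-- Bounded universal quantification over the elements of a list. -/
theorem ball {r : α → β → Prop} {l : α → List β} (hl : Primrec l)
    (h : SemiDec fun x : α × β => r x.1 x.2) : SemiDec fun a => ∀ b ∈ l a, r a b := by
  obtain ⟨s, hs, hrs⟩ := h
  have h1 : PrimrecRel fun (k : ℕ) (x : α × β) => s (x, k) :=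
    hs.comp (Primrec.snd.pair Primrec.fst)
  have h3 : PrimrecRel fun (b : β) (y : α × ℕ) => ∃ k < y.2, s ((y.1, b), k) := by
    have h2 : PrimrecRel fun (L : List ℕ) (x : α × β) => ∃ k ∈ L, s (x, k) := h1.exists_mem_list
    refine PrimrecPred.of_eq (h2.comp
      (f := fun z : β × α × ℕ => List.range z.2.2) (g := fun z => (z.2.1, z.1))
      (Primrec.list_range.comp (Primrec.snd.comp Primrec.snd))
      ((Primrec.fst.comp Primrec.snd).pair Primrec.fst)) fun z => by simp
  -- One number bounds the confirmation stages of all elements of the list, and the search below it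
  -- is primitive recursive.
  refine ⟨fun y => ∀ b ∈ l y.1, ∃ k < y.2, s ((y.1, b), k),
    h3.forall_mem_list.comp (hl.comp Primrec.fst) Primrec.id, fun a => ?_⟩
  constructor
  · intro h
    have h' : ∀ b ∈ l a, ∃ k, s ((a, b), k) := fun b hb => (hrs (a, b)).1 (h b hb)
    choose! f hf using h'
    refine ⟨((l a).map f).sum + 1, fun b hb => ⟨f b, ?_, hf b hb⟩⟩
    exact Nat.lt_succ_of_le (List.le_sum_of_mem (List.mem_map_of_mem hb))
  · rintro ⟨K, hK⟩ b hb
    obtain ⟨k, _, hk⟩ := hK b hb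
    exact (hrs (a, b)).2 ⟨k, hk⟩

/-- Bounded existential quantification over the elements of a list. -/
theorem bex {r : α → β → Prop} {l : α → List β} (hl : Primrec l)
    (h : SemiDec fun x : α × β => r x.1 x.2) : SemiDec fun a => ∃ b ∈ l a, r a b := by
  refine ex (r := fun a b => b ∈ l a ∧ r a b) (and ?_ h)
  have h1 : PrimrecRel fun (L : List β) (b : β) => ∃ c ∈ L, c = b :=
    PrimrecRel.exists_mem_list Primrec.eq
  exact ((h1.comp (hl.comp Primrec.fst) Primrec.snd).of_eq fun x => by simp).semiDec

theorem ball_lt {r : α → ℕ → Prop} {f : α → ℕ} (hf : Primrec f)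
    (h : SemiDec fun x : α × ℕ => r x.1 x.2) : SemiDec fun a => ∀ b < f a, r a b :=
  (ball (Primrec.list_range.comp hf) h).of_eq fun a => by simp

theorem all_fin {k : ℕ} {r : Fin k → α → Prop} (h : ∀ i, SemiDec (r i)) :
    SemiDec fun a => ∀ i, r i a := by
  induction k with
  | zero =>
    have h0 : PrimrecPred fun _ : α => True := ⟨fun _ => isTrue trivial, Primrec.const true⟩
    exact h0.semiDec.of_eq fun a => by simp
  | succ k ih =>
    exact ((h 0).and (ih fun i => h i.succ)).of_eq fun a => by rw [Fin.forall_fin_succ]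

/-- A total semi-decidable relation is uniformized by a computable function. -/
theorem exists_computable {r : α → σ → Prop} (h : SemiDec fun x : α × σ => r x.1 x.2)
    (htot : ∀ a, ∃ b, r a b) : ∃ f : α → σ, Computable f ∧ ∀ a, r a (f a) := by
  obtain ⟨s, hs, hrs⟩ := h
  obtain ⟨_, hs'⟩ := hs
  -- The number `k` is read as a pair of a candidate value and a stage; the search over `k` stops at
  -- the first confirmed candidate.
  let F : α → ℕ → Option σ := fun a k =>
    (Encodable.decode (α := σ) k.unpair.1).bind
      fun b => if decide (s ((a, b), k.unpair.2)) = true then some b else none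
  have hF : Primrec₂ F := by
    have h := Primrec.unpair.comp (Primrec.snd (α := α) (β := ℕ))
    refine Primrec.option_bind (Primrec.decode.comp (Primrec.fst.comp h)) ?_
    refine Primrec.ite (Primrec.eq.comp (hs'.comp ?_) (Primrec.const true))
      (Primrec.option_some.comp Primrec.snd) (Primrec.const _)
    exact ((Primrec.fst.comp Primrec.fst).pair Primrec.snd).pair
      (Primrec.snd.comp (h.comp Primrec.fst))
  have hFr : ∀ a k b, F a k = some b → r a b := by
    intro a k b hb
    obtain ⟨c, _, hc⟩ := Option.bind_eq_some_iff.1 hb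
    by_cases hcs : s ((a, c), k.unpair.2)
    · simp only [hcs, decide_true, if_true, Option.some.injEq] at hc
      subst hc
      exact (hrs (a, c)).2 ⟨_, hcs⟩
    · simp [hcs] at hc
  have hdom : ∀ a, (Nat.rfindOpt (F a)).Dom := by
    intro a
    obtain ⟨b, hb⟩ := htot a
    obtain ⟨k, hk⟩ := (hrs (a, b)).1 hb
    refine Nat.rfindOpt_dom.2 ⟨Nat.pair (Encodable.encode b) k, b, ?_⟩
    simp [F, hk]
  refine ⟨fun a => (Nat.rfindOpt (F a)).get (hdom a),
    (Partrec.rfindOpt hF.to_comp).of_eq_tot fun a => Part.get_mem _, fun a => ?_⟩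
  obtain ⟨k, hk⟩ := Nat.rfindOpt_spec (Part.get_mem (hdom a))
  exact hFr a k _ hk

theorem computable {f : α → σ} (h : SemiDec fun x : α × σ => f x.1 = x.2) : Computable f := by
  obtain ⟨g, hg, hfg⟩ := exists_computable (r := fun a b => f a = b) h fun a => ⟨_, rfl⟩
  exact hg.of_eq fun a => (hfg a).symm

/-- **Post's theorem.** -/
theorem computablePred {p : α → Prop} (hp : SemiDec p) (hn : SemiDec fun a => ¬ p a) :
    ComputablePred p := by
  classical
  refine ⟨fun _ => Classical.dec _, computable ?_⟩
  have h1 : PrimrecPred fun x : α × Bool => x.2 = true :=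
    Primrec.eq.comp Primrec.snd (Primrec.const true)
  have h2 : PrimrecPred fun x : α × Bool => x.2 = false :=
    Primrec.eq.comp Primrec.snd (Primrec.const false)
  refine ((h1.semiDec.and (hp.comp Primrec.fst)).or
    (h2.semiDec.and (hn.comp Primrec.fst))).of_eq ?_
  rintro ⟨a, b⟩
  cases b <;> simp

end SemiDec

end SemiDec

/-! ## Reduced words -/

namespace FreeGroup

variable {X : Type*}

/-- The formal inverse of a letter. -/
def letterInv (a : X × Bool) : X × Bool := (a.1, !a.2)

@[simp] theorem letterInv_letterInv (a : X × Bool) : letterInv (letterInv a) = a := by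
  simp [letterInv]

theorem invRev_singleton (a : X × Bool) : invRev [a] = [letterInv a] := rfl

theorem invRev_cons_eq (a : X × Bool) (w : List (X × Bool)) :
    invRev (a :: w) = invRev w ++ [letterInv a] := by
  rw [invRev_cons, invRev_singleton]

theorem invRev_concat (a : X × Bool) (w : List (X × Bool)) :
    invRev (w ++ [a]) = letterInv a :: invRev w := by
  rw [invRev_append, invRev_singleton, List.singleton_append]

theorem invRev_eq_nil {w : List (X × Bool)} : invRev w = [] ↔ w = [] := by
  rw [← List.length_eq_zero_iff, invRev_length, List.length_eq_zero_iff]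

theorem mk_singleton_letterInv (a : X × Bool) : mk [letterInv a] = (mk [a])⁻¹ := by
  rw [inv_mk, invRev_singleton]

theorem mk_append (u v : List (X × Bool)) : mk (u ++ v) = mk u * mk v := mul_mk.symm

theorem mk_cons (a : X × Bool) (v : List (X × Bool)) : mk (a :: v) = mk [a] * mk v := by
  rw [← mk_append, List.singleton_append]

theorem mk_invRev (u : List (X × Bool)) : mk (invRev u) = (mk u)⁻¹ := inv_mk.symm

theorem compat_iff {a b : X × Bool} : (a.1 = b.1 → a.2 = b.2) ↔ b ≠ letterInv a := by
  obtain ⟨x, s⟩ := a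
  obtain ⟨y, t⟩ := b
  simp only [letterInv, ne_eq, Prod.mk.injEq, not_and]
  constructor
  · rintro h rfl h'
    rw [h rfl] at h'
    simp at h'
  · rintro h rfl
    have := h rfl
    cases s <;> cases t <;> simp_all

theorem isReduced_append {u v : List (X × Bool)} :
    IsReduced (u ++ v) ↔ IsReduced u ∧ IsReduced v ∧
      ∀ a ∈ u.getLast?, ∀ b ∈ v.head?, b ≠ letterInv a := by
  simp only [IsReduced, List.isChain_append, compat_iff]

theorem isReduced_concat_append_cons {u v : List (X × Bool)} {a b : X × Bool} :
    IsReduced (u ++ [a] ++ b :: v) ↔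
      IsReduced (u ++ [a]) ∧ IsReduced (b :: v) ∧ b ≠ letterInv a := by
  rw [isReduced_append, List.getLast?_concat]
  simp

theorem IsReduced.left {u v : List (X × Bool)} (h : IsReduced (u ++ v)) : IsReduced u :=
  (isReduced_append.1 h).1

theorem IsReduced.right {u v : List (X × Bool)} (h : IsReduced (u ++ v)) : IsReduced v :=
  (isReduced_append.1 h).2.1

theorem getLast?_invRev (w : List (X × Bool)) : (invRev w).getLast? = w.head?.map letterInv := by
  simp only [invRev, List.getLast?_reverse, List.head?_map]
  rfl

theorem head?_invRev (w : List (X × Bool)) : (invRev w).head? = w.getLast?.map letterInv := by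
  simp only [invRev, List.head?_reverse, List.getLast?_map]
  rfl

theorem IsReduced.invRev {w : List (X × Bool)} (h : IsReduced w) :
    IsReduced (FreeGroup.invRev w) := by
  induction w with
  | nil => simp
  | cons a w ih =>
    rw [invRev_cons_eq, isReduced_append]
    refine ⟨ih (IsReduced.right (u := [a]) h), IsReduced.singleton, ?_⟩
    rw [getLast?_invRev]
    intro c hc b hb
    obtain ⟨d, hd, rfl⟩ := Option.mem_map.1 hc
    simp only [List.head?_cons, Option.mem_def, Option.some.injEq] at hb
    subst hb
    rw [letterInv_letterInv]
    have h' : IsReduced ([a] ++ w) := h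
    have := (isReduced_append.1 h').2.2 a (by simp) d hd
    exact this.symm

theorem isCyclicallyReduced_iff_append_self {w : List (X × Bool)} :
    IsCyclicallyReduced w ↔ IsReduced (w ++ w) := by
  simp only [IsCyclicallyReduced, compat_iff, isReduced_append]
  tauto

/-- The square of the rotated word, `v u v u`, is an infix of the cube of `u v`. -/
theorem IsCyclicallyReduced.rotate {u v : List (X × Bool)} (h : IsCyclicallyReduced (u ++ v)) :
    IsCyclicallyReduced (v ++ u) := by
  rw [isCyclicallyReduced_iff_append_self]
  have h3 := (h.flatten_replicate 3).isReduced
  refine h3.infix ⟨u, v, ?_⟩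
  simp [List.replicate]

theorem IsCyclicallyReduced.invRev {w : List (X × Bool)} (h : IsCyclicallyReduced w) :
    IsCyclicallyReduced (FreeGroup.invRev w) := by
  rw [isCyclicallyReduced_iff_append_self] at h ⊢
  rw [← invRev_append]
  exact h.invRev

/-- A reduced word that is not cyclically reduced begins with a letter and ends with its inverse. -/
theorem IsReduced.exists_of_not_isCyclicallyReduced {w : List (X × Bool)} (h : IsReduced w)
    (hc : ¬ IsCyclicallyReduced w) : ∃ x v, w = x :: (v ++ [letterInv x]) := by
  rcases w with _ | ⟨a, w⟩
  · simp at hc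
  rcases List.eq_nil_or_concat w with rfl | ⟨v, b, rfl⟩
  · simp at hc
  refine ⟨a, v, ?_⟩
  rw [List.concat_eq_append] at h hc ⊢
  by_contra hne
  refine hc (isCyclicallyReduced_iff_append_self.2 ?_)
  have : a :: (v ++ [b]) ++ a :: (v ++ [b]) = (a :: v) ++ [b] ++ a :: (v ++ [b]) := by simp
  rw [this, isReduced_concat_append_cons]
  refine ⟨by simpa using h, h, fun hab => hne ?_⟩
  rw [hab, letterInv_letterInv]

theorem not_isCyclicallyReduced_cons_append (x : X × Bool) (v : List (X × Bool)) :
    ¬ IsCyclicallyReduced (x :: (v ++ [letterInv x])) := by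
  rw [isCyclicallyReduced_iff_append_self]
  have : x :: (v ++ [letterInv x]) ++ x :: (v ++ [letterInv x])
      = (x :: v) ++ [letterInv x] ++ x :: (v ++ [letterInv x]) := by simp
  rw [this, isReduced_concat_append_cons]
  simp

theorem IsReduced.toWord_mk [DecidableEq X] {w : List (X × Bool)} (h : IsReduced w) :
    (mk w).toWord = w := by
  rw [FreeGroup.toWord_mk, h.reduce_eq]

theorem IsReduced.eq_of_mk_eq {u v : List (X × Bool)} (hu : IsReduced u) (hv : IsReduced v)
    (h : mk u = mk v) : u = v := by
  classical
  rw [← hu.toWord_mk, h, hv.toWord_mk]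

theorem IsReduced.mk_ne_one {w : List (X × Bool)} (h : IsReduced w) (hw : w ≠ []) :
    mk w ≠ 1 := fun h1 => hw (h.eq_of_mk_eq IsReduced.nil h1)

/-- Multiplication on the right by a word of length `k` keeps all but the last `k` letters of a
reduced word. -/
theorem IsReduced.take_prefix_toWord [DecidableEq X] {u : List (X × Bool)} (hu : IsReduced u)
    (v : List (X × Bool)) : u.take (u.length - v.length) <+: (mk (u ++ v)).toWord := by
  induction v generalizing u with
  | nil => simp [hu.toWord_mk]
  | cons a v ih =>
    by_cases h : IsReduced (u ++ [a])
    · have h1 := ih h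
      have h2 : u ++ a :: v = u ++ [a] ++ v := by simp
      rw [h2]
      refine List.IsPrefix.trans ?_ h1
      simp only [List.length_append, List.length_cons, List.length_nil]
      rw [← List.take_append_of_le_length (l₁ := u) (l₂ := [a]) (i := u.length - (v.length + 1))
        (by omega)]
      exact List.take_prefix_take_left (by omega)
    · rcases List.eq_nil_or_concat u with rfl | ⟨u', b, rfl⟩
      · simp at h
      rw [List.concat_eq_append] at *
      have hab : a = letterInv b := by
        by_contra hne
        exact h (isReduced_concat_append_cons.2 ⟨hu, IsReduced.singleton, hne⟩)
      have h1 := ih hu.left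
      have h2 : mk (u' ++ [b] ++ a :: v) = mk (u' ++ v) := by
        rw [mk_append, mk_append, mk_cons a v, hab, mk_singleton_letterInv, mk_append]
        group
      rw [h2]
      refine List.IsPrefix.trans ?_ h1
      simp only [List.length_append, List.length_cons, List.length_nil]
      rw [List.take_append_of_le_length (by omega)]
      exact List.take_prefix_take_left (by omega)

/-- Every element is a conjugate of one that is represented by a cyclically reduced word. -/
theorem exists_conj_isCyclicallyReduced (u : FreeGroup X) :
    ∃ v c : List (X × Bool), IsCyclicallyReduced c ∧ u = mk v * mk c * (mk v)⁻¹ := by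
  classical
  refine ⟨reduceCyclically.conjugator u.toWord, reduceCyclically u.toWord,
    reduceCyclically.isCyclicallyReduced isReduced_toWord, ?_⟩
  conv_lhs => rw [← mk_toWord (x := u),
    ← reduceCyclically.conj_conjugator_reduceCyclically u.toWord]
  rw [mk_append, mk_append, mk_invRev]

theorem mk_flatten_replicate (c : List (X × Bool)) (k : ℕ) :
    mk (List.replicate k c).flatten = mk c ^ k := by
  induction k with
  | zero => rfl
  | succ k ih => rw [List.replicate_succ, List.flatten_cons, mk_append, ih, pow_succ']

end FreeGroup

/-! ## Walks -/

namespace InvDigraph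

variable {X V : Type*} {A : InvDigraph X V}

theorem Walk.left_mem {p q : V} {w : List (X × Bool)} (h : A.Walk p w q) : p ∈ A.verts := by
  cases h with
  | nil h => exact h
  | cons h _ => exact A.mem_verts h

theorem Walk.append {p q r : V} {u v : List (X × Bool)} (h : A.Walk p u q) (h' : A.Walk q v r) :
    A.Walk p (u ++ v) r := by
  induction h with
  | nil _ => exact h'
  | cons ha _ ih => exact Walk.cons ha (ih h')

theorem walk_singleton {p q : V} {a : X × Bool} (h : A.arc p a q) : A.Walk p [a] q :=
  Walk.cons h (Walk.nil (A.mem_verts (A.arc_inv h)))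

theorem Walk.invRev {p q : V} {w : List (X × Bool)} (h : A.Walk p w q) :
    A.Walk q (FreeGroup.invRev w) p := by
  induction h with
  | nil h => exact Walk.nil h
  | cons ha _ ih =>
    rw [FreeGroup.invRev_cons_eq]
    exact ih.append (walk_singleton (A.arc_inv ha))

theorem mem_restrict_verts {S E : Set V} {p : V} :
    p ∈ (A.restrict S E).verts ↔ p ∈ S ∧ p ∈ A.verts := Iff.rfl

theorem restrict_arc {S E : Set V} {p q : V} {a : X × Bool} :
    (A.restrict S E).arc p a q ↔ A.arc p a q ∧ p ∈ S ∧ q ∈ S ∧ (p ∉ E ∨ q ∉ E) := Iff.rfl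

/-- A walk that starts in a hanging tree stays there or visits the vertex where it is attached. -/
theorem IsHangingTree.walk_or {p : V} {B : Set V} (hB : A.IsHangingTree p B) {q r : V}
    {w : List (X × Bool)} (hw : A.Walk q w r) (hq : q ∈ insert p B) :
    (A.restrict (insert p B) {p}).Walk q w r ∨
      ∃ u v, w = u ++ v ∧ (A.restrict (insert p B) {p}).Walk q u p := by
  induction hw with
  | nil h => exact Or.inl (Walk.nil ⟨hq, h⟩)
  | @cons q q' r a w ha hw ih =>
    by_cases hqp : q = p
    · subst hqp
      exact Or.inr ⟨[], _, rfl, Walk.nil ⟨hq, hB.1⟩⟩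
    · have hqB : q ∈ B := (Set.mem_insert_iff.1 hq).resolve_left hqp
      have hq' := hB.2.2.2.1 q hqB a q' ha
      have ha' : (A.restrict (insert p B) {p}).arc q a q' := ⟨ha, hq, hq', Or.inl hqp⟩
      rcases ih hq' with h | ⟨u, v, rfl, h⟩
      · exact Or.inl (Walk.cons ha' h)
      · exact Or.inr ⟨a :: u, v, rfl, Walk.cons ha' h⟩

/-- A vertex on a nontrivial cyclically reduced closed walk is not in a hanging tree. -/
theorem IsHangingTree.not_mem_of_walk {p : V} {B : Set V} (hB : A.IsHangingTree p B) {q : V}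
    {w : List (X × Bool)} (hw : A.Walk q w q) (hc : FreeGroup.IsCyclicallyReduced w)
    (hne : w ≠ []) : q ∉ B := by
  intro hqB
  have hq : q ∈ insert p B := Set.mem_insert_of_mem _ hqB
  have hqv := hw.left_mem
  have huniq := hB.2.2.2.2.2
  have hqp : q ≠ p := by
    rintro rfl
    exact hB.2.2.1 hqB
  -- A closed walk that never leaves the tree would be the empty one by uniqueness. So the walk
  -- reaches `p`, and so does its inverse.
  rcases hB.walk_or hw hq with h | ⟨u, v, hu, h⟩
  · exact hne ((huniq q ⟨hq, hqv⟩ q ⟨hq, hqv⟩).unique ⟨hc.isReduced, h⟩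
      ⟨FreeGroup.IsReduced.nil, Walk.nil ⟨hq, hqv⟩⟩)
  rcases hB.walk_or hw.invRev hq with h' | ⟨u', v', hu', h'⟩
  · have hnil := (huniq q ⟨hq, hqv⟩ q ⟨hq, hqv⟩).unique ⟨hc.isReduced.invRev, h'⟩
      ⟨FreeGroup.IsReduced.nil, Walk.nil ⟨hq, hqv⟩⟩
    exact hne (FreeGroup.invRev_eq_nil.1 hnil)
  · have hr : FreeGroup.IsReduced u := (hu ▸ hc.isReduced).left
    have hr' : FreeGroup.IsReduced u' := (hu' ▸ hc.isReduced.invRev).left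
    -- Both initial segments are the unique reduced walk from `q` to `p`. Hence `w` and its inverse
    -- begin with the same letter, that is, `w` ends with the inverse of its first letter.
    have heq := (huniq q ⟨hq, hqv⟩ p ⟨Set.mem_insert _ _, hB.1⟩).unique ⟨hr, h⟩ ⟨hr', h'⟩
    subst heq
    rcases u with _ | ⟨a, u⟩
    · cases h
      exact hqp rfl
    · have h1 : w.head? = some a := by simp [hu]
      have h2 : w.getLast? = some (FreeGroup.letterInv a) := by
        have h3 : (FreeGroup.invRev w).head? = some a := by simp [hu']
        rw [FreeGroup.head?_invRev] at h3
        obtain ⟨b, hb, hba⟩ := Option.map_eq_some_iff.1 h3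
        rw [hb, ← hba, FreeGroup.letterInv_letterInv]
      have h4 := hc.2 _ h2 _ h1 rfl
      simp [FreeGroup.letterInv] at h4

end InvDigraph

/-! ## Schreier and Stallings automata -/

section Stallings

open FreeGroup

variable {X : Type*} {K : Subgroup (FreeGroup X)}

theorem rightCoset_eq_rightCoset {u v : FreeGroup X} :
    rightCoset K u = rightCoset K v ↔ u * v⁻¹ ∈ K := by
  have h : rightCoset K u = rightCoset K v ↔ rightCoset K v = rightCoset K u := eq_comm
  rw [h]
  unfold rightCoset
  rw [Quotient.eq, QuotientGroup.rightRel_apply]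

theorem exists_rightCoset (q : RightCosets K) : ∃ u, q = rightCoset K u := by
  induction q using Quotient.inductionOn with
  | h u => exact ⟨u, rfl⟩

theorem exists_rightCoset_mk (q : RightCosets K) : ∃ w, q = rightCoset K (mk w) := by
  classical
  obtain ⟨u, rfl⟩ := exists_rightCoset q
  exact ⟨u.toWord, by rw [mk_toWord]⟩

theorem schreier_arc {u : FreeGroup X} {a : X × Bool} {q : RightCosets K} :
    (schreier K).arc (rightCoset K u) a q ↔ q = rightCoset K (u * mk [a]) := by
  constructor
  · rintro ⟨w, hw, rfl⟩
    exact rightCoset_mul hw.symm _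
  · rintro rfl
    exact ⟨u, rfl, rfl⟩

theorem schreier_walk {u : FreeGroup X} {w : List (X × Bool)} {q : RightCosets K} :
    (schreier K).Walk (rightCoset K u) w q ↔ q = rightCoset K (u * mk w) := by
  induction w generalizing u with
  | nil =>
    rw [← FreeGroup.one_eq_mk, mul_one]
    constructor
    · intro h
      cases h
      rfl
    · rintro rfl
      exact InvDigraph.Walk.nil (Set.mem_univ _)
  | cons a w ih =>
    rw [mk_cons, ← mul_assoc]
    constructor
    · intro h
      cases h with
      | cons ha hw =>
        rw [schreier_arc.1 ha] at hw
        exact ih.1 hw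
    · intro h
      exact InvDigraph.Walk.cons (schreier_arc.2 rfl) (ih.2 h)

theorem mem_stallings_verts {q : RightCosets K} :
    q ∈ (stallings K).verts ↔ ∃ w₁ w₂ : List (X × Bool), IsReduced (w₁ ++ w₂) ∧
      q = rightCoset K (mk w₁) ∧ mk (w₁ ++ w₂) ∈ K := by
  unfold stallings InvDigraph.core
  rw [InvDigraph.mem_restrict_verts]
  constructor
  · rintro ⟨⟨w₁, w₂, hr, h1, h2⟩, -⟩
    rw [schreier_walk, one_mul] at h1
    subst h1
    rw [schreier_walk, rightCoset_eq_rightCoset, ← mk_append, one_mul] at h2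
    exact ⟨w₁, w₂, hr, rfl, by simpa using K.inv_mem h2⟩
  · rintro ⟨w₁, w₂, hr, rfl, h⟩
    refine ⟨⟨w₁, w₂, hr, ?_, ?_⟩, Set.mem_univ _⟩
    · rw [schreier_walk, one_mul]
    · rw [schreier_walk, rightCoset_eq_rightCoset, ← mk_append, one_mul]
      exact K.inv_mem h

theorem stallings_arc {p q : RightCosets K} {a : X × Bool} :
    (stallings K).arc p a q ↔
      (schreier K).arc p a q ∧ p ∈ (stallings K).verts ∧ q ∈ (stallings K).verts := by
  unfold stallings InvDigraph.core
  rw [InvDigraph.restrict_arc, InvDigraph.mem_restrict_verts, InvDigraph.mem_restrict_verts]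
  simp [schreier]

/-- The vertices of the Schreier automaton that lie on a nontrivial cyclically reduced closed
walk. -/
def cyclicVerts (K : Subgroup (FreeGroup X)) : Set (RightCosets K) :=
  {q | ∃ u : FreeGroup X, ∃ z : List (X × Bool), q = rightCoset K u ∧ z ≠ [] ∧
    IsCyclicallyReduced z ∧ u * mk z * u⁻¹ ∈ K}

theorem conj_mem_iff {u v : FreeGroup X} (h : rightCoset K u = rightCoset K v) (g : FreeGroup X) :
    u * g * u⁻¹ ∈ K ↔ v * g * v⁻¹ ∈ K := by
  rw [rightCoset_eq_rightCoset] at h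
  have h1 : v * g * v⁻¹ = (u * v⁻¹)⁻¹ * (u * g * u⁻¹) * (u * v⁻¹) := by group
  rw [h1, K.mul_mem_cancel_right h, K.mul_mem_cancel_left (K.inv_mem h)]

theorem mem_cyclicVerts {u : FreeGroup X} :
    rightCoset K u ∈ cyclicVerts K ↔ ∃ z : List (X × Bool), z ≠ [] ∧
      IsCyclicallyReduced z ∧ u * mk z * u⁻¹ ∈ K := by
  constructor
  · rintro ⟨v, z, hv, hz, hc, hm⟩
    exact ⟨z, hz, hc, (conj_mem_iff hv _).2 hm⟩
  · rintro ⟨z, hz, hc, hm⟩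
    exact ⟨u, z, rfl, hz, hc, hm⟩

/-- All the vertices of a cyclically reduced closed walk lie on a cyclically reduced closed walk. -/
theorem mem_cyclicVerts_of_append {u : FreeGroup X} {z₁ z₂ : List (X × Bool)}
    (hne : z₁ ++ z₂ ≠ []) (hc : IsCyclicallyReduced (z₁ ++ z₂))
    (hm : u * mk (z₁ ++ z₂) * u⁻¹ ∈ K) : rightCoset K (u * mk z₁) ∈ cyclicVerts K := by
  refine mem_cyclicVerts.2 ⟨z₂ ++ z₁, ?_, hc.rotate, ?_⟩
  · intro h
    apply hne
    rw [List.append_eq_nil_iff] at h ⊢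
    exact h.symm
  · rw [mk_append] at hm ⊢
    have : u * mk z₁ * (mk z₂ * mk z₁) * (u * mk z₁)⁻¹ = u * (mk z₁ * mk z₂) * u⁻¹ := by group
    rwa [this]

/-- Go out along a reduced word `c`, run around the cycle more than `|c|` times, and return along
the inverse of `c`. The return cancels too little to reach `c`, so the reduced form of this closed
walk still passes through the vertex. -/
theorem cyclicVerts_subset_stallings : cyclicVerts K ⊆ (stallings K).verts := by
  classical
  rintro q hq
  obtain ⟨u, rfl⟩ := exists_rightCoset q
  obtain ⟨z, hz, hc, hm⟩ := mem_cyclicVerts.1 hq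
  have key : ∀ z : List (X × Bool), z ≠ [] → IsCyclicallyReduced z → u * mk z * u⁻¹ ∈ K →
      IsReduced (u.toWord ++ z) → rightCoset K u ∈ (stallings K).verts := by
    intro z hz hc hm hr
    set c := u.toWord with hcu
    have hcu' : mk c = u := mk_toWord
    -- The return path has length `|c|`, hence destroys at most `|c|` letters, while `N` copies of
    -- the nonempty `z` have at least `|c| + 1`.
    set N := c.length + 1
    have hred : IsReduced (c ++ (List.replicate N z).flatten) := by
      have := IsReduced.append_flatten_replicate_append (L₁ := c) (L₂ := z) (L₃ := []) hc
        (by simpa using hr) (n := N) (by omega)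
      simpa using this
    have hpre := hred.take_prefix_toWord (invRev c)
    have hzl : N ≤ (List.replicate N z).flatten.length := by
      have : 1 ≤ z.length := List.length_pos_iff.2 hz
      simp only [List.length_flatten, List.map_replicate, List.sum_replicate, smul_eq_mul]
      nlinarith
    have hpre2 : c <+: (mk (c ++ (List.replicate N z).flatten ++ invRev c)).toWord := by
      refine List.IsPrefix.trans ?_ hpre
      refine List.prefix_take_iff.2 ⟨List.prefix_append _ _, ?_⟩
      rw [List.length_append, invRev_length]
      omega
    obtain ⟨w₂, hw₂⟩ := hpre2
    refine mem_stallings_verts.2 ⟨c, w₂, ?_, by rw [hcu'], ?_⟩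
    · rw [hw₂]
      exact isReduced_toWord
    · rw [hw₂, mk_toWord, mk_append, mk_append, mk_flatten_replicate, mk_invRev, hcu', ← conj_pow]
      exact K.pow_mem hm N
  by_cases hr : IsReduced (u.toWord ++ z)
  · exact key z hz hc hm hr
  -- If `z` cancels against the last letter of the path, its inverse does not: otherwise `z` would
  -- end with the inverse of its first letter.
  · refine key (invRev z) (fun h => hz (invRev_eq_nil.1 h)) hc.invRev ?_ ?_
    · rw [mk_invRev]
      have : u * (mk z)⁻¹ * u⁻¹ = (u * mk z * u⁻¹)⁻¹ := by group
      rw [this]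
      exact K.inv_mem hm
    · rw [isReduced_append] at hr ⊢
      refine ⟨isReduced_toWord, hc.isReduced.invRev, ?_⟩
      intro a ha b hb hab
      apply hr
      refine ⟨isReduced_toWord, hc.isReduced, ?_⟩
      intro a' ha' b' hb' hab'
      rw [Option.mem_unique ha' ha] at hab'
      rw [head?_invRev] at hb
      obtain ⟨d, hd, hdb⟩ := Option.mem_map.1 hb
      have hda : d = a := by
        rw [← letterInv_letterInv d, hdb, hab, letterInv_letterInv]
      have := compat_iff.1 (hc.2 d hd b' hb')
      rw [hab', hda] at this
      exact this rfl

/-- The suffix `z₂` is read inside the core because every vertex of a cyclically reduced closed walk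
lies on a rotation of it. -/
theorem stallings_walk {u : FreeGroup X} {z₁ z₂ : List (X × Bool)} (hne : z₁ ++ z₂ ≠ [])
    (hc : IsCyclicallyReduced (z₁ ++ z₂)) (hm : u * mk (z₁ ++ z₂) * u⁻¹ ∈ K) :
    (stallings K).Walk (rightCoset K (u * mk z₁)) z₂ (rightCoset K (u * mk (z₁ ++ z₂))) := by
  induction z₂ generalizing z₁ with
  | nil =>
    rw [List.append_nil]
    exact InvDigraph.Walk.nil (cyclicVerts_subset_stallings (mem_cyclicVerts_of_append hne hc hm))
  | cons a z₂ ih =>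
    have h1 : z₁ ++ a :: z₂ = z₁ ++ [a] ++ z₂ := by simp
    have hmem := cyclicVerts_subset_stallings (mem_cyclicVerts_of_append hne hc hm)
    rw [h1] at hne hc hm ⊢
    refine InvDigraph.Walk.cons (stallings_arc.2 ⟨schreier_arc.2 ?_, hmem,
      cyclicVerts_subset_stallings (mem_cyclicVerts_of_append hne hc hm)⟩) (ih hne hc hm)
    rw [mk_append, mul_assoc]

theorem cyclicVerts_subset_restrictedStallings :
    cyclicVerts K ⊆ (restrictedStallings K).verts := by
  intro q hq
  refine InvDigraph.mem_restrict_verts.2 ⟨?_, cyclicVerts_subset_stallings hq⟩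
  rintro ⟨p, B, hB, hqB⟩
  obtain ⟨u, rfl⟩ := exists_rightCoset q
  obtain ⟨z, hz, hc, hm⟩ := mem_cyclicVerts.1 hq
  have hw := stallings_walk (z₁ := []) (z₂ := z) (by simpa using hz) (by simpa using hc)
    (by simpa using hm)
  rw [← FreeGroup.one_eq_mk, mul_one, List.nil_append] at hw
  have h1 : rightCoset K (u * mk z) = rightCoset K u := by
    rw [rightCoset_eq_rightCoset]
    exact hm
  rw [h1] at hw
  exact hB.not_mem_of_walk hw hc hz hqB

theorem restrictedStallings_verts_bot (hK : K = ⊥) :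
    (restrictedStallings K).verts = {rightCoset K 1} := by
  have hcore : (stallings K).verts = {rightCoset K 1} := by
    ext q
    rw [mem_stallings_verts, Set.mem_singleton_iff]
    constructor
    · rintro ⟨w₁, w₂, hr, rfl, hm⟩
      rw [hK, Subgroup.mem_bot] at hm
      have := hr.eq_of_mk_eq IsReduced.nil hm
      rw [List.append_eq_nil_iff] at this
      rw [this.1, FreeGroup.one_eq_mk]
    · rintro rfl
      exact ⟨[], [], by simp, rfl, K.one_mem⟩
  ext q
  unfold restrictedStallings InvDigraph.restrictedCore
  rw [InvDigraph.mem_restrict_verts, hcore]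
  refine ⟨fun h => h.2, fun h => ⟨?_, h⟩⟩
  -- The only vertex would be the attaching vertex of the hanging tree, which does not belong to
  -- `B`.
  rintro ⟨p, B, ⟨hp, hBv, hpB, -⟩, hq⟩
  rw [hcore] at hp hBv
  rw [Set.mem_singleton_iff] at hp h
  subst hp
  exact hpB (h ▸ hq)

end Stallings

/-! ## The restricted Stallings automaton -/

section RestrictedStallings

open FreeGroup

variable {X : Type*} {K : Subgroup (FreeGroup X)}

/-- At a vertex that lies on no cyclically reduced closed walk, all the reduced closed walks begin
with the same letter. -/
theorem exists_first_letter {u : FreeGroup X} (hu : rightCoset K u ∉ cyclicVerts K)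
    (hK : K ≠ ⊥) : ∃ x : X × Bool, ∀ z : List (X × Bool), z ≠ [] → IsReduced z →
      u * mk z * u⁻¹ ∈ K → ∃ v, z = x :: (v ++ [letterInv x]) := by
  classical
  have h1 : ∀ z : List (X × Bool), z ≠ [] → IsReduced z → u * mk z * u⁻¹ ∈ K →
      ∃ x v, z = x :: (v ++ [letterInv x]) := fun z hz hr hm =>
    hr.exists_of_not_isCyclicallyReduced fun hc => hu (mem_cyclicVerts.2 ⟨z, hz, hc, hm⟩)
  -- A conjugate of any nontrivial element of `K` gives a reduced closed walk at the vertex, whose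
  -- first letter is the required `x`.
  obtain ⟨⟨k, hk⟩, hk'⟩ := Subgroup.ne_bot_iff_exists_ne_one.1 hK
  have hk1 : k ≠ 1 := fun h => hk' (Subtype.ext h)
  have hz0 : u⁻¹ * k * u ≠ 1 := by
    intro h
    apply hk1
    have : k = u * (u⁻¹ * k * u) * u⁻¹ := by group
    rw [this, h]
    group
  obtain ⟨x, v, hxv⟩ := h1 (u⁻¹ * k * u).toWord (by rwa [ne_eq, toWord_eq_nil_iff])
    isReduced_toWord (by
      rw [mk_toWord]
      have : u * (u⁻¹ * k * u) * u⁻¹ = k := by group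
      rwa [this])
  have hm0 : u * mk (u⁻¹ * k * u).toWord * u⁻¹ ∈ K := by
    rw [mk_toWord]
    have : u * (u⁻¹ * k * u) * u⁻¹ = k := by group
    rwa [this]
  have hr0 : IsReduced (u⁻¹ * k * u).toWord := isReduced_toWord
  rw [hxv] at hm0 hr0
  refine ⟨x, fun z hz hr hm => ?_⟩
  obtain ⟨y, w, rfl⟩ := h1 z hz hr hm
  by_cases hxy : y = x
  · exact ⟨w, by rw [hxy]⟩
  -- Two closed walks with different first letters, each ending with the inverse of its own first
  -- letter, concatenate to a cyclically reduced closed walk.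
  · exfalso
    refine hu (mem_cyclicVerts.2 ⟨x :: (v ++ [letterInv x]) ++ y :: (w ++ [letterInv y]),
      by simp, ?_, ?_⟩)
    · rw [isCyclicallyReduced_iff_append_self]
      have e1 : IsReduced (x :: (v ++ [letterInv x]) ++ y :: (w ++ [letterInv y])) := by
        have : x :: (v ++ [letterInv x]) ++ y :: (w ++ [letterInv y]) =
          (x :: v) ++ [letterInv x] ++ y :: (w ++ [letterInv y]) := by simp
        rw [this, isReduced_concat_append_cons]
        exact ⟨by simpa using hr0, hr, by rwa [letterInv_letterInv]⟩
      have e2 : ∀ l, x :: (v ++ [letterInv x]) ++ y :: (w ++ [letterInv y]) ++ x :: l =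
        (x :: (v ++ [letterInv x]) ++ y :: w) ++ [letterInv y] ++ x :: l := by simp
      have e3 := e2 (v ++ [letterInv x] ++ y :: (w ++ [letterInv y]))
      simp only [List.cons_append] at e3 e1 ⊢
      rw [e3, ← List.cons_append, ← List.cons_append, isReduced_concat_append_cons]
      refine ⟨by simpa using e1, by simpa using e1, ?_⟩
      rw [letterInv_letterInv]
      exact fun h => hxy h.symm
    · rw [mk_append]
      have : ∀ a b : FreeGroup X, u * (a * b) * u⁻¹ = (u * a * u⁻¹) * (u * b * u⁻¹) := by
        intro a b
        group
      rw [this]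
      exact K.mul_mem hm0 hm

/-- The word `y` is the label of a common initial segment of all the reduced closed walks at the
basepoint, in both directions. -/
def IsStem (K : Subgroup (FreeGroup X)) (y : List (X × Bool)) : Prop :=
  ∀ k : List (X × Bool), IsReduced k → k ≠ [] → mk k ∈ K → ∃ z, k = y ++ z ++ invRev y

theorem exists_reduced_mem (hK : K ≠ ⊥) :
    ∃ k : List (X × Bool), IsReduced k ∧ k ≠ [] ∧ mk k ∈ K := by
  classical
  obtain ⟨k, hk⟩ := Subgroup.ne_bot_iff_exists_ne_one.1 hK
  refine ⟨k.1.toWord, isReduced_toWord, ?_, by rw [mk_toWord]; exact k.2⟩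
  rw [ne_eq, toWord_eq_nil_iff]
  exact fun h => hk (Subtype.ext h)

theorem exists_longest_stem (hK : K ≠ ⊥) :
    ∃ y : List (X × Bool), IsStem K y ∧ ∀ y', IsStem K y' → y'.length ≤ y.length := by
  classical
  obtain ⟨k, hr, hne, hk⟩ := exists_reduced_mem hK
  have hbd : ∀ y, IsStem K y → y.length ≤ k.length := by
    intro y hy
    obtain ⟨z, hz⟩ := hy k hr hne hk
    rw [hz, List.length_append, List.length_append]
    omega
  have h0 : ∃ y, IsStem K y ∧ y.length = 0 := ⟨[], fun k _ _ _ => ⟨k, by simp⟩, rfl⟩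
  have h1 := Nat.findGreatest_spec (P := fun l => ∃ y, IsStem K y ∧ y.length = l)
    (Nat.zero_le k.length) h0
  obtain ⟨y, hy, hyl⟩ := h1
  refine ⟨y, hy, fun y' hy' => ?_⟩
  rw [hyl]
  exact Nat.le_findGreatest (hbd y' hy') ⟨y', hy', rfl⟩

/-! ### The longest stem as the hanging tree at the basepoint -/

namespace IsStem

variable {y : List (X × Bool)}

theorem isReduced (hy : IsStem K y) (hK : K ≠ ⊥) : IsReduced y := by
  obtain ⟨k, hr, hne, hk⟩ := exists_reduced_mem hK
  obtain ⟨z, rfl⟩ := hy k hr hne hk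
  exact hr.left.left

/-- A short closed walk at the basepoint represents the identity. -/
theorem eq_one (hy : IsStem K y) {w : List (X × Bool)} (hw : mk w ∈ K)
    (hl : w.length ≤ 2 * y.length) : mk w = 1 := by
  classical
  by_contra h
  have h1 : (mk w).toWord ≠ [] := by rwa [ne_eq, toWord_eq_nil_iff]
  obtain ⟨z, hz⟩ := hy _ isReduced_toWord h1 (by rwa [mk_toWord])
  have hl' : (mk w).toWord.length ≤ w.length := norm_mk_le
  have hz0 : z = [] := by
    rw [hz, List.length_append, List.length_append, invRev_length] at hl'
    exact List.length_eq_zero_iff.1 (by omega)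
  apply h
  rw [← mk_toWord (x := mk w), hz, hz0, List.append_nil, mk_append, mk_invRev, mul_inv_cancel]

/-- The shape of the reduced closed walks at a vertex of the stem. -/
theorem exists_eq (hy : IsStem K y) {y₁ s : List (X × Bool)} (hs : y = y₁ ++ s)
    {z : List (X × Bool)} (hz : z ≠ []) (hr : IsReduced z)
    (hm : mk y₁ * mk z * (mk y₁)⁻¹ ∈ K) : ∃ t, z = s ++ t ++ invRev s := by
  classical
  have h1 : (mk y₁ * mk z * (mk y₁)⁻¹).toWord ≠ [] := by
    rw [ne_eq, toWord_eq_nil_iff]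
    intro h
    apply hr.mk_ne_one hz
    have : mk z = (mk y₁)⁻¹ * (mk y₁ * mk z * (mk y₁)⁻¹) * mk y₁ := by group
    rw [this, h]
    group
  obtain ⟨t, ht⟩ := hy _ isReduced_toWord h1 (by rwa [mk_toWord])
  refine ⟨t, hr.eq_of_mk_eq ?_ ?_⟩
  · have h2 := isReduced_toWord (x := mk y₁ * mk z * (mk y₁)⁻¹)
    rw [ht, hs] at h2
    refine h2.infix ⟨y₁, invRev y₁, ?_⟩
    simp
  · have h2 : mk (y₁ ++ (s ++ t ++ invRev s) ++ invRev y₁) = mk y₁ * mk z * (mk y₁)⁻¹ := by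
      rw [← mk_toWord (x := mk y₁ * mk z * (mk y₁)⁻¹), ht, hs]
      simp
    rw [mk_append, mk_append, mk_invRev] at h2
    exact (mul_left_cancel (mul_right_cancel h2)).symm

theorem not_mem_cyclicVerts (hy : IsStem K y) {y₁ s : List (X × Bool)} (hs : y = y₁ ++ s)
    (hne : s ≠ []) : rightCoset K (mk y₁) ∉ cyclicVerts K := by
  intro h
  obtain ⟨z, hz, hc, hm⟩ := mem_cyclicVerts.1 h
  obtain ⟨t, rfl⟩ := hy.exists_eq hs hz hc.isReduced hm
  rcases s with _ | ⟨a, s⟩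
  · exact hne rfl
  · refine not_isCyclicallyReduced_cons_append a (s ++ t ++ invRev s) ?_
    rw [invRev_cons_eq] at hc
    simpa using hc

/-- A coincidence of cosets gives the closed walk `y₁ y₂⁻¹`, of length at most `2 |y|`, which must
be trivial. -/
theorem eq_of_rightCoset_eq (hy : IsStem K y) (hK : K ≠ ⊥) {y₁ s₁ y₂ s₂ : List (X × Bool)}
    (h₁ : y = y₁ ++ s₁) (h₂ : y = y₂ ++ s₂)
    (h : rightCoset K (mk y₁) = rightCoset K (mk y₂)) : y₁ = y₂ := by
  rw [rightCoset_eq_rightCoset, ← mk_invRev, ← mk_append] at h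
  have h3 := hy.eq_one h (by
    have := congrArg List.length h₁
    have := congrArg List.length h₂
    rw [List.length_append, invRev_length]
    rw [List.length_append] at *
    omega)
  rw [mk_append, mk_invRev, mul_inv_eq_one] at h3
  have hr := hy.isReduced hK
  exact (h₁ ▸ hr).left.eq_of_mk_eq (h₂ ▸ hr).left h3

theorem mem_stallings_verts (hy : IsStem K y) (hK : K ≠ ⊥) {y₁ s : List (X × Bool)}
    (hs : y = y₁ ++ s) : rightCoset K (mk y₁) ∈ (stallings K).verts := by
  obtain ⟨k, hr, hne, hk⟩ := exists_reduced_mem hK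
  obtain ⟨z, hz⟩ := hy k hr hne hk
  have hk' : k = y₁ ++ (s ++ z ++ invRev y) := by
    rw [hz, hs]
    simp
  exact _root_.mem_stallings_verts.2 ⟨y₁, s ++ z ++ invRev y, hk' ▸ hr, rfl, hk' ▸ hk⟩

/-- A vertex of the Stallings automaton that lies on no cyclically reduced closed walk is a vertex
of the longest stem. -/
theorem exists_of_not_mem_cyclicVerts (hy : IsStem K y)
    (hmax : ∀ y', IsStem K y' → y'.length ≤ y.length) (hK : K ≠ ⊥) {q : RightCosets K}
    (hq : q ∈ (stallings K).verts) (hqc : q ∉ cyclicVerts K) :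
    ∃ y₁ s, s ≠ [] ∧ y = y₁ ++ s ∧ q = rightCoset K (mk y₁) := by
  classical
  obtain ⟨w₁, w₂, hr, rfl, hm⟩ := _root_.mem_stallings_verts.1 hq
  obtain ⟨x, hx⟩ := exists_first_letter hqc hK
  -- Let `v` lead back to the basepoint without beginning with `x`. For `k ∈ K` the closed walk `v k
  -- v⁻¹` at the vertex begins with `x` and ends with its inverse; conjugating back causes no
  -- cancellation with `v`. So the inverse of `v`, followed by `x`, is a stem.
  have key : ∀ v : List (X × Bool), IsReduced v → mk w₁ * mk v ∈ K → v.head? ≠ some x →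
      ∃ y₁ s, s ≠ [] ∧ y = y₁ ++ s ∧ rightCoset K (mk w₁) = rightCoset K (mk y₁) := by
    intro v hv hmv hvx
    have hstem : ∀ k, IsReduced k → k ≠ [] → mk k ∈ K →
        ∃ z, k = (invRev v ++ [x]) ++ z ++ invRev (invRev v ++ [x]) := by
      intro k hkr hkne hk
      have hz1 : (mk v * mk k * (mk v)⁻¹).toWord ≠ [] := by
        rw [ne_eq, toWord_eq_nil_iff]
        intro h
        apply hkr.mk_ne_one hkne
        have : mk k = (mk v)⁻¹ * (mk v * mk k * (mk v)⁻¹) * mk v := by group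
        rw [this, h]
        group
      obtain ⟨t, ht⟩ := hx _ hz1 isReduced_toWord (by
        rw [mk_toWord]
        have : mk w₁ * (mk v * mk k * (mk v)⁻¹) * (mk w₁)⁻¹ =
          (mk w₁ * mk v) * mk k * (mk w₁ * mk v)⁻¹ := by group
        rw [this]
        exact K.mul_mem (K.mul_mem hmv hk) (K.inv_mem hmv))
      have htr : IsReduced (x :: (t ++ [letterInv x])) := ht ▸ isReduced_toWord
      refine ⟨t, ?_⟩
      rw [invRev_concat, invRev_invRev]
      refine hkr.eq_of_mk_eq ?_ ?_
      · have e : invRev v ++ [x] ++ t ++ letterInv x :: v =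
            invRev v ++ (x :: (t ++ [letterInv x]) ++ v) := by simp
        rw [e, isReduced_append]
        refine ⟨hv.invRev, ?_, ?_⟩
        · rw [isReduced_append]
          refine ⟨htr, hv, ?_⟩
          intro a ha b hb hab
          have : (x :: (t ++ [letterInv x])).getLast? = some (letterInv x) := by
            rw [← List.cons_append, List.getLast?_concat]
          rw [this, Option.mem_def, Option.some.injEq] at ha
          subst ha
          rw [letterInv_letterInv] at hab
          subst hab
          exact hvx hb
        · intro a ha b hb hab
          rw [getLast?_invRev] at ha
          obtain ⟨d, hd, rfl⟩ := Option.mem_map.1 ha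
          rw [letterInv_letterInv] at hab
          subst hab
          simp only [List.cons_append, List.head?_cons, Option.mem_def, Option.some.injEq] at hb
          subst hb
          exact hvx hd
      · have e : invRev v ++ [x] ++ t ++ letterInv x :: v =
            invRev v ++ (x :: (t ++ [letterInv x])) ++ v := by simp
        rw [e, ← ht, mk_append, mk_append, mk_invRev, mk_toWord]
        group
    have hlen := hmax _ hstem
    obtain ⟨k, hkr, hkne, hk⟩ := exists_reduced_mem hK
    obtain ⟨z, hz⟩ := hy k hkr hkne hk
    obtain ⟨z', hz'⟩ := hstem k hkr hkne hk
    -- Both stems are prefixes of the same word, so the shorter one is a prefix of the longest one.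
    have hp1 : y <+: k := ⟨z ++ invRev y, by rw [hz]; simp⟩
    have hp2 : invRev v ++ [x] <+: k :=
      ⟨z' ++ invRev (invRev v ++ [x]), by conv_rhs => rw [hz']
                                          simp⟩
    obtain ⟨s, hs⟩ := List.prefix_of_prefix_length_le hp2 hp1 hlen
    refine ⟨invRev v, x :: s, by simp, by rw [← hs]; simp, ?_⟩
    rw [rightCoset_eq_rightCoset, mk_invRev, inv_inv]
    exact hmv
  -- There are two ways back to the basepoint, along `w₂` and against `w₁`. Since `w₁ w₂` is
  -- reduced, they cannot both begin with `x`.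
  by_cases h : w₂.head? = some x
  · refine key (invRev w₁) hr.left.invRev ?_ ?_
    · rw [mk_invRev, mul_inv_cancel]
      exact K.one_mem
    · intro h'
      rw [head?_invRev] at h'
      obtain ⟨a, ha, hax⟩ := Option.map_eq_some_iff.1 h'
      exact (isReduced_append.1 hr).2.2 a ha x h hax.symm
  · exact key w₂ hr.right (by rwa [← mk_append]) h

/-- Along the stem, walks are determined in the free group itself and not only modulo `K`: an arc
that deviated would close up to a nontrivial closed walk of length at most `2 |y|`. This gives the
uniqueness of reduced walks in the hanging tree. -/
theorem walk_eq (hy : IsStem K y) (hK : K ≠ ⊥) {p q : RightCosets K} {w : List (X × Bool)}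
    (hw : ((stallings K).restrict {q | ∃ y₁ s, y = y₁ ++ s ∧ q = rightCoset K (mk y₁)}
      {rightCoset K (mk y)}).Walk p w q)
    {y₁ s₁ y₂ s₂ : List (X × Bool)} (h₁ : y = y₁ ++ s₁) (h₂ : y = y₂ ++ s₂)
    (hp : p = rightCoset K (mk y₁)) (hq : q = rightCoset K (mk y₂)) :
    mk y₁ * mk w = mk y₂ := by
  induction hw generalizing y₁ s₁ with
  | nil _ =>
    have := hy.eq_of_rightCoset_eq hK h₁ h₂ (hp.symm.trans hq)
    rw [this, ← FreeGroup.one_eq_mk, mul_one]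
  | @cons p r q a w ha hw ih =>
    rw [InvDigraph.restrict_arc] at ha
    obtain ⟨ha, -, ⟨y₃, s₃, h₃, hr⟩, hpr⟩ := ha
    have h4 := ih h₃ hr hq
    rw [← h4, mk_cons, ← mul_assoc]
    congr 1
    have h5 := (stallings_arc.1 ha).1
    rw [hp, schreier_arc, hr, rightCoset_eq_rightCoset] at h5
    have h6 : mk (y₃ ++ invRev (y₁ ++ [a])) ∈ K := by
      rwa [mk_append, mk_invRev, mk_append]
    have l1 := congrArg List.length h₁
    have l3 := congrArg List.length h₃
    rw [List.length_append] at l1 l3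
    -- The length is `|y₃| + |y₁| + 1`. It is at most `2 |y|` because one end of the arc is not the
    -- end of the stem; this is where the arcs from the attaching vertex to itself must be excluded.
    have h7 := hy.eq_one h6 (by
      rw [List.length_append, invRev_length, List.length_append, List.length_singleton]
      rcases hpr with hpr | hpr
      · have : s₁ ≠ [] := by
          rintro rfl
          rw [List.append_nil] at h₁
          exact hpr (by rw [hp, h₁]; rfl)
        have := List.length_pos_iff.2 this
        omega
      · have : s₃ ≠ [] := by
          rintro rfl
          rw [List.append_nil] at h₃
          exact hpr (by rw [hr, h₃]; rfl)
        have := List.length_pos_iff.2 this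
        omega)
    rw [mk_append, mk_invRev, mul_inv_eq_one, mk_append] at h7
    exact h7.symm

theorem exists_walk (hy : IsStem K y) (hK : K ≠ ⊥) {y₁ t s : List (X × Bool)}
    (hs : y = y₁ ++ t ++ s) :
    ((stallings K).restrict {q | ∃ y₁ s, y = y₁ ++ s ∧ q = rightCoset K (mk y₁)}
      {rightCoset K (mk y)}).Walk (rightCoset K (mk y₁)) t (rightCoset K (mk (y₁ ++ t))) := by
  have hv : ∀ {y₁ s : List (X × Bool)}, y = y₁ ++ s →
      rightCoset K (mk y₁) ∈ ((stallings K).restrict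
        {q | ∃ y₁ s, y = y₁ ++ s ∧ q = rightCoset K (mk y₁)} {rightCoset K (mk y)}).verts :=
    fun {y₁ s} h => ⟨⟨y₁, s, h, rfl⟩, hy.mem_stallings_verts hK h⟩
  induction t generalizing y₁ with
  | nil =>
    rw [List.append_nil] at hs ⊢
    exact InvDigraph.Walk.nil (hv hs)
  | cons a t ih =>
    have hs' : y = y₁ ++ [a] ++ t ++ s := by
      rw [hs]
      simp
    have h1 := ih hs'
    have h2 : y₁ ++ a :: t = y₁ ++ [a] ++ t := by simp
    rw [h2]
    rw [List.append_assoc] at hs hs'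
    refine InvDigraph.Walk.cons ?_ h1
    refine InvDigraph.restrict_arc.2 ⟨stallings_arc.2 ⟨?_, (hv hs).2, (hv hs').2⟩, (hv hs).1,
      (hv hs').1, Or.inl ?_⟩
    · rw [schreier_arc, mk_append]
    · intro h
      have h3 := hy.eq_of_rightCoset_eq hK hs (List.append_nil y).symm h
      have h4 := congrArg List.length hs
      rw [h3] at h4
      simp at h4

/-- The point is that no arc leaves the stem before its end. A neighbour on no cyclically reduced
closed walk is again on the stem. A neighbour on such a walk `z`, reached by the letter `a`, gives
the reduced closed walk `a z a⁻¹`, which has to begin along the rest of the stem, so the neighbour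
is the next stem vertex. -/
theorem isHangingTree (hy : IsStem K y) (hmax : ∀ y', IsStem K y' → y'.length ≤ y.length)
    (hK : K ≠ ⊥) : (stallings K).IsHangingTree (rightCoset K (mk y))
      {q | ∃ y₁ s, s ≠ [] ∧ y = y₁ ++ s ∧ q = rightCoset K (mk y₁)} := by
  have hins : insert (rightCoset K (mk y))
      {q | ∃ y₁ s, s ≠ [] ∧ y = y₁ ++ s ∧ q = rightCoset K (mk y₁)} =
      {q | ∃ y₁ s, y = y₁ ++ s ∧ q = rightCoset K (mk y₁)} := by
    ext q
    simp only [Set.mem_insert_iff, Set.mem_ofPred_eq]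
    constructor
    · rintro (rfl | ⟨y₁, s, -, h, h'⟩)
      · exact ⟨y, [], by simp, rfl⟩
      · exact ⟨y₁, s, h, h'⟩
    · rintro ⟨y₁, s, h, h'⟩
      by_cases hs : s = []
      · rw [hs, List.append_nil] at h
        exact Or.inl (by rw [h', h])
      · exact Or.inr ⟨y₁, s, hs, h, h'⟩
  refine ⟨hy.mem_stallings_verts hK (List.append_nil y).symm, ?_, ?_, ?_, ?_⟩
  · rintro q ⟨y₁, s, -, h, rfl⟩
    exact hy.mem_stallings_verts hK h
  · rintro ⟨y₁, s, hs, h, h'⟩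
    have h1 := hy.eq_of_rightCoset_eq hK (List.append_nil y).symm h h'
    have h2 := congrArg List.length h
    rw [← h1, List.length_append] at h2
    exact hs (List.length_eq_zero_iff.1 (by omega))
  · rintro q ⟨y₁, s, hs, h, rfl⟩ a r har
    rw [hins]
    obtain ⟨har, -, hrv⟩ := stallings_arc.1 har
    rw [schreier_arc] at har
    by_cases hrc : r ∈ cyclicVerts K
    · rw [har] at hrc
      obtain ⟨z, hz, hc, hm⟩ := mem_cyclicVerts.1 hrc
      have hq := hy.not_mem_cyclicVerts h hs
      have hm' : mk y₁ * mk (a :: (z ++ [letterInv a])) * (mk y₁)⁻¹ ∈ K := by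
        rw [mk_cons, mk_append, mk_singleton_letterInv]
        have : mk y₁ * (mk [a] * (mk z * (mk [a])⁻¹)) * (mk y₁)⁻¹ =
          mk y₁ * mk [a] * mk z * (mk y₁ * mk [a])⁻¹ := by group
        rwa [this]
      -- If `z` went straight back along `a`, the stem vertex itself would lie on the cyclically
      -- reduced closed walk. The same applies to the last letter of `z`.
      have hzh : z.head? ≠ some (letterInv a) := by
        intro h1
        rcases z with _ | ⟨b, z⟩
        · exact hz rfl
        rw [List.head?_cons, Option.some.injEq] at h1
        subst h1
        apply hq
        have := mem_cyclicVerts_of_append (u := mk y₁ * mk [a]) (z₁ := [letterInv a]) (z₂ := z)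
          (by simp) hc hm
        rwa [mk_singleton_letterInv, mul_inv_cancel_right] at this
      have hzl : z.getLast? ≠ some a := by
        intro h1
        rcases List.eq_nil_or_concat z with rfl | ⟨z', b, rfl⟩
        · exact hz rfl
        rw [List.concat_eq_append] at *
        rw [List.getLast?_concat, Option.some.injEq] at h1
        subst h1
        apply hq
        have h2 := mem_cyclicVerts_of_append (u := mk y₁ * mk [b]) (z₁ := z') (z₂ := [b])
          (by simp) hc hm
        have h3 : rightCoset K (mk y₁ * mk [b] * mk z') = rightCoset K (mk y₁) := by
          rw [rightCoset_eq_rightCoset]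
          rw [mk_append] at hm
          have : mk y₁ * mk [b] * mk z' * (mk y₁)⁻¹ =
            mk y₁ * mk [b] * (mk z' * mk [b]) * (mk y₁ * mk [b])⁻¹ := by group
          rwa [this]
        rwa [h3] at h2
      have hred : IsReduced (a :: (z ++ [letterInv a])) := by
        have e : a :: (z ++ [letterInv a]) = [a] ++ (z ++ [letterInv a]) := rfl
        rw [e, isReduced_append, isReduced_append]
        refine ⟨IsReduced.singleton, ⟨hc.isReduced, IsReduced.singleton, ?_⟩, ?_⟩
        · intro b hb c hc' hcb
          simp only [List.head?_cons, Option.mem_def, Option.some.injEq] at hc'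
          subst hc'
          have : b = a := by rw [← letterInv_letterInv b, ← hcb, letterInv_letterInv]
          exact hzl (this ▸ hb)
        · intro b hb c hc' hcb
          simp only [List.getLast?_singleton, Option.mem_def, Option.some.injEq] at hb
          subst hb
          rcases z with _ | ⟨d, z⟩
          · exact hz rfl
          simp only [List.cons_append, List.head?_cons, Option.mem_def, Option.some.injEq] at hc'
          subst hc'
          exact hzh (by rw [hcb]; rfl)
      -- Comparing first letters, `a` is the first letter of the nonempty rest `s` of the stem.
      obtain ⟨t, ht⟩ := hy.exists_eq h (by simp) hred hm'
      rcases s with _ | ⟨b, s⟩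
      · exact absurd rfl hs
      · simp only [List.cons_append, List.cons.injEq] at ht
        obtain ⟨rfl, -⟩ := ht
        exact ⟨y₁ ++ [a], s, by rw [h]; simp, by rw [har, mk_append]⟩
    · obtain ⟨y₂, s₂, -, h2, h3⟩ := hy.exists_of_not_mem_cyclicVerts hmax hK hrv hrc
      exact ⟨y₂, s₂, h2, h3⟩
  · rw [hins]
    refine ⟨⟨rightCoset K (mk y), ⟨y, [], by simp, rfl⟩,
      hy.mem_stallings_verts hK (List.append_nil y).symm⟩, ?_⟩
    rintro p ⟨⟨y₁, s₁, h₁, rfl⟩, -⟩ q ⟨⟨y₂, s₂, h₂, rfl⟩, -⟩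
    have hred := hy.isReduced hK
    have hex : ∃ w, IsReduced w ∧ ((stallings K).restrict
        {q | ∃ y₁ s, y = y₁ ++ s ∧ q = rightCoset K (mk y₁)} {rightCoset K (mk y)}).Walk
        (rightCoset K (mk y₁)) w (rightCoset K (mk y₂)) := by
      have hp₁ : y₁ <+: y := ⟨s₁, h₁.symm⟩
      have hp₂ : y₂ <+: y := ⟨s₂, h₂.symm⟩
      rcases List.prefix_or_prefix_of_prefix hp₁ hp₂ with ⟨t, rfl⟩ | ⟨t, rfl⟩
      · refine ⟨t, ?_, hy.exists_walk hK h₂⟩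
        rw [h₂] at hred
        exact hred.left.right
      · refine ⟨invRev t, ?_, (hy.exists_walk hK h₁).invRev⟩
        rw [h₁] at hred
        exact hred.left.right.invRev
    obtain ⟨w, hw, hww⟩ := hex
    refine ⟨w, ⟨hw, hww⟩, fun w' hw' => ?_⟩
    refine hw'.1.eq_of_mk_eq hw (mul_left_cancel (a := mk y₁) ?_)
    rw [hy.walk_eq hK hw'.2 h₁ h₂ rfl rfl, hy.walk_eq hK hww h₁ h₂ rfl rfl]

end IsStem

/-- The vertices of the restricted Stallings automaton of a nontrivial subgroup are those on
nontrivial cyclically reduced closed walks. -/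
theorem restrictedStallings_verts (hK : K ≠ ⊥) : (restrictedStallings K).verts = cyclicVerts K := by
  refine Set.Subset.antisymm ?_ cyclicVerts_subset_restrictedStallings
  intro q hq
  by_contra hqc
  obtain ⟨y, hy, hmax⟩ := exists_longest_stem hK
  obtain ⟨hq1, hq2⟩ := InvDigraph.mem_restrict_verts.1 hq
  exact hq1 ⟨_, _, hy.isHangingTree hmax hK,
    hy.exists_of_not_mem_cyclicVerts hmax hK hq2 hqc⟩

end RestrictedStallings

/-! ## Relative orders -/

section RelOrder

variable {G : Type*} [Group G] {H : Subgroup G} {g : G}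

theorem relOrder_eq_zero_iff : relOrder (H : Set G) g = 0 ↔ ∀ k, 1 ≤ k → g ^ k ∉ H := by
  unfold relOrder
  rw [Nat.sInf_eq_zero]
  constructor
  · rintro (⟨h, -⟩ | h) k hk hg
    · omega
    · have : k ∈ {k : ℕ | 1 ≤ k ∧ g ^ k ∈ (H : Set G)} := ⟨hk, hg⟩
      rw [h] at this
      exact this
  · intro h
    right
    ext k
    simp only [Set.mem_ofPred_eq, SetLike.mem_coe, Set.mem_empty_iff_false, iff_false, not_and]
    exact fun hk => h k hk

theorem pow_relOrder_mem : g ^ relOrder (H : Set G) g ∈ H := by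
  by_cases h : relOrder (H : Set G) g = 0
  · rw [h, pow_zero]
    exact H.one_mem
  · have hne : {k : ℕ | 1 ≤ k ∧ g ^ k ∈ (H : Set G)}.Nonempty :=
      Nat.nonempty_of_pos_sInf (Nat.pos_of_ne_zero h)
    exact (Nat.sInf_mem hne).2

theorem relOrder_le {k : ℕ} (hk : 1 ≤ k) (hg : g ^ k ∈ H) : relOrder (H : Set G) g ≤ k :=
  Nat.sInf_le ⟨hk, hg⟩

/-- Division with remainder contradicts minimality. The convention for infinite order fits, since `0
∣ k` only for `k = 0`; later arguments therefore need no case distinction. -/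
theorem pow_mem_iff_relOrder_dvd {k : ℕ} : g ^ k ∈ H ↔ relOrder (H : Set G) g ∣ k := by
  set d := relOrder (H : Set G) g with hd
  constructor
  · intro h
    by_cases hd0 : d = 0
    · rcases Nat.eq_zero_or_pos k with rfl | hk
      · exact dvd_zero _
      · exact absurd h (relOrder_eq_zero_iff.1 hd0 k hk)
    · by_contra hdk
      have h1 : g ^ (k % d) ∈ H := by
        have h2 : g ^ k = (g ^ d) ^ (k / d) * g ^ (k % d) := by
          rw [← pow_mul, ← pow_add, Nat.div_add_mod]
        rw [h2] at h
        exact (H.mul_mem_cancel_left (H.pow_mem pow_relOrder_mem _)).1 h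
      have h3 : 1 ≤ k % d := by
        by_contra hlt
        exact hdk (Nat.dvd_of_mod_eq_zero (by omega))
      have := relOrder_le h3 h1
      have := Nat.mod_lt k (Nat.pos_of_ne_zero hd0)
      omega
  · rintro ⟨i, rfl⟩
    rw [pow_mul]
    exact H.pow_mem pow_relOrder_mem _

theorem relOrder_eq_iff {d : ℕ} :
    relOrder (H : Set G) g = d ↔ ∀ j, g ^ j ∈ H ↔ d ∣ j := by
  constructor
  · rintro rfl j
    exact pow_mem_iff_relOrder_dvd
  · intro h
    refine Nat.dvd_antisymm ?_ ?_
    · exact pow_mem_iff_relOrder_dvd.1 ((h d).2 dvd_rfl)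
    · exact (h _).1 pow_relOrder_mem

theorem relOrder_congr {G' : Type*} [Group G'] {H' : Subgroup G'} {g' : G'}
    (h : ∀ j, g ^ j ∈ H ↔ g' ^ j ∈ H') : relOrder (H : Set G) g = relOrder (H' : Set G') g' := by
  rw [relOrder_eq_iff]
  intro j
  rw [h, pow_mem_iff_relOrder_dvd]

theorem relOrder_eq_succ_iff {k : ℕ} (hk : 1 ≤ k) : relOrder (H : Set G) g = k ↔
    g ^ k ∈ H ∧ ∀ j < k, 1 ≤ j → g ^ j ∉ H := by
  constructor
  · rintro rfl
    refine ⟨pow_relOrder_mem, fun j hj hj1 hm => ?_⟩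
    have := relOrder_le hj1 hm
    omega
  · rintro ⟨h1, h2⟩
    refine le_antisymm (relOrder_le hk h1) ?_
    by_contra hlt
    push Not at hlt
    have h0 : 1 ≤ relOrder (H : Set G) g := by
      by_contra h0
      exact relOrder_eq_zero_iff.1 (by omega) k hk h1
    exact h2 _ hlt h0 pow_relOrder_mem

end RelOrder

/-! ## Walks in balls of the Schreier automaton -/

section Balls

open FreeGroup

variable {X : Type*} {K : Subgroup (FreeGroup X)}

/-- The walk with label `w` from the coset of `u` stays in the set `Γ`. -/
def StaysIn (Γ : Set (RightCosets K)) (u : FreeGroup X) (w : List (X × Bool)) : Prop :=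
  ∀ w₁ w₂, w = w₁ ++ w₂ → rightCoset K (u * mk w₁) ∈ Γ

namespace StaysIn

variable {Γ : Set (RightCosets K)} {u v : FreeGroup X} {w w' : List (X × Bool)}

theorem congr_left (h : rightCoset K u = rightCoset K v) (hs : StaysIn Γ u w) : StaysIn Γ v w :=
  fun w₁ w₂ hw => rightCoset_mul h (mk w₁) ▸ hs w₁ w₂ hw

theorem append (h : StaysIn Γ u w) (h' : StaysIn Γ (u * mk w) w') : StaysIn Γ u (w ++ w') := by
  intro w₁ w₂ hw
  rcases List.append_eq_append_iff.1 hw with ⟨t, rfl, rfl⟩ | ⟨t, rfl, rfl⟩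
  · rw [mk_append, ← mul_assoc]
    exact h' t w₂ rfl
  · exact h w₁ t rfl

theorem invRev (h : StaysIn Γ u w) : StaysIn Γ (u * mk w) (FreeGroup.invRev w) := by
  intro w₁ w₂ hw
  have h1 : w = FreeGroup.invRev w₂ ++ FreeGroup.invRev w₁ := by
    rw [← invRev_append, ← hw, invRev_invRev]
  have h2 := h _ _ h1
  convert h2 using 2
  rw [h1, mk_append, mk_invRev, mk_invRev]
  group

theorem left (h : StaysIn Γ u (w ++ w')) : StaysIn Γ u w := fun w₁ w₂ hw =>
  h w₁ (w₂ ++ w') (by rw [hw, List.append_assoc])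

theorem right (h : StaysIn Γ u (w ++ w')) : StaysIn Γ (u * mk w) w' := fun w₁ w₂ hw => by
  rw [mul_assoc, ← mk_append]
  exact h (w ++ w₁) w₂ (by rw [hw, List.append_assoc])

/-- Cancelling a pair of inverse letters only deletes vertices from the walk. -/
theorem of_red (h : StaysIn Γ u w) (hr : Red w w') : StaysIn Γ u w' := by
  induction hr with
  | refl => exact h
  | tail _ hs ih =>
    cases hs with
    | @not L₁ L₂ x b =>
      intro w₁ w₂ hw
      rcases List.append_eq_append_iff.1 hw with ⟨t, rfl, rfl⟩ | ⟨t, rfl, rfl⟩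
      · have h1 := ih (L₁ ++ (x, b) :: (x, !b) :: t) w₂ (by simp)
        have h2 : mk (L₁ ++ (x, b) :: (x, !b) :: t) = mk (L₁ ++ t) :=
          Quot.sound Red.Step.not
        rwa [h2] at h1
      · exact ih w₁ (t ++ (x, b) :: (x, !b) :: L₂) (by simp)

theorem of_mk_eq (h : StaysIn Γ u w) (hr : IsReduced w') (he : mk w = mk w') :
    StaysIn Γ u w' := by
  classical
  refine h.of_red ?_
  rw [← hr.toWord_mk, ← he, FreeGroup.toWord_mk]
  exact reduce.red

end StaysIn

/-- The ball of radius `l` in the Schreier automaton. -/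
def schreierBall (K : Subgroup (FreeGroup X)) (l : ℕ) : Set (RightCosets K) :=
  {q | ∃ w : List (X × Bool), w.length ≤ l ∧ q = rightCoset K (mk w)}

theorem finite_schreierBall [Finite X] (l : ℕ) : (schreierBall K l).Finite := by
  have h : schreierBall K l = (fun w => rightCoset K (mk w)) '' {w | w.length ≤ l} := by
    ext q
    constructor
    · rintro ⟨w, hw, rfl⟩
      exact ⟨w, hw, rfl⟩
    · rintro ⟨w, hw, rfl⟩
      exact ⟨w, hw, rfl⟩
  rw [h]
  exact (List.finite_length_le _ l).image _

theorem staysIn_schreierBall {l : ℕ} {w : List (X × Bool)} (hw : w.length ≤ l) :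
    StaysIn (schreierBall K l) 1 w := by
  rintro w₁ w₂ rfl
  rw [List.length_append] at hw
  exact ⟨w₁, by omega, by rw [one_mul]⟩

/-- The subgroup `K` is generated by words of length at most `l`. -/
def GeneratedInLength (K : Subgroup (FreeGroup X)) (l : ℕ) : Prop :=
  K = Subgroup.closure {g | ∃ w : List (X × Bool), w.length ≤ l ∧ mk w ∈ K ∧ mk w = g}

namespace GeneratedInLength

variable {l : ℕ}

/-- Walks along the generators stay in the ball by their length. The property passes to products and
inverses, as the walks are closed at the basepoint and free reduction only removes vertices. -/
theorem staysIn_of_mem (hK : GeneratedInLength K l) {w : List (X × Bool)} (hr : IsReduced w)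
    (hw : mk w ∈ K) : StaysIn (schreierBall K l) 1 w := by
  classical
  have key : ∀ k ∈ Subgroup.closure
      {g | ∃ w : List (X × Bool), w.length ≤ l ∧ mk w ∈ K ∧ mk w = g},
      StaysIn (schreierBall K l) 1 k.toWord := by
    intro k hk
    induction hk using Subgroup.closure_induction with
    | mem x hx =>
      obtain ⟨w, hwl, -, rfl⟩ := hx
      exact (staysIn_schreierBall hwl).of_mk_eq isReduced_toWord (by rw [mk_toWord])
    | one =>
      rw [toWord_one]
      exact staysIn_schreierBall (Nat.zero_le _)
    | mul x y hx hy ihx ihy =>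
      rw [← hK] at hx
      have h1 : StaysIn (schreierBall K l) 1 (x.toWord ++ y.toWord) := by
        refine ihx.append (ihy.congr_left ?_)
        rw [mk_toWord, one_mul, rightCoset_eq_rightCoset, one_mul]
        exact K.inv_mem hx
      exact h1.of_mk_eq isReduced_toWord (by rw [mk_append, mk_toWord, mk_toWord, mk_toWord])
    | inv x hx ih =>
      rw [← hK] at hx
      rw [toWord_inv]
      refine ih.invRev.congr_left ?_
      rw [mk_toWord, one_mul, rightCoset_eq_rightCoset, inv_one, mul_one]
      exact hx
  have h1 := key (mk w) (hK ▸ hw)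
  rwa [hr.toWord_mk] at h1

/-- A reduced walk between two vertices of the ball stays in the ball. -/
theorem staysIn (hK : GeneratedInLength K l) {u : FreeGroup X} {w : List (X × Bool)}
    (hr : IsReduced w) (hu : rightCoset K u ∈ schreierBall K l)
    (hw : rightCoset K (u * mk w) ∈ schreierBall K l) : StaysIn (schreierBall K l) u w := by
  classical
  obtain ⟨v₁, hv₁, h₁⟩ := hu
  obtain ⟨v₂, hv₂, h₂⟩ := hw
  rw [rightCoset_mul h₁, rightCoset_eq_rightCoset] at h₂
  have s1 : StaysIn (schreierBall K l) (mk v₁) (invRev v₁) := by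
    have := (staysIn_schreierBall (K := K) hv₁).invRev
    rwa [one_mul] at this
  have s2 := hK.staysIn_of_mem (isReduced_toWord (x := mk v₁ * mk w * (mk v₂)⁻¹))
    (by rwa [mk_toWord])
  have s3 := staysIn_schreierBall (K := K) hv₂
  -- A detour through the basepoint: back along `v₁`, around a reduced closed walk, out along `v₂`.
  -- It stays in the ball and reduces to `w`.
  have s4 : StaysIn (schreierBall K l) (mk v₁)
      (invRev v₁ ++ (mk v₁ * mk w * (mk v₂)⁻¹).toWord ++ v₂) := by
    refine (s1.append (s2.congr_left ?_)).append (s3.congr_left ?_)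
    · rw [mk_invRev, mul_inv_cancel]
    · rw [mk_append, mk_invRev, mk_toWord, mul_inv_cancel_left, rightCoset_eq_rightCoset, one_mul]
      exact K.inv_mem h₂
  refine (s4.of_mk_eq hr ?_).congr_left h₁.symm
  rw [mk_append, mk_append, mk_invRev, mk_toWord]
  group

theorem stallings_verts_subset (hK : GeneratedInLength K l) :
    (stallings K).verts ⊆ schreierBall K l := by
  intro q hq
  obtain ⟨w₁, w₂, hr, rfl, hm⟩ := mem_stallings_verts.1 hq
  have := hK.staysIn_of_mem hr hm w₁ w₂ rfl
  rwa [one_mul] at this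

theorem restrictedStallings_verts_finite [Finite X] (hK : GeneratedInLength K l) :
    (restrictedStallings K).verts.Finite :=
  ((finite_schreierBall l).subset hK.stallings_verts_subset).subset
    fun _ h => (InvDigraph.mem_restrict_verts.1 h).2

end GeneratedInLength

theorem generatedInLength_closure {S : Set (List (X × Bool))} {l : ℕ}
    (hS : ∀ w ∈ S, w.length ≤ l) :
    GeneratedInLength (Subgroup.closure (mk '' S)) l := by
  refine le_antisymm ?_ ?_
  · refine Subgroup.closure_mono ?_
    rintro _ ⟨w, hw, rfl⟩
    exact ⟨w, hS w hw, Subgroup.subset_closure ⟨w, hw, rfl⟩, rfl⟩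
  · rw [Subgroup.closure_le]
    rintro _ ⟨w, -, hw, rfl⟩
    exact hw

theorem exists_generatedInLength (hK : K.FG) : ∃ l, GeneratedInLength K l := by
  classical
  obtain ⟨S, rfl⟩ := hK
  refine ⟨(S.image FreeGroup.norm).sup id, ?_⟩
  have h : (S : Set (FreeGroup X)) = mk '' (toWord '' (S : Set (FreeGroup X))) := by
    rw [Set.image_image]
    simp [mk_toWord]
  rw [h]
  refine generatedInLength_closure ?_
  rintro _ ⟨g, hg, rfl⟩
  exact Finset.le_sup (f := id) (Finset.mem_image_of_mem FreeGroup.norm hg)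

/-- The vertices of the cyclically reduced closed walk that belongs to an element of positive
order. -/
theorem relOrder_le_ncard_verts (hfin : (restrictedStallings K).verts.Finite)
    (u : FreeGroup X) : relOrder (K : Set (FreeGroup X)) u ≤ (restrictedStallings K).verts.ncard := by
  classical
  rcases Nat.eq_zero_or_pos (relOrder (K : Set (FreeGroup X)) u) with h0 | hpos
  · omega
  obtain ⟨v, c, hc, hu⟩ := exists_conj_isCyclicallyReduced u
  -- The trivial element has order `1`, so it suffices that the automaton has a vertex.
  by_cases hc0 : c = []
  · have hu1 : u = 1 := by
      rw [hu, hc0, ← FreeGroup.one_eq_mk]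
      group
    have h1 : relOrder (K : Set (FreeGroup X)) u ≤ 1 :=
      relOrder_le le_rfl (by rw [hu1, one_pow]; exact K.one_mem)
    refine h1.trans ?_
    rw [Nat.succ_le_iff, Set.ncard_pos hfin]
    by_cases hK : K = ⊥
    · rw [restrictedStallings_verts_bot hK]
      exact Set.singleton_nonempty _
    · rw [restrictedStallings_verts hK]
      obtain ⟨k, hr, hne, hk⟩ := exists_reduced_mem hK
      obtain ⟨v', c', hc', hkc⟩ := exists_conj_isCyclicallyReduced (mk k)
      refine ⟨rightCoset K (mk v'), mem_cyclicVerts.2 ⟨c', ?_, hc', hkc ▸ hk⟩⟩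
      rintro rfl
      apply hr.mk_ne_one hne
      rw [hkc, ← FreeGroup.one_eq_mk]
      group
  · set a := relOrder (K : Set (FreeGroup X)) u with ha
    have hua : mk v * mk c ^ a * (mk v)⁻¹ ∈ K := by
      rw [← conj_pow, ← hu]
      exact pow_relOrder_mem
    have hca : (List.replicate a c).flatten ≠ [] := by
      obtain ⟨b, hb⟩ : ∃ b, a = b + 1 := ⟨a - 1, by omega⟩
      rw [hb, List.replicate_succ, List.flatten_cons]
      simp [hc0]
    -- Powers of `c` commute, so `c ^ a` is also the label of a closed walk at the coset of `v c ^
    -- i`.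
    have hmem : ∀ i, rightCoset K (mk v * mk c ^ i) ∈ cyclicVerts K := by
      intro i
      refine mem_cyclicVerts.2 ⟨_, hca, hc.flatten_replicate a, ?_⟩
      rw [mk_flatten_replicate]
      have : mk v * mk c ^ i * mk c ^ a * (mk v * mk c ^ i)⁻¹ = mk v * mk c ^ a * (mk v)⁻¹ := by
        group
      rwa [this]
    have hsub : (fun i => rightCoset K (mk v * mk c ^ i)) '' (Finset.range a : Set ℕ) ⊆
        (restrictedStallings K).verts := by
      rintro _ ⟨i, -, rfl⟩
      exact cyclicVerts_subset_restrictedStallings (hmem i)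
    -- Equality of the cosets for `i < j < a` would put `u ^ (j - i)` into `K`, against the
    -- minimality of `a`.
    have hinj : Set.InjOn (fun i => rightCoset K (mk v * mk c ^ i)) (Finset.range a : Set ℕ) := by
      have key : ∀ i j, i < j → j < a →
          rightCoset K (mk v * mk c ^ j) ≠ rightCoset K (mk v * mk c ^ i) := by
        intro i j hij hj h
        rw [rightCoset_eq_rightCoset] at h
        have h2 : mk v * mk c ^ j * (mk v * mk c ^ i)⁻¹ = u ^ (j - i) := by
          rw [hu, conj_pow]
          obtain ⟨d, rfl⟩ := Nat.exists_eq_add_of_lt hij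
          have : i + d + 1 - i = d + 1 := by omega
          rw [this, add_assoc, add_comm i, pow_add]
          group
        rw [h2, pow_mem_iff_relOrder_dvd] at h
        have := Nat.le_of_dvd (by omega) h
        omega
      intro i hi j hj hij
      simp only [Finset.coe_range, Set.mem_Iio] at hi hj
      rcases lt_trichotomy i j with h | h | h
      · exact absurd hij.symm (key i j h hj)
      · exact h
      · exact absurd hij (key j i h hi)
    have h3 := Set.ncard_le_ncard hsub hfin
    rwa [hinj.ncard_image, Set.ncard_coe_finset, Finset.card_range] at h3

end Balls

/-! ## Diagonal bases for subgroups of free abelian groups -/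

section DiagonalBasis

/-- The submodule `N` is spanned by the multiples `d i • b i` of the basis vectors. -/
def IsDiagonal {ι M : Type*} [AddCommGroup M] (N : Submodule ℤ M) (b : Module.Basis ι ℤ M)
    (d : ι → ℕ) : Prop :=
  ∀ y, y ∈ N ↔ ∀ i, (d i : ℤ) ∣ b.repr y i

/-- A positive value of a linear functional on `N` that is minimal among all such values divides
all the values of linear functionals on `N`. -/
theorem dvd_of_minimal_value {M : Type*} [AddCommGroup M] {N : Submodule ℤ M} {a : ℕ}
    (ha : 0 < a) (hmin : ∀ (ψ : M →ₗ[ℤ] ℤ) (z : M) (c : ℕ), 0 < c → z ∈ N → ψ z = c → a ≤ c)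
    {φ : M →ₗ[ℤ] ℤ} {y : M} (hy : y ∈ N) (hφ : φ y = a) (ψ : M →ₗ[ℤ] ℤ) {z : M} (hz : z ∈ N) :
    (a : ℤ) ∣ ψ z := by
  have ha' : (0 : ℤ) < a := by exact_mod_cast ha
  -- For functionals with value `a` at `y`: a nonzero remainder would be a smaller positive value.
  have h1 : ∀ (φ : M →ₗ[ℤ] ℤ), φ y = a → ∀ z ∈ N, (a : ℤ) ∣ φ z := by
    intro φ hφ z hz
    by_contra hnd
    have h2 : 0 < φ z % a := lt_of_le_of_ne (Int.emod_nonneg _ ha'.ne')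
      fun h => hnd (Int.dvd_of_emod_eq_zero h.symm)
    have h3 : φ (z - (φ z / a) • y) = φ z % a := by
      rw [map_sub, map_smul, hφ, smul_eq_mul, Int.emod_def, mul_comm]
    obtain ⟨c, hc⟩ := Int.eq_ofNat_of_zero_le h2.le
    have h4 := hmin φ _ c (by omega) (N.sub_mem hz (N.smul_mem _ hy)) (h3.trans hc)
    have h5 := Int.emod_lt_of_pos (φ z) ha'
    omega
  -- By Bézout the gcd of `a` and `ψ y` is itself the value at `y` of a functional.
  have h6 : (a : ℤ) ∣ ψ y := by
    have hg : 0 < Int.gcd a (ψ y) := Int.gcd_pos_of_ne_zero_left _ ha'.ne'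
    have h7 := hmin (Int.gcdA a (ψ y) • φ + Int.gcdB a (ψ y) • ψ) y (Int.gcd a (ψ y)) hg hy (by
      rw [Int.gcd_eq_gcd_ab, LinearMap.add_apply, LinearMap.smul_apply, LinearMap.smul_apply, hφ,
        smul_eq_mul, smul_eq_mul]
      ring)
    have h8 : Int.gcd a (ψ y) ∣ a := by exact_mod_cast Int.gcd_dvd_left (a := (a : ℤ)) (b := ψ y)
    have h9 := Nat.le_antisymm h7 (Nat.le_of_dvd ha h8)
    conv_lhs => rw [h9]
    exact Int.gcd_dvd_right ..
  obtain ⟨e, he⟩ := h6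
  -- Subtracting `e • φ` makes the correction vanish at `y`, so the sum again takes the value `a`
  -- there and the first case applies.
  have h10 := h1 (φ + (ψ - e • φ)) (by
    rw [LinearMap.add_apply, LinearMap.sub_apply, LinearMap.smul_apply, hφ, he, smul_eq_mul]
    ring) z hz
  have h11 := h1 φ hφ z hz
  rw [LinearMap.add_apply, LinearMap.sub_apply, LinearMap.smul_apply, smul_eq_mul] at h10
  have h12 : ψ z = (φ z + (ψ z - e * φ z)) - φ z + e * φ z := by ring
  rw [h12]
  exact dvd_add (dvd_sub h10 h11) (dvd_mul_of_dvd_right h11 _)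

/-- Induction on the rank. The least positive value `a = φ y` of a functional on `N` divides all
such values, so `y = a x` with `φ x = 1`. Then `M` is the direct sum of `ℤ x` and `ker φ`, and `N`
splits accordingly. Divisibility of all values by `a` yields the chain. Missing divisors are
recorded as `0`, which is consistent with the chain because everything divides `0`. -/
theorem exists_chain_equiv (k : ℕ) : ∀ (M : Type) [AddCommGroup M] [Module.Free ℤ M]
    [Module.Finite ℤ M], Module.finrank ℤ M = k → ∀ N : Submodule ℤ M,
    ∃ (e : M ≃ₗ[ℤ] (Fin k → ℤ)) (d : Fin k → ℕ), (∀ i j, i ≤ j → d i ∣ d j) ∧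
      (∀ y, y ∈ N ↔ ∀ i, (d i : ℤ) ∣ e y i) := by
  induction k with
  | zero =>
    intro M _ _ _ hM N
    refine ⟨(Module.finBasisOfFinrankEq ℤ M hM).equivFun, fun _ => 0, fun i => i.elim0, fun y => ?_⟩
    have : Subsingleton M := Module.finrank_zero_iff.1 hM
    rw [Subsingleton.elim y 0]
    simp
  | succ k ih =>
    intro M _ _ _ hM N
    by_cases hN : N = ⊥
    · refine ⟨(Module.finBasisOfFinrankEq ℤ M hM).equivFun, fun _ => 0, fun _ _ _ => dvd_rfl,
        fun y => ?_⟩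
      rw [hN, Submodule.mem_bot]
      simp only [Nat.cast_zero, zero_dvd_iff]
      constructor
      · rintro rfl i
        simp
      · intro h
        exact (LinearEquiv.map_eq_zero_iff _).1 (funext h)
    · let b := Module.finBasisOfFinrankEq ℤ M hM
      have hex : ∃ a : ℕ, 0 < a ∧ ∃ (ψ : M →ₗ[ℤ] ℤ) (z : M), z ∈ N ∧ ψ z = a := by
        obtain ⟨y, hy, hy0⟩ := (Submodule.ne_bot_iff N).1 hN
        have h1 : ∃ i, b.repr y i ≠ 0 := by
          by_contra h
          push Not at h
          apply hy0
          rw [← b.repr.map_eq_zero_iff]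
          exact Finsupp.ext h
        obtain ⟨i, hi⟩ := h1
        refine ⟨(b.repr y i).natAbs, Int.natAbs_pos.2 hi, ?_⟩
        rcases Int.natAbs_eq (b.repr y i) with h | h
        · exact ⟨b.coord i, y, hy, h⟩
        · refine ⟨-b.coord i, y, hy, ?_⟩
          rw [LinearMap.neg_apply, Module.Basis.coord_apply]
          omega
      classical
      obtain ⟨ha, φ, y, hy, hφ⟩ := Nat.find_spec hex
      have hmin : ∀ (ψ : M →ₗ[ℤ] ℤ) (z : M) (c : ℕ), 0 < c → z ∈ N → ψ z = c →
          Nat.find hex ≤ c := fun ψ z c hc hz h => Nat.find_min' hex ⟨hc, ψ, z, hz, h⟩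
      generalize Nat.find hex = a at ha hφ hmin
      have hdvd := fun ψ {z : M} (hz : z ∈ N) => dvd_of_minimal_value ha hmin hy hφ ψ hz
      have ha' : (a : ℤ) ≠ 0 := by exact_mod_cast ha.ne'
      -- The coordinates of `y` are values of functionals, so they are all divisible by `a`.
      obtain ⟨x, hx⟩ : ∃ x, (a : ℤ) • x = y := by
        choose c hc using fun i => hdvd (b.coord i) hy
        refine ⟨∑ i, c i • b i, ?_⟩
        rw [Finset.smul_sum, ← b.sum_repr y]
        refine Finset.sum_congr rfl fun i _ => ?_
        rw [smul_smul, ← hc]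
        rfl
      have hφx : φ x = 1 := by
        rw [← hx, map_smul, smul_eq_mul] at hφ
        exact mul_left_cancel₀ ha' (hφ.trans (mul_one _).symm)
      have hker : Module.finrank ℤ (LinearMap.ker φ) = k := by
        have h1 := (LinearMap.ker φ).finrank_quotient_add_finrank
        have h2 : Function.Surjective φ := fun c =>
          ⟨c • x, by rw [map_smul, hφx, smul_eq_mul, mul_one]⟩
        rw [(φ.quotKerEquivOfSurjective h2).finrank_eq, hM, Module.finrank_self] at h1
        omega
      obtain ⟨e, d, hd, he⟩ := ih (LinearMap.ker φ) hker (N.comap (LinearMap.ker φ).subtype)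
      let ρ : M →ₗ[ℤ] LinearMap.ker φ :=
        LinearMap.codRestrict _ (LinearMap.id - φ.smulRight x) fun z => by
          rw [LinearMap.mem_ker, LinearMap.sub_apply, LinearMap.smulRight_apply, map_sub, map_smul,
            hφx]
          simp
      have hρ : ∀ z, (ρ z : M) = z - φ z • x := fun z => rfl
      let E : M ≃ₗ[ℤ] (Fin (k + 1) → ℤ) :=
        { toFun := fun z => Fin.cons (φ z) (e (ρ z))
          map_add' := fun z w => by
            ext i
            refine Fin.cases ?_ (fun i => ?_) i <;> simp
          map_smul' := fun c z => by
            ext i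
            refine Fin.cases ?_ (fun i => ?_) i <;> simp
          invFun := fun f => f 0 • x + (e.symm (Fin.tail f) : M)
          left_inv := fun z => by simp [hρ]
          right_inv := fun f => by
            have h1 : φ (f 0 • x + (e.symm (Fin.tail f) : M)) = f 0 := by
              rw [map_add, map_smul, hφx, (e.symm (Fin.tail f)).2]
              simp
            have h2 : ρ (f 0 • x + (e.symm (Fin.tail f) : M)) = e.symm (Fin.tail f) := by
              apply Subtype.ext
              rw [hρ, h1]
              simp
            simp only [h1, h2, LinearEquiv.apply_symm_apply, Fin.cons_self_tail] }
      have hE0 : ∀ z, E z 0 = φ z := fun z => rfl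
      have hE1 : ∀ z i, E z (Fin.succ i) = e (ρ z) i := fun z i => rfl
      -- The number `d i` is the value on an element of `N` of the `i`-th coordinate on the kernel,
      -- extended to `M` by the projection `ρ`.
      have had : ∀ i, a ∣ d i := by
        intro i
        have h1 : ((e.symm (Pi.single i (d i : ℤ)) : LinearMap.ker φ) : M) ∈ N := by
          have := (he (e.symm (Pi.single i (d i : ℤ)))).2 fun j => by
            rw [LinearEquiv.apply_symm_apply]
            by_cases hj : j = i
            · subst hj
              rw [Pi.single_eq_same]
            · rw [Pi.single_eq_of_ne hj]
              exact dvd_zero _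
          exact this
        have h2 := hdvd (LinearMap.proj i ∘ₗ e.toLinearMap ∘ₗ ρ) h1
        have h3 : ρ ((e.symm (Pi.single i (d i : ℤ)) : LinearMap.ker φ) : M) =
            e.symm (Pi.single i (d i : ℤ)) := by
          apply Subtype.ext
          rw [hρ, (e.symm (Pi.single i (d i : ℤ))).2]
          simp
        simp only [LinearMap.comp_apply, h3, LinearEquiv.coe_coe, LinearEquiv.apply_symm_apply,
          LinearMap.proj_apply, Pi.single_eq_same] at h2
        exact_mod_cast h2
      refine ⟨E, Fin.cons a d, ?_, fun z => ?_⟩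
      · intro i j hij
        induction i using Fin.cases with
        | zero =>
          induction j using Fin.cases with
          | zero => exact dvd_rfl
          | succ j => simpa using had j
        | succ i =>
          induction j using Fin.cases with
          | zero => simp at hij
          | succ j => simpa using hd i j (by simpa using hij)
      · rw [Fin.forall_fin_succ]
        simp only [Fin.cons_zero, Fin.cons_succ, hE0, hE1]
        constructor
        · intro hz
          refine ⟨hdvd φ hz, (he (ρ z)).1 ?_⟩
          change (ρ z : M) ∈ N
          obtain ⟨c, hc⟩ := hdvd φ hz
          rw [hρ, hc, mul_comm, mul_smul, hx]
          exact N.sub_mem hz (N.smul_mem _ hy)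
        · rintro ⟨⟨c, hc⟩, h2⟩
          have h3 : (ρ z : M) ∈ N := (he (ρ z)).2 h2
          rw [hρ, hc, mul_comm, mul_smul, hx] at h3
          have := N.add_mem h3 (N.smul_mem c hy)
          rwa [sub_add_cancel] at this

theorem exists_isDiagonal_chain {m : ℕ} (L : Submodule ℤ (Fin m → ℤ)) :
    ∃ (b : Module.Basis (Fin m) ℤ (Fin m → ℤ)) (d : Fin m → ℕ),
      (∀ i j, i ≤ j → d i ∣ d j) ∧ IsDiagonal L b d := by
  obtain ⟨e, d, hd, he⟩ := exists_chain_equiv m (Fin m → ℤ) (by simp) L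
  refine ⟨Module.Basis.ofEquivFun e, d, hd, fun y => ?_⟩
  rw [he]
  simp [Module.Basis.ofEquivFun_repr_apply]

namespace IsDiagonal

variable {m : ℕ} {L : Submodule ℤ (Fin m → ℤ)} {b : Module.Basis (Fin m) ℤ (Fin m → ℤ)}
  {d : Fin m → ℕ}

theorem smul_basis_mem_iff (h : IsDiagonal L b d) {i : Fin m} {c : ℤ} :
    c • b i ∈ L ↔ (d i : ℤ) ∣ c := by
  rw [h]
  constructor
  · intro h1
    have h2 := h1 i
    rwa [map_smul, Module.Basis.repr_self, Finsupp.smul_apply, Finsupp.single_eq_same, smul_eq_mul,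
      mul_one] at h2
  · intro h1 j
    rw [map_smul, Module.Basis.repr_self]
    by_cases hj : j = i
    · subst hj
      simpa using h1
    · simp [Finsupp.single_eq_of_ne hj]

/-- The Smith normal form that belongs to a diagonal basis with a chain of divisors. -/
theorem exists_smithNormalForm (h : IsDiagonal L b d) (hd : ∀ i j, i ≤ j → d i ∣ d j)
    {i₀ : Fin m} (hi₀ : d i₀ ≠ 0) : d i₀ ∈ elementaryDivisors L := by
  classical
  -- Only the nonzero `d i` contribute to a basis of `L`. Enumerating them in increasing order
  -- preserves the divisor chain.
  let S := Finset.univ.filter fun i => d i ≠ 0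
  let f : Fin S.card ↪o Fin m := S.orderEmbOfFin rfl
  have hf : ∀ j, d (f j) ≠ 0 := fun j => (Finset.mem_filter.1 (S.orderEmbOfFin_mem rfl j)).2
  have hfs : ∀ i, d i ≠ 0 → ∃ j, f j = i := by
    intro i hi
    have : i ∈ Set.range (S.orderEmbOfFin rfl) := by
      rw [Finset.range_orderEmbOfFin]
      simpa [S] using hi
    exact this
  let v : Fin S.card → L := fun j => ⟨(d (f j) : ℤ) • b (f j), h.smul_basis_mem_iff.2 dvd_rfl⟩
  have hli : LinearIndependent ℤ v := by
    rw [Fintype.linearIndependent_iff]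
    intro g hg j
    have h1 := congrArg (fun y : L => b.repr (y : Fin m → ℤ) (f j)) hg
    simp only [Submodule.coe_sum, Submodule.coe_smul, Submodule.coe_zero, map_zero, v, map_sum,
      map_smul, Module.Basis.repr_self, Finsupp.coe_finsetSum, Finset.sum_apply,
      Finsupp.smul_apply, smul_eq_mul, Finsupp.coe_zero, Pi.zero_apply, Finsupp.single_apply,
      EmbeddingLike.apply_eq_iff_eq, mul_ite, mul_one, mul_zero, Finset.sum_ite_eq',
      Finset.mem_univ, if_true] at h1
    have h2 : (d (f j) : ℤ) ≠ 0 := by exact_mod_cast hf j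
    exact (mul_eq_zero.1 h1).resolve_right h2
  have hsp : ⊤ ≤ Submodule.span ℤ (Set.range v) := by
    rintro ⟨y, hy⟩ -
    have h1 : y = ∑ j, (b.repr y (f j) / d (f j)) • (v j : Fin m → ℤ) := by
      have h2 : ∀ i, d i = 0 → b.repr y i = 0 := by
        intro i hi
        have := (h y).1 hy i
        rwa [hi, Nat.cast_zero, zero_dvd_iff] at this
      conv_lhs => rw [← b.sum_repr y]
      rw [← Finset.sum_subset (Finset.subset_univ S) fun i _ hi => ?_]
      · conv_lhs => rw [← Finset.map_orderEmbOfFin_univ S rfl, Finset.sum_map]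
        refine Finset.sum_congr rfl fun j _ => ?_
        have h3 := (h y).1 hy (f j)
        change b.repr y (f j) • b (f j) =
          (b.repr y (f j) / d (f j)) • ((d (f j) : ℤ) • b (f j))
        rw [smul_smul, Int.ediv_mul_cancel h3]
      · rw [h2 i (by simpa [S] using hi), zero_smul]
    have h4 : (⟨y, hy⟩ : L) = ∑ j, (b.repr y (f j) / d (f j)) • v j := by
      apply Subtype.ext
      rw [Submodule.coe_sum]
      exact h1
    rw [h4]
    exact Submodule.sum_mem _ fun j _ => Submodule.smul_mem _ _ (Submodule.subset_span ⟨j, rfl⟩)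
  let s : Module.Basis.SmithNormalForm L (Fin m) S.card :=
    { bM := b
      bN := Module.Basis.mk hli hsp
      f := f.toEmbedding
      a := fun j => d (f j)
      snf := fun j => by rw [Module.Basis.mk_apply]; rfl }
  obtain ⟨j, hj⟩ := hfs i₀ hi₀
  refine ⟨S.card, s, fun i => ?_, fun i j hij => ?_, j, ?_⟩
  · change (0 : ℤ) < d (f i)
    exact_mod_cast Nat.pos_of_ne_zero (hf i)
  · change (d (f i) : ℤ) ∣ d (f j)
    exact_mod_cast hd _ _ (f.monotone hij)
  · change (d (f j) : ℤ) = d i₀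
    rw [hj]

/-- If `D` is a multiple of the nonzero `d i`, then it annihilates the torsion modulo `L`. -/
theorem smul_mem_of_torsion (h : IsDiagonal L b d) {D : ℤ} (hD : ∀ i, d i ≠ 0 → (d i : ℤ) ∣ D)
    {c : ℤ} (hc : c ≠ 0) {y : Fin m → ℤ} (hy : c • y ∈ L) : D • y ∈ L := by
  rw [h] at hy ⊢
  intro i
  have h1 := hy i
  rw [map_smul, Finsupp.smul_apply, smul_eq_mul] at h1 ⊢
  by_cases hi : d i = 0
  · rw [hi, Nat.cast_zero, zero_dvd_iff] at h1 ⊢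
    rw [(mul_eq_zero.1 h1).resolve_left hc, mul_zero]
  · exact dvd_mul_of_dvd_left (hD i hi) _

/-- In another Smith normal form, `x` times a basis vector lies in `L`; then so does `D` times it,
and reading the coordinate gives `x ∣ D`. -/
theorem dvd_of_mem_elementaryDivisors (h : IsDiagonal L b d) {D : ℕ}
    (hD : ∀ i, d i ≠ 0 → d i ∣ D) {x : ℕ} (hx : x ∈ elementaryDivisors L) : x ∣ D := by
  obtain ⟨r, s, hpos, -, i, hi⟩ := hx
  have h1 : s.a i • s.bM (s.f i) ∈ L := by
    rw [← s.snf]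
    exact (s.bN i).2
  have h2 := h.smul_mem_of_torsion (D := D) (fun i hi => by exact_mod_cast hD i hi)
    (hpos i).ne' h1
  have h3 := s.repr_apply_embedding_eq_repr_smul ⟨_, h2⟩ (i := i)
  simp only [map_smul, Module.Basis.repr_self, Finsupp.smul_apply, Finsupp.single_eq_same,
    smul_eq_mul, mul_one] at h3
  rw [hi] at h3
  have h4 : (x : ℤ) ∣ D := ⟨_, h3⟩
  exact_mod_cast h4

theorem exists_largest (hd : ∀ i j, i ≤ j → d i ∣ d j) :
    ∃ D, (D = 1 ∨ ∃ i, d i ≠ 0 ∧ D = d i) ∧ ∀ i, d i ≠ 0 → d i ∣ D := by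
  classical
  by_cases h0 : ∀ i, d i = 0
  · exact ⟨1, Or.inl rfl, fun i hi => absurd (h0 i) hi⟩
  · push Not at h0
    obtain ⟨i, hi⟩ := h0
    obtain ⟨j, hj, hmax⟩ := Finset.exists_max_image (Finset.univ.filter fun i => d i ≠ 0) d
      ⟨i, by simpa using hi⟩
    have hj' : d j ≠ 0 := by simpa using hj
    refine ⟨d j, Or.inr ⟨j, hj', rfl⟩, fun i hi => ?_⟩
    rcases le_total i j with hij | hij
    · exact hd i j hij
    · have h1 := hd j i hij
      have h2 := hmax i (by simpa using hi)
      rw [Nat.le_antisymm h2 (Nat.le_of_dvd (Nat.pos_of_ne_zero hi) h1)]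

/-- No divisor chain is required, so any certified diagonal basis may be used to compute the value.
-/
theorem largestElementaryDivisor_eq (h : IsDiagonal L b d) {D : ℕ}
    (hD1 : D = 1 ∨ ∃ i, d i ≠ 0 ∧ D = d i) (hD : ∀ i, d i ≠ 0 → d i ∣ D) :
    largestElementaryDivisor L = D := by
  have hD0 : D ≠ 0 := by
    rcases hD1 with rfl | ⟨i, hi, rfl⟩
    · exact one_ne_zero
    · exact hi
  have hle : ∀ x ∈ insert 1 (elementaryDivisors L), x ≤ D := by
    rintro x (rfl | hx)
    · exact Nat.one_le_iff_ne_zero.2 hD0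
    · exact Nat.le_of_dvd (Nat.pos_of_ne_zero hD0) (h.dvd_of_mem_elementaryDivisors hD hx)
  have hmem : D ∈ insert 1 (elementaryDivisors L) := by
    rcases hD1 with rfl | ⟨i, hi, rfl⟩
    · exact Set.mem_insert _ _
    -- The given `d` may fail to be a chain and then is not a Smith normal form. Comparison with a
    -- chain `d'` shows that the two candidates divide each other.
    · obtain ⟨b', d', hd', h'⟩ := exists_isDiagonal_chain L
      obtain ⟨D', hD1', hD'⟩ := exists_largest hd'
      have h1 : d i ∣ D' := by
        have h2 := h'.smul_mem_of_torsion (D := D') (fun i hi => by exact_mod_cast hD' i hi)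
          (c := d i) (by exact_mod_cast hi) (y := b i) (h.smul_basis_mem_iff.2 dvd_rfl)
        exact_mod_cast h.smul_basis_mem_iff.1 h2
      rcases hD1' with rfl | ⟨j, hj, rfl⟩
      · rw [Nat.dvd_one.1 h1]
        exact Set.mem_insert _ _
      · have h3 := h'.exists_smithNormalForm hd' hj
        have h4 := h.dvd_of_mem_elementaryDivisors hD h3
        rw [Nat.dvd_antisymm h1 h4]
        exact Set.mem_insert_of_mem _ h3
  exact le_antisymm (csSup_le ⟨_, hmem⟩ hle) (le_csSup ⟨D, hle⟩ hmem)

end IsDiagonal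

theorem largestElementaryDivisor_pos {m : ℕ} (L : Submodule ℤ (Fin m → ℤ)) :
    0 < largestElementaryDivisor L := by
  obtain ⟨b, d, hd, h⟩ := exists_isDiagonal_chain L
  obtain ⟨D, hD1, hD⟩ := IsDiagonal.exists_largest hd
  rw [h.largestElementaryDivisor_eq hD1 hD]
  rcases hD1 with rfl | ⟨i, hi, rfl⟩
  · exact one_pos
  · exact Nat.pos_of_ne_zero hi

theorem largestElementaryDivisor_smul_mem {m : ℕ} {L : Submodule ℤ (Fin m → ℤ)} {c : ℕ}
    (hc : c ≠ 0) {y : Fin m → ℤ} (hy : c • y ∈ L) : largestElementaryDivisor L • y ∈ L := by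
  obtain ⟨b, d, hd, h⟩ := exists_isDiagonal_chain L
  obtain ⟨D, hD1, hD⟩ := IsDiagonal.exists_largest hd
  rw [h.largestElementaryDivisor_eq hD1 hD, ← natCast_zsmul]
  exact h.smul_mem_of_torsion (fun i hi => by exact_mod_cast hD i hi) (c := c)
    (by exact_mod_cast hc) (by rwa [natCast_zsmul])

end DiagonalBasis

/-! ## Orders in free times free-abelian groups -/

namespace FTA

variable {n m : ℕ} {H : Subgroup (FTA n m)}

theorem mem_freePart {u : FreeGroup (Fin n)} : u ∈ freePart H ↔ ∃ s, (u, s) ∈ H := by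
  unfold freePart
  rw [Subgroup.mem_map]
  constructor
  · rintro ⟨⟨v, s⟩, h, rfl⟩
    exact ⟨s, h⟩
  · rintro ⟨s, h⟩
    exact ⟨_, h, rfl⟩

theorem fst_mem_freePart {g : FTA n m} (hg : g ∈ H) : g.1 ∈ freePart H := mem_freePart.2 ⟨g.2, hg⟩

theorem mem_baseSubgroup {s : Multiplicative (Fin m → ℤ)} :
    s ∈ baseSubgroup H ↔ ((1 : FreeGroup (Fin n)), s) ∈ H := Iff.rfl

theorem mem_baseSubmodule {y : Fin m → ℤ} :
    y ∈ baseSubmodule H ↔ Multiplicative.ofAdd y ∈ baseSubgroup H := Iff.rfl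

theorem commute_inr (g : FTA n m) (s : Multiplicative (Fin m → ℤ)) :
    Commute g ((1 : FreeGroup (Fin n)), s) := by
  ext1 <;> simp [mul_comm]

/-- The order of an element is the product of the order of its free part and of an order in the
free-abelian part. -/
theorem relOrder_eq_mul {g h : FTA n m} {y : Multiplicative (Fin m → ℤ)} (hh : h ∈ H)
    (hg : g ^ relOrder (freePart H : Set (FreeGroup (Fin n))) g.1 = h * (1, y)) :
    relOrder (H : Set (FTA n m)) g = relOrder (freePart H : Set (FreeGroup (Fin n))) g.1 *
      relOrder (baseSubgroup H : Set (Multiplicative (Fin m → ℤ))) y := by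
  set a := relOrder (freePart H : Set (FreeGroup (Fin n))) g.1
  -- Since `(1, y)` is central, the power splits, and the factor `h ^ i` lies in `H`.
  have key : ∀ i, g ^ (a * i) ∈ H ↔ y ^ i ∈ baseSubgroup H := by
    intro i
    rw [pow_mul, hg, (commute_inr h y).mul_pow, H.mul_mem_cancel_left (H.pow_mem hh i),
      mem_baseSubgroup]
    simp
  rw [relOrder_eq_iff]
  intro j
  constructor
  · intro hj
    have h1 : a ∣ j := pow_mem_iff_relOrder_dvd.1 (by
      have := fst_mem_freePart hj
      rwa [Prod.pow_fst] at this)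
    obtain ⟨i, rfl⟩ := h1
    exact mul_dvd_mul_left a (pow_mem_iff_relOrder_dvd.1 ((key i).1 hj))
  · rintro ⟨i, rfl⟩
    rw [mul_assoc, key]
    exact pow_mem_iff_relOrder_dvd.2 (dvd_mul_right _ _)

theorem exists_pow_eq (H : Subgroup (FTA n m)) (g : FTA n m) : ∃ h ∈ H, ∃ y,
    g ^ relOrder (freePart H : Set (FreeGroup (Fin n))) g.1 = h * (1, y) := by
  obtain ⟨s, hs⟩ := mem_freePart.1 (pow_relOrder_mem (H := freePart H) (g := g.1))
  refine ⟨_, hs, s⁻¹ * g.2 ^ relOrder (freePart H : Set (FreeGroup (Fin n))) g.1, ?_⟩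
  ext1
  · simp
  · simp

theorem relSpectrum_subset (H : Subgroup (FTA n m)) : relSpectrum (H : Set (FTA n m)) ⊆
    relSpectrum (freePart H : Set (FreeGroup (Fin n))) *
      relSpectrum (baseSubgroup H : Set (Multiplicative (Fin m → ℤ))) := by
  rintro _ ⟨g, rfl⟩
  obtain ⟨h, hh, y, hy⟩ := exists_pow_eq H g
  rw [relOrder_eq_mul hh hy]
  exact Set.mul_mem_mul ⟨_, rfl⟩ ⟨_, rfl⟩

/-- A positive order makes `y` torsion modulo the submodule, so the largest elementary divisor is an
exponent that the order divides. -/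
theorem relOrder_baseSubgroup_le (H : Subgroup (FTA n m)) (y : Multiplicative (Fin m → ℤ)) :
    relOrder (baseSubgroup H : Set (Multiplicative (Fin m → ℤ))) y ≤
      largestElementaryDivisor (baseSubmodule H) := by
  set b := relOrder (baseSubgroup H : Set (Multiplicative (Fin m → ℤ))) y with hb
  rcases Nat.eq_zero_or_pos b with h0 | h0
  · omega
  · have h1 : b • y.toAdd ∈ baseSubmodule H := by
      rw [mem_baseSubmodule, ofAdd_nsmul]
      exact pow_relOrder_mem
    have h2 := largestElementaryDivisor_smul_mem h0.ne' h1
    rw [mem_baseSubmodule, ofAdd_nsmul] at h2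
    exact Nat.le_of_dvd (largestElementaryDivisor_pos _) (pow_mem_iff_relOrder_dvd.1 h2)

theorem freePart_fg (hH : H.FG) : (freePart H).FG := by
  obtain ⟨S, rfl⟩ := hH
  classical
  refine ⟨S.image (MonoidHom.fst _ _), ?_⟩
  unfold freePart
  rw [MonoidHom.map_closure, Finset.coe_image]

theorem restrictedStallings_finite (hH : H.FG) : (restrictedStallings (freePart H)).verts.Finite :=
  (exists_generatedInLength (freePart_fg hH)).choose_spec.restrictedStallings_verts_finite

theorem relOrder_le_spectrumBound (hH : H.FG) (g : FTA n m) :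
    relOrder (H : Set (FTA n m)) g ≤ spectrumBound H := by
  obtain ⟨h, hh, y, hy⟩ := exists_pow_eq H g
  rw [relOrder_eq_mul hh hy]
  exact Nat.mul_le_mul (relOrder_le_ncard_verts (restrictedStallings_finite hH) _)
    (relOrder_baseSubgroup_le H y)

end FTA

/-! ## Words as inputs of algorithms -/

section Words

variable {X : Type*} [Primcodable X]

theorem primrec_invRev : Primrec (FreeGroup.invRev : List (X × Bool) → List (X × Bool)) :=
  Primrec.list_reverse.comp (Primrec.list_map Primrec.id
    ((Primrec.fst.comp Primrec.snd).pair (Primrec.not.comp (Primrec.snd.comp Primrec.snd))))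

theorem primrec_flatten_replicate {α : Type*} [Primcodable α] :
    Primrec₂ fun (k : ℕ) (w : List α) => (List.replicate k w).flatten := by
  refine (Primrec.list_flatten.comp (Primrec.list_map (Primrec.list_range.comp Primrec.fst)
    (show Primrec₂ fun (x : ℕ × List α) (_ : ℕ) => x.2 from
      Primrec.snd.comp Primrec.fst))).of_eq fun x => ?_
  simp [List.map_const']

theorem primrec_reduce [Finite X] [DecidableEq X] :
    Primrec (FreeGroup.reduce : List (X × Bool) → List (X × Bool)) := by
  have hc : PrimrecRel fun a b : X × Bool => a.1 = b.1 ∧ a.2 = !b.2 := by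
    classical
    exact Primrec.primrecPred (Primrec.dom_finite _)
  have hstep : Primrec₂ fun (_ : List (X × Bool)) (x : (X × Bool) × List (X × Bool)) =>
      (List.casesOn x.2 [x.1] fun b t =>
        if x.1.1 = b.1 ∧ x.1.2 = !b.2 then t else x.1 :: b :: t : List (X × Bool)) := by
    have h0 : Primrec fun x : List (X × Bool) × ((X × Bool) × List (X × Bool)) => x.2.2 :=
      Primrec.snd.comp Primrec.snd
    have h0' : Primrec fun x : List (X × Bool) × ((X × Bool) × List (X × Bool)) => [x.2.1] :=
      Primrec.list_cons.comp (Primrec.fst.comp Primrec.snd) (Primrec.const [])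
    refine Primrec.list_casesOn (h := fun (x : List (X × Bool) × ((X × Bool) × List (X × Bool)))
        (y : (X × Bool) × List (X × Bool)) =>
          if x.2.1.1 = y.1.1 ∧ x.2.1.2 = !y.1.2 then y.2 else x.2.1 :: y.1 :: y.2) h0 h0' ?_
    have h1 := Primrec.fst.comp (Primrec.snd.comp
      (Primrec.fst (α := List (X × Bool) × ((X × Bool) × List (X × Bool)))
        (β := (X × Bool) × List (X × Bool))))
    have h2 := Primrec.snd (α := List (X × Bool) × ((X × Bool) × List (X × Bool)))
        (β := (X × Bool) × List (X × Bool))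
    exact Primrec.ite (hc.comp h1 (Primrec.fst.comp h2)) (Primrec.snd.comp h2)
      (Primrec.list_cons.comp h1 (Primrec.list_cons.comp (Primrec.fst.comp h2)
        (Primrec.snd.comp h2)))
  refine (Primrec.list_foldr Primrec.id (Primrec.const []) hstep).of_eq fun l => ?_
  induction l with
  | nil => rfl
  | cons a l ih =>
    simp only [id, List.foldr_cons] at ih ⊢
    rw [ih]
    rfl

theorem primrecPred_isReduced [Finite X] :
    PrimrecPred (FreeGroup.IsReduced : List (X × Bool) → Prop) := by
  classical
  refine (Primrec.eq.comp primrec_reduce Primrec.id).of_eq fun w => ?_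
  exact FreeGroup.isReduced_iff_reduce_eq.symm

theorem primrecPred_isCyclicallyReduced [Finite X] :
    PrimrecPred (FreeGroup.IsCyclicallyReduced : List (X × Bool) → Prop) :=
  (primrecPred_isReduced.comp (Primrec.list_append.comp Primrec.id Primrec.id)).of_eq fun _ =>
    FreeGroup.isCyclicallyReduced_iff_append_self.symm

/-- The words of length at most `l` over a list of letters. -/
def wordsUpTo {α : Type*} (A : List α) : ℕ → List (List α)
  | 0 => [[]]
  | l + 1 => [] :: A.flatMap fun a => (wordsUpTo A l).map (a :: ·)

theorem mem_wordsUpTo {α : Type*} {A : List α} (hA : ∀ a, a ∈ A) {l : ℕ} {w : List α} :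
    w ∈ wordsUpTo A l ↔ w.length ≤ l := by
  induction l generalizing w with
  | zero => simp [wordsUpTo]
  | succ l ih =>
    rcases w with _ | ⟨a, w⟩
    · simp [wordsUpTo]
    · simp [wordsUpTo, ih, hA]

theorem primrec_wordsUpTo {α : Type*} [Primcodable α] (A : List α) : Primrec (wordsUpTo A) := by
  have hstep : Primrec₂ fun (_ : ℕ) (x : List (List α)) =>
      [] :: A.flatMap fun a => x.map (a :: ·) := by
    refine Primrec.list_cons.comp (Primrec.const []) (Primrec.list_flatMap (Primrec.const A) ?_)
    refine Primrec.list_map (Primrec.snd.comp Primrec.fst) ?_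
    exact Primrec.list_cons.comp (Primrec.snd.comp Primrec.fst) Primrec.snd
  refine (Primrec.nat_rec₁ [[]] hstep).of_eq fun l => ?_
  induction l with
  | zero => rfl
  | succ l ih =>
    simp only at ih ⊢
    rw [ih]
    rfl

theorem primrec_pow : Primrec₂ fun a b : ℕ => a ^ b :=
  Primrec₂.unpaired'.1 Nat.Primrec.pow

end Words

namespace FTA

variable {n m : ℕ}

/-- The letters `x_i^{±1}` and `t_j^{±1}`. -/
abbrev Letter (n m : ℕ) : Type := (Fin n ⊕ Fin m) × Bool

/-- Words in the letters `x_i^{±1}` and `t_j^{±1}`. -/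
abbrev Word (n m : ℕ) : Type := List (Letter n m)

/-- Words in the letters `x_i^{±1}`. -/
abbrev FreeWord (n : ℕ) : Type := List (Fin n × Bool)

/-- The element that a word represents. -/
abbrev eval (w : Word n m) : FTA n m := wordEval (gen n m) w

/-- The subgroup generated by the elements that the words in a list represent. -/
abbrev span (W : List (Word n m)) : Subgroup (FTA n m) := subgroupOfWords (gen n m) W

@[simp] theorem eval_nil : eval ([] : Word n m) = 1 := by
  unfold eval wordEval
  rw [← FreeGroup.one_eq_mk, map_one]

@[simp] theorem eval_append (u v : Word n m) : eval (u ++ v) = eval u * eval v := by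
  unfold eval wordEval
  rw [← FreeGroup.mul_mk, map_mul]

@[simp] theorem eval_invRev (u : Word n m) : eval (FreeGroup.invRev u) = (eval u)⁻¹ := by
  unfold eval wordEval
  rw [← FreeGroup.inv_mk, map_inv]

theorem eval_cons (a : Letter n m) (u : Word n m) : eval (a :: u) = eval [a] * eval u := by
  rw [← eval_append, List.singleton_append]

@[simp] theorem eval_flatten_replicate (k : ℕ) (u : Word n m) :
    eval (List.replicate k u).flatten = eval u ^ k := by
  induction k with
  | zero => simp
  | succ k ih => rw [List.replicate_succ, List.flatten_cons, eval_append, ih, pow_succ']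

theorem eval_inl (i : Fin n) (b : Bool) :
    eval [((Sum.inl i : Fin n ⊕ Fin m), b)] = (FreeGroup.mk [(i, b)], 1) := by
  unfold eval wordEval
  cases b <;> simp [gen, FreeGroup.of, FreeGroup.inv_mk, FreeGroup.invRev]

theorem eval_inr (j : Fin m) (b : Bool) :
    eval [((Sum.inr j : Fin n ⊕ Fin m), b)] =
      (1, Multiplicative.ofAdd (Pi.single j (if b then 1 else -1))) := by
  unfold eval wordEval
  cases b
  · simp [gen, Pi.single_neg]
  · simp [gen]

/-- The free part of a word. -/
def proj (w : Word n m) : FreeWord n :=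
  w.filterMap fun a => a.1.elim (fun i => some (i, a.2)) fun _ => none

theorem primrec_proj : Primrec (proj : Word n m → FreeWord n) :=
  Primrec.listFilterMap Primrec.id ((Primrec.dom_finite fun a : Letter n m =>
    (a.1.elim (fun i => some (i, a.2)) fun _ => none : Option (Fin n × Bool))).comp Primrec.snd)

theorem proj_append (u v : Word n m) : proj (u ++ v) = proj u ++ proj v :=
  List.filterMap_append

theorem fst_eval (w : Word n m) : (eval w).1 = FreeGroup.mk (proj w) := by
  induction w with
  | nil => simp [proj, FreeGroup.one_eq_mk]
  | cons a w ih =>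
    have h : proj (a :: w) = proj [a] ++ proj w := proj_append [a] w
    rw [eval_cons, Prod.fst_mul, ih, h, FreeGroup.mk_append]
    congr 1
    obtain ⟨i | j, b⟩ := a
    · rw [eval_inl]
      rfl
    · rw [eval_inr]
      rfl

/-- A word in the letters of the free part as a word in all the letters. -/
def emb (c : FreeWord n) : Word n m := c.map fun a => (Sum.inl a.1, a.2)

theorem primrec_emb : Primrec (emb : FreeWord n → Word n m) :=
  Primrec.list_map Primrec.id ((Primrec.dom_finite fun a : Fin n × Bool =>
    ((Sum.inl a.1, a.2) : Letter n m)).comp Primrec.snd)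

theorem eval_emb (c : FreeWord n) : eval (emb c : Word n m) = (FreeGroup.mk c, 1) := by
  induction c with
  | nil =>
    simp only [emb, List.map_nil, eval_nil, ← FreeGroup.one_eq_mk]
    rfl
  | cons a c ih =>
    have : (emb (a :: c) : Word n m) = [(Sum.inl a.1, a.2)] ++ emb c := rfl
    rw [this, eval_append, ih, eval_inl, FreeGroup.mk_cons a c]
    simp

/-- Exponents as differences of letter counts: vanishing becomes an equality of natural numbers,
which makes the word problem primitive recursive. -/
theorem toAdd_snd_eval (w : Word n m) (j : Fin m) : (eval w).2.toAdd j =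
    (w.filter (· = (Sum.inr j, true))).length - (w.filter (· = (Sum.inr j, false))).length := by
  induction w with
  | nil => simp
  | cons a w ih =>
    rw [eval_cons, Prod.snd_mul, toAdd_mul, Pi.add_apply, ih, List.filter_cons, List.filter_cons]
    obtain ⟨i | k, b⟩ := a
    · rw [eval_inl]
      simp
    · rw [eval_inr]
      by_cases hk : k = j
      · subst hk
        cases b <;> simp <;> ring
      · cases b <;> simp [hk, Ne.symm hk]

theorem primrecPred_fst_eval_eq_one : PrimrecPred fun w : Word n m => (eval w).1 = 1 := by
  refine (Primrec.eq.comp (primrec_reduce.comp primrec_proj) (Primrec.const [])).of_eq fun w => ?_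
  rw [fst_eval, ← FreeGroup.toWord_mk, FreeGroup.toWord_eq_nil_iff]

theorem primrecPred_eval_eq_one : PrimrecPred fun w : Word n m => eval w = 1 := by
  have hcount : ∀ b : Bool, Primrec fun w : Word n m =>
      List.ofFn fun j : Fin m => (w.filter (· = (Sum.inr j, b))).length := by
    intro b
    refine Primrec.list_ofFn fun j => Primrec.list_length.comp ?_
    exact Primrec.listFilter (Primrec.eq.comp Primrec.id (Primrec.const _))
  refine (primrecPred_fst_eval_eq_one.and
    (Primrec.eq.comp (hcount true) (hcount false))).of_eq fun w => ?_
  rw [Prod.ext_iff, Prod.fst_one, Prod.snd_one, ← toAdd_eq_zero, funext_iff,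
    List.ofFn_injective.eq_iff, funext_iff]
  refine and_congr_right fun _ => forall_congr' fun j => ?_
  rw [toAdd_snd_eval, Pi.zero_apply, sub_eq_zero, Nat.cast_inj]

theorem primrecRel_eval_eq : PrimrecRel fun u v : Word n m => eval u = eval v := by
  refine (primrecPred_eval_eq_one.comp (Primrec.list_append.comp Primrec.fst
    (primrec_invRev.comp Primrec.snd))).of_eq fun x => ?_
  rw [eval_append, eval_invRev, mul_inv_eq_one]

/-- Every element is represented by a word. -/
theorem eval_surjective (g : FTA n m) : ∃ w : Word n m, eval w = g := by
  have h1 : ∀ s : Fin m → ℤ, ∃ w : Word n m, eval w = (1, Multiplicative.ofAdd s) := by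
    intro s
    have hsum : s = ∑ j, s j • Pi.single j (1 : ℤ) := by
      ext k
      simp [Finset.sum_apply, Pi.single_apply]
    have hgen : ∀ (j : Fin m) (c : ℤ),
        ∃ w : Word n m, eval w = (1, Multiplicative.ofAdd (c • Pi.single j (1 : ℤ))) := by
      intro j c
      induction c with
      | zero => exact ⟨[], by rw [eval_nil, zero_smul]; rfl⟩
      | succ i ih =>
        obtain ⟨w, hw⟩ := ih
        refine ⟨w ++ [(Sum.inr j, true)], ?_⟩
        rw [eval_append, hw, eval_inr, add_smul, ofAdd_add]
        simp
      | pred i ih =>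
        obtain ⟨w, hw⟩ := ih
        refine ⟨w ++ [(Sum.inr j, false)], ?_⟩
        rw [eval_append, hw, eval_inr, sub_smul, sub_eq_add_neg, ofAdd_add]
        simp [Pi.single_neg]
    rw [hsum]
    induction (Finset.univ : Finset (Fin m)) using Finset.induction_on with
    | empty => exact ⟨[], by rw [eval_nil, Finset.sum_empty]; rfl⟩
    | insert j S hj ih =>
      obtain ⟨w, hw⟩ := ih
      obtain ⟨v, hv⟩ := hgen j (s j)
      refine ⟨v ++ w, ?_⟩
      rw [Finset.sum_insert hj, eval_append, hv, hw, ofAdd_add]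
      simp
  obtain ⟨w, hw⟩ := h1 g.2.toAdd
  refine ⟨emb g.1.toWord ++ w, ?_⟩
  rw [eval_append, hw, eval_emb, FreeGroup.mk_toWord]
  ext1 <;> simp

theorem eval_mem_span {W : List (Word n m)} {w : Word n m} (hw : w ∈ W) : eval w ∈ span W :=
  Subgroup.subset_closure ⟨w, hw, rfl⟩

theorem span_le {W : List (Word n m)} {H : Subgroup (FTA n m)} :
    span W ≤ H ↔ ∀ w ∈ W, eval w ∈ H := by
  unfold span subgroupOfWords
  rw [Subgroup.closure_le]
  constructor
  · intro h w hw
    exact h ⟨w, hw, rfl⟩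
  · rintro h _ ⟨w, hw, rfl⟩
    exact h w hw

theorem span_fg (W : List (Word n m)) : (span W).FG := by
  rw [Subgroup.fg_iff]
  refine ⟨_, rfl, ?_⟩
  have : {g | ∃ w ∈ W, wordEval (gen n m) w = g} = eval '' {w | w ∈ W} := rfl
  rw [this]
  exact (List.finite_toSet W).image _

theorem mem_span_iff {W : List (Word n m)} {g : FTA n m} : g ∈ span W ↔
    ∃ l : List (Word n m), (∀ x ∈ l, ∃ w ∈ W, x = w ∨ x = FreeGroup.invRev w) ∧
      eval l.flatten = g := by
  constructor
  · intro hg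
    unfold span subgroupOfWords at hg
    induction hg using Subgroup.closure_induction with
    | mem x hx =>
      obtain ⟨w, hw, rfl⟩ := hx
      exact ⟨[w], by simpa using ⟨w, hw, Or.inl rfl⟩, by simp⟩
    | one => exact ⟨[], by simp, by simp⟩
    | mul x y _ _ ihx ihy =>
      obtain ⟨l, hl, rfl⟩ := ihx
      obtain ⟨l', hl', rfl⟩ := ihy
      refine ⟨l ++ l', fun z hz => ?_, by simp⟩
      rcases List.mem_append.1 hz with h | h
      · exact hl z h
      · exact hl' z h
    | inv x hx ih =>
      obtain ⟨l, hl, rfl⟩ := ih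
      clear hx
      refine ⟨(l.map FreeGroup.invRev).reverse, fun z hz => ?_, ?_⟩
      · rw [List.mem_reverse, List.mem_map] at hz
        obtain ⟨y, hy, rfl⟩ := hz
        obtain ⟨w, hw, rfl | rfl⟩ := hl y hy
        · exact ⟨y, hw, Or.inr rfl⟩
        · exact ⟨w, hw, Or.inl FreeGroup.invRev_invRev⟩
      · clear hl
        induction l with
        | nil => simp
        | cons y l ih => simp [ih]
  · rintro ⟨l, hl, rfl⟩
    induction l with
    | nil => simp
    | cons y l ih =>
      rw [List.flatten_cons, eval_append]
      refine (span W).mul_mem ?_ (ih fun x hx => hl x (List.mem_cons_of_mem _ hx))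
      obtain ⟨w, hw, rfl | rfl⟩ := hl y List.mem_cons_self
      · exact eval_mem_span hw
      · rw [eval_invRev]
        exact (span W).inv_mem (eval_mem_span hw)

/-- The certificate is a list of generators and inverses whose product is compared with the element
by the word problem. -/
theorem semiDec_mem_span :
    SemiDec fun p : List (Word n m) × Word n m => eval p.2 ∈ span p.1 := by
  refine SemiDec.of_eq (p := fun p : List (Word n m) × Word n m => ∃ l : List (Word n m),
    (∀ x ∈ l, ∃ w ∈ p.1, x = w ∨ x = FreeGroup.invRev w) ∧ eval l.flatten = eval p.2) ?_
    fun p => mem_span_iff.symm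
  refine SemiDec.ex (SemiDec.and (SemiDec.ball Primrec.snd (SemiDec.bex
    (Primrec.fst.comp (Primrec.fst.comp Primrec.fst)) (PrimrecPred.semiDec ?_))) ?_)
  · exact (Primrec.eq.comp (Primrec.snd.comp Primrec.fst) Primrec.snd).or
      (Primrec.eq.comp (Primrec.snd.comp Primrec.fst) (primrec_invRev.comp Primrec.snd))
  · exact (primrecRel_eval_eq.comp (Primrec.list_flatten.comp Primrec.snd)
      (Primrec.snd.comp Primrec.fst)).semiDec

theorem _root_.SemiDec.mem_span {α : Type*} [Primcodable α] {f : α → List (Word n m)}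
    {g : α → Word n m} (hf : Primrec f) (hg : Primrec g) :
    SemiDec fun a => eval (g a) ∈ span (f a) :=
  SemiDec.comp (f := fun a => (f a, g a)) semiDec_mem_span (hf.pair hg)

end FTA

/-! ## Finite covers with labels in the free-abelian part -/

theorem List.lookup_map_of_injective {ι α β : Type*} [BEq α] [LawfulBEq α] {l : List ι}
    {key : ι → α} (hkey : Function.Injective key) (val : ι → β) {x : ι} (hx : x ∈ l) :
    (l.map fun y => (key y, val y)).lookup (key x) = some (val x) := by
  induction l with
  | nil => simp at hx
  | cons y l ih =>
    rw [List.map_cons, List.lookup_cons]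
    by_cases h : key x = key y
    · rw [hkey h]
      simp
    · rw [beq_false_of_ne h]
      rcases List.mem_cons.1 hx with rfl | h'
      · exact absurd rfl h
      · exact ih h'

namespace FTA

open FreeGroup

variable {n m : ℕ}

/-- The table of a finite automaton over the letters `x_i^{±1}` with states in `ℕ`, where every
arc carries a word. -/
abbrev CoverTable (n m : ℕ) : Type := List (((Fin n × Bool) × ℕ) × (ℕ × Word n m))

namespace CoverTable

/-- The end of the arc labelled `a` at the state `k` and the word that it carries. -/
def step (τ : CoverTable n m) (a : Fin n × Bool) (k : ℕ) : ℕ × Word n m :=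
  -- A missing arc is read as an arc to the state `0` with the empty word. The conditions for a
  -- cover test the resulting total function, so any table may be tried.
  (@List.lookup _ _ instBEqOfDecidableEq (a, k) τ).getD (0, [])

/-- Read a word and collect the words that the arcs carry. -/
def run (τ : CoverTable n m) (u : FreeWord n) (s : ℕ × Word n m) : ℕ × Word n m :=
  u.foldl (fun s a => ((τ.step a s.1).1, s.2 ++ (τ.step a s.1).2)) s

/-- The state that is reached by reading `u` from the state `k`. -/
def pos (τ : CoverTable n m) (u : FreeWord n) (k : ℕ) : ℕ := (τ.run u (k, [])).1

/-- The element that is collected when reading `u` from the state `k`. -/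
def lab (τ : CoverTable n m) (u : FreeWord n) (k : ℕ) : FTA n m := eval (τ.run u (k, [])).2

/-- The letters act on the states `k < N` as permutations, and the labels are in the
free-abelian part and compatible with inversion. -/
def IsCover (τ : CoverTable n m) (N : ℕ) : Prop :=
  0 < N ∧ ∀ (a : Fin n × Bool) (k : ℕ), k < N → (τ.step a k).1 < N ∧
    (eval (τ.step a k).2).1 = 1 ∧ (τ.step (letterInv a) (τ.step a k).1).1 = k ∧
    eval ((τ.step a k).2 ++ (τ.step (letterInv a) (τ.step a k).1).2) = 1

variable {τ : CoverTable n m} {N : ℕ}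

theorem run_eq (u : FreeWord n) (k : ℕ) (z : Word n m) :
    τ.run u (k, z) = ((τ.run u (k, [])).1, z ++ (τ.run u (k, [])).2) := by
  induction u generalizing k z with
  | nil => simp [run]
  | cons a u ih =>
    have h : ∀ z, τ.run (a :: u) (k, z) = τ.run u ((τ.step a k).1, z ++ (τ.step a k).2) :=
      fun z => rfl
    rw [h, h, ih, ih _ ([] ++ (τ.step a k).2)]
    simp

@[simp] theorem pos_nil (k : ℕ) : τ.pos [] k = k := rfl

@[simp] theorem lab_nil (k : ℕ) : τ.lab [] k = 1 := eval_nil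

theorem pos_cons (a : Fin n × Bool) (u : FreeWord n) (k : ℕ) :
    τ.pos (a :: u) k = τ.pos u (τ.step a k).1 := by
  have h : τ.run (a :: u) (k, []) = τ.run u ((τ.step a k).1, [] ++ (τ.step a k).2) := rfl
  unfold pos
  rw [h, run_eq]

theorem lab_cons (a : Fin n × Bool) (u : FreeWord n) (k : ℕ) :
    τ.lab (a :: u) k = eval (τ.step a k).2 * τ.lab u (τ.step a k).1 := by
  have h : τ.run (a :: u) (k, []) = τ.run u ((τ.step a k).1, [] ++ (τ.step a k).2) := rfl
  unfold lab
  rw [h, run_eq]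
  simp

theorem pos_append (u v : FreeWord n) (k : ℕ) : τ.pos (u ++ v) k = τ.pos v (τ.pos u k) := by
  induction u generalizing k with
  | nil => simp
  | cons a u ih => rw [List.cons_append, pos_cons, ih, pos_cons]

theorem lab_append (u v : FreeWord n) (k : ℕ) :
    τ.lab (u ++ v) k = τ.lab u k * τ.lab v (τ.pos u k) := by
  induction u generalizing k with
  | nil => simp
  | cons a u ih => rw [List.cons_append, lab_cons, ih, lab_cons, pos_cons, mul_assoc]

/-! ### Invariance and soundness of reading words in a cover -/

namespace IsCover

variable (h : τ.IsCover N)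
include h

theorem pos_lt (u : FreeWord n) {k : ℕ} (hk : k < N) : τ.pos u k < N := by
  induction u generalizing k with
  | nil => exact hk
  | cons a u ih =>
    rw [pos_cons]
    exact ih (h.2 a k hk).1

theorem fst_lab (u : FreeWord n) {k : ℕ} (hk : k < N) : (τ.lab u k).1 = 1 := by
  induction u generalizing k with
  | nil => simp
  | cons a u ih =>
    rw [lab_cons, Prod.fst_mul, ih (h.2 a k hk).1, (h.2 a k hk).2.1, mul_one]

/-- By the conditions on a cover, an arc followed by its inverse returns to the same state with
trivial label. So the reading depends only on the element of the free group. -/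
theorem of_red {u v : FreeWord n} (hr : Red u v) {k : ℕ} (hk : k < N) :
    τ.pos u k = τ.pos v k ∧ τ.lab u k = τ.lab v k := by
  induction hr with
  | refl => exact ⟨rfl, rfl⟩
  | tail _ hs ih =>
    rw [ih.1, ih.2]
    cases hs with
    | @not L₁ L₂ x b =>
      have h1 := h.2 (x, b) _ (h.pos_lt L₁ hk)
      have h2 : letterInv (x, b) = (x, !b) := rfl
      rw [h2, eval_append] at h1
      rw [pos_append, pos_append, lab_append, lab_append, pos_cons, pos_cons, lab_cons, lab_cons,
        h1.2.2.1, ← mul_assoc (eval _), h1.2.2.2, one_mul]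
      exact ⟨rfl, rfl⟩

theorem of_mk_eq {u v : FreeWord n} (huv : FreeGroup.mk u = FreeGroup.mk v) {k : ℕ} (hk : k < N) :
    τ.pos u k = τ.pos v k ∧ τ.lab u k = τ.lab v k := by
  obtain ⟨w, hu, hv⟩ := Red.exact.1 huv
  have h1 := h.of_red hu hk
  have h2 := h.of_red hv hk
  exact ⟨h1.1.trans h2.1.symm, h1.2.trans h2.2.symm⟩

/-- Labels are central, so the conditions on the generators pass to products and inverses. With `M =
⊤` only the states matter, and a word not returning to `0` lies outside the free part. With the
empty word `u` the label is trivial, and `M` contains the intersection with `ℤ ^ m`. -/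
theorem sound {W : List (Word n m)} {M : Subgroup (FTA n m)}
    (hW : ∀ w ∈ W, τ.pos (proj w) 0 = 0 ∧ τ.lab (proj w) 0 * (1, (eval w).2) ∈ M)
    {g : FTA n m} (hg : g ∈ span W) {u : FreeWord n} (hu : FreeGroup.mk u = g.1) :
    τ.pos u 0 = 0 ∧ τ.lab u 0 * (1, g.2) ∈ M := by
  have hcomm : ∀ {u : FreeWord n} (a : FTA n m), a * τ.lab u 0 = τ.lab u 0 * a := by
    intro u a
    have h1 := h.fst_lab u h.1
    ext1
    · rw [Prod.fst_mul, Prod.fst_mul, h1, mul_one, one_mul]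
    · exact mul_comm _ _
  unfold span subgroupOfWords at hg
  induction hg using Subgroup.closure_induction generalizing u with
  | mem x hx =>
    obtain ⟨w, hw, rfl⟩ := hx
    have h1 := h.of_mk_eq (hu.trans (fst_eval w)) h.1
    rw [h1.1, h1.2]
    exact hW w hw
  | one =>
    have h1 := h.of_mk_eq (hu.trans FreeGroup.one_eq_mk) h.1
    rw [h1.1, h1.2]
    simp [Prod.mk_one_one, M.one_mem]
  | mul x y _ _ ihx ihy =>
    obtain ⟨h1, h2⟩ := ihx (FreeGroup.mk_toWord (x := x.1))
    obtain ⟨h3, h4⟩ := ihy (FreeGroup.mk_toWord (x := y.1))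
    have h5 := h.of_mk_eq (v := x.1.toWord ++ y.1.toWord) (by
      rw [hu, FreeGroup.mk_append, FreeGroup.mk_toWord, FreeGroup.mk_toWord, Prod.fst_mul]) h.1
    rw [h5.1, h5.2, pos_append, lab_append, h1, h3]
    refine ⟨rfl, ?_⟩
    convert M.mul_mem h2 h4 using 1
    have h6 : ((1, (x * y).2) : FTA n m) = (1, x.2) * (1, y.2) := by ext1 <;> simp
    rw [h6, mul_assoc, mul_assoc, ← mul_assoc (1, x.2), hcomm]
    simp only [mul_assoc]
  | inv x _ ih =>
    obtain ⟨h1, h2⟩ := ih (FreeGroup.mk_toWord (x := x.1))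
    have h5 := h.of_mk_eq (v := FreeGroup.invRev x.1.toWord) (by
      rw [hu, FreeGroup.mk_invRev, FreeGroup.mk_toWord, Prod.fst_inv]) h.1
    rw [h5.1, h5.2]
    have h6 := h.of_mk_eq (u := x.1.toWord ++ FreeGroup.invRev x.1.toWord) (v := []) (by
      rw [FreeGroup.mk_append, FreeGroup.mk_invRev, mul_inv_cancel, FreeGroup.one_eq_mk]) h.1
    rw [pos_append, lab_append, h1, pos_nil, lab_nil] at h6
    refine ⟨h6.1, ?_⟩
    convert M.inv_mem h2 using 1
    rw [← hcomm, eq_inv_of_mul_eq_one_right h6.2, mul_inv_rev]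
    have h7 : ((1, x⁻¹.2) : FTA n m) = (1, x.2)⁻¹ := by ext1 <;> simp
    rw [h7]

end IsCover

/-- A finite permutation representation of the free group with labels in the free-abelian part
as a table. -/
theorem exists_isCover {V : Type*} [Finite V] (b : V) (σ : Fin n → Equiv.Perm V)
    (ζ : Fin n → V → Multiplicative (Fin m → ℤ)) :
    ∃ (τ : CoverTable n m) (N : ℕ) (ι : V → ℕ), Function.Injective ι ∧ ι b = 0 ∧ (∀ p, ι p < N) ∧ τ.IsCover N ∧
      ∀ i p, (τ.step (i, true) (ι p)).1 = ι (σ i p) ∧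
        eval (τ.step (i, true) (ι p)).2 = (1, ζ i p) ∧
        (τ.step (i, false) (ι (σ i p))).1 = ι p ∧
        eval (τ.step (i, false) (ι (σ i p))).2 = (1, (ζ i p)⁻¹) := by
  classical
  obtain ⟨N, ⟨e₀⟩⟩ := Finite.exists_equiv_fin V
  have hN : 0 < N := (e₀ b).pos
  -- The swap gives the basepoint the number `0`.
  let e : V ≃ Fin N := e₀.trans (Equiv.swap (e₀ b) ⟨0, hN⟩)
  have heb : e b = ⟨0, hN⟩ := by simp [e]
  choose wd hwd using eval_surjective (n := n) (m := m)
  let F : Fin n × Bool → V → V × FTA n m := fun a p =>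
    if a.2 then (σ a.1 p, (1, ζ a.1 p)) else ((σ a.1).symm p, (1, (ζ a.1 ((σ a.1).symm p))⁻¹))
  have : Fintype V := Fintype.ofFinite V
  let τ : CoverTable n m := (Finset.univ : Finset ((Fin n × Bool) × V)).toList.map fun x =>
    ((x.1, (e x.2 : ℕ)), ((e (F x.1 x.2).1 : ℕ), wd (F x.1 x.2).2))
  have hτ : ∀ a p, τ.step a (e p) = ((e (F a p).1 : ℕ), wd (F a p).2) := by
    intro a p
    have hinj : Function.Injective fun x : (Fin n × Bool) × V => (x.1, (e x.2 : ℕ)) := by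
      rintro ⟨a, p⟩ ⟨a', p'⟩ hx
      rw [Prod.mk.injEq] at hx
      exact Prod.ext hx.1 (e.injective (Fin.ext hx.2))
    have := @List.lookup_map_of_injective _ _ _ instBEqOfDecidableEq _ Finset.univ.toList _ hinj
      (fun x => ((e (F x.1 x.2).1 : ℕ), wd (F x.1 x.2).2)) (a, p) (by simp)
    exact congrArg (fun o => o.getD (0, [])) this
  refine ⟨τ, N, fun p => e p, fun p q h => e.injective (Fin.ext h), by simp [heb], fun p => (e p).2, ⟨hN, ?_⟩, ?_⟩
  · intro a k hk
    obtain ⟨p, hp⟩ := e.surjective ⟨k, hk⟩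
    have hp' : k = e p := by rw [hp]
    subst hp'
    rw [hτ, hτ, eval_append, hwd, hwd]
    obtain ⟨i, b⟩ := a
    cases b <;> simp [F, letterInv]
  · intro i p
    rw [hτ, hτ, hwd, hwd]
    simp [F]

/-- **Marshall Hall's theorem** with labels. -/
theorem exists_complete (W : List (Word n m)) (u : FreeWord n) :
    ∃ (τ : CoverTable n m) (N : ℕ), τ.IsCover N ∧
      (∀ w ∈ W, τ.pos (proj w) 0 = 0 ∧ τ.lab (proj w) 0 * (1, (eval w).2) ∈ span W) ∧
      (τ.pos u 0 = 0 → FreeGroup.mk u ∈ freePart (span W)) := by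
  classical
  set H := span W
  set K := freePart H with hK
  -- The radius covers the walks of all generators and of the test word `u`.
  let l := u.length + (W.map List.length).sum
  have hproj : ∀ w ∈ W, (proj w).length ≤ l := by
    intro w hw
    have h1 : (proj w).length ≤ w.length := List.length_filterMap_le _ _
    have h2 : w.length ≤ (W.map List.length).sum :=
      List.le_sum_of_mem (List.mem_map_of_mem hw)
    omega
  let Γ := schreierBall K l
  have hΓ : Γ.Finite := finite_schreierBall l
  let t : Finset (RightCosets K) := hΓ.toFinset
  have ht : ∀ q, q ∈ t ↔ q ∈ Γ := fun q => hΓ.mem_toFinset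
  have hbase : rightCoset K 1 ∈ t := (ht _).2 ⟨[], by simp, by rw [FreeGroup.one_eq_mk]⟩
  -- The basepoint is represented by `1`, so that no correction appears at the ends of closed walks.
  have hrep : ∀ q : RightCosets K, ∃ c, rightCoset K c = q ∧ (q = rightCoset K 1 → c = 1) := by
    intro q
    by_cases hq : q = rightCoset K 1
    · exact ⟨1, hq.symm, fun _ => rfl⟩
    · obtain ⟨c, hc⟩ := exists_rightCoset q
      exact ⟨c, hc.symm, fun h => absurd h hq⟩
  choose rep hrep hrep1 using hrep
  -- Multiplication by a free generator is a partial injection of the finite ball, and so extends to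
  -- a permutation of it.
  have hσ : ∀ i : Fin n, ∃ g : t ≃ t, ∀ p : t,
      rightCoset K (rep p * FreeGroup.of i) ∈ t →
        (g p : RightCosets K) = rightCoset K (rep p * FreeGroup.of i) := by
    intro i
    have := Set.MapsTo.exists_equiv_extend_of_card_eq (α := t) (t := t) (by simp)
      (s := {p | rightCoset K (rep p * FreeGroup.of i) ∈ t})
      (f := fun p => rightCoset K (rep p * FreeGroup.of i)) (fun p hp => hp) (by
        intro p _ q _ hpq
        have := rightCoset_mul hpq (FreeGroup.of i)⁻¹
        rw [mul_inv_cancel_right, mul_inv_cancel_right, hrep, hrep] at this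
        exact Subtype.ext this)
    exact this
  choose σ hσ using hσ
  -- On genuine arcs of the Schreier automaton, the Schreier element is lifted to `H`, and the label
  -- is the inverse of its central part. Arcs added by the completion may carry any label.
  have hζ : ∀ (i : Fin n) (p : t), ∃ z : Multiplicative (Fin m → ℤ),
      rightCoset K (rep p * FreeGroup.of i) ∈ t →
        ((rep p * FreeGroup.of i * (rep (σ i p))⁻¹, z⁻¹) : FTA n m) ∈ H := by
    intro i p
    by_cases hp : rightCoset K (rep p * FreeGroup.of i) ∈ t
    · have h1 := hσ i p hp
      rw [← hrep (σ i p : RightCosets K), eq_comm, rightCoset_eq_rightCoset] at h1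
      obtain ⟨s, hs⟩ := mem_freePart.1 h1
      exact ⟨s⁻¹, fun _ => by rwa [inv_inv]⟩
    · exact ⟨1, fun h => absurd h hp⟩
  choose ζ hζ using hζ
  obtain ⟨τ, N, ι, hι, hι0, hιN, hcov, hstep⟩ := exists_isCover (⟨_, hbase⟩ : t) σ ζ
  -- Invariant for walks inside the ball: the cover follows the true cosets, and modulo `H` the
  -- element read equals the representative of the end times the collected label.
  have hrun : ∀ (w : FreeWord n) (p : t), StaysIn Γ (rep p) w →
      ∃ q : t, rightCoset K (rep p * FreeGroup.mk w) = q ∧ τ.pos w (ι p) = ι q ∧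
        ((rep p * FreeGroup.mk w, 1) : FTA n m) * ((rep q, 1) * τ.lab w (ι p))⁻¹ ∈ H := by
    intro w
    induction w with
    | nil =>
      intro p _
      refine ⟨p, ?_, rfl, ?_⟩
      · rw [← FreeGroup.one_eq_mk, mul_one, hrep]
      · rw [← FreeGroup.one_eq_mk, mul_one, lab_nil, mul_one, mul_inv_cancel]
        exact H.one_mem
    | cons a w ih =>
      intro p hp
      have h1 : rightCoset K (rep p * FreeGroup.mk [a]) ∈ t := (ht _).2 (hp [a] w rfl)
      have hlet : ∃ q : t, rightCoset K (rep p * FreeGroup.mk [a]) = q ∧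
          (τ.step a (ι p)).1 = ι q ∧
          ((rep p * FreeGroup.mk [a], 1) : FTA n m) *
            ((rep q, 1) * eval (τ.step a (ι p)).2)⁻¹ ∈ H := by
        obtain ⟨i, _ | _⟩ := a
        -- An arc labelled by an inverse generator is a genuine positive arc traversed backwards.
        · have h2 : rightCoset K (rep (rightCoset K (rep p * FreeGroup.mk [(i, false)])) *
              FreeGroup.of i) = p := by
            have := rightCoset_mul (hrep (rightCoset K (rep p * FreeGroup.mk [(i, false)])))
              (FreeGroup.of i)
            rw [this, mul_assoc]
            have h3 : FreeGroup.mk [(i, false)] * FreeGroup.of i = 1 := by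
              have h8 : FreeGroup.mk [(i, false)] = (FreeGroup.of i)⁻¹ := by
                rw [FreeGroup.of, FreeGroup.inv_mk]
                rfl
              rw [h8, inv_mul_cancel]
            rw [h3, mul_one, hrep]
          have h3 : rightCoset K (rep (rightCoset K (rep p * FreeGroup.mk [(i, false)])) *
              FreeGroup.of i) ∈ t := by
            rw [h2]
            exact p.2
          have h4 := hσ i ⟨_, h1⟩ h3
          have h5 := hζ i ⟨_, h1⟩ h3
          have h6 : σ i ⟨_, h1⟩ = p := Subtype.ext (h4.trans h2)
          have h7 := hstep i ⟨_, h1⟩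
          rw [h6] at h7 h5
          refine ⟨⟨_, h1⟩, rfl, h7.2.2.1, ?_⟩
          rw [h7.2.2.2]
          convert H.inv_mem h5 using 1
          ext1
          · have h8 : FreeGroup.mk [(i, false)] = (FreeGroup.of i)⁻¹ := by
              rw [FreeGroup.of, FreeGroup.inv_mk]
              rfl
            simp [h8, mul_assoc]
          · simp
        · have h4 := hσ i p h1
          have h5 := hζ i p h1
          have h7 := hstep i p
          refine ⟨σ i p, h4.symm, h7.1, ?_⟩
          rw [h7.2.1]
          convert h5 using 1
          ext1
          · simp [FreeGroup.of]
          · simp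
      obtain ⟨q, hq, hq1, hq2⟩ := hlet
      have h2 : rightCoset K (rep p * FreeGroup.mk [a]) = rightCoset K (rep q) := by
        rw [hq, hrep]
      have h3 : StaysIn Γ (rep q) w := StaysIn.congr_left h2 (StaysIn.right (w := [a]) hp)
      obtain ⟨r, hr, hr1, hr2⟩ := ih q h3
      refine ⟨r, ?_, ?_, ?_⟩
      · rw [← hr, FreeGroup.mk_cons, ← mul_assoc]
        exact rightCoset_mul h2 _
      · rw [pos_cons, hq1, hr1]
      · rw [lab_cons, hq1, FreeGroup.mk_cons]
        convert H.mul_mem hq2 hr2 using 1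
        have h4 : (eval (τ.step a (ι p)).2).1 = 1 := (hcov.2 a _ (hιN p)).2.1
        have h5 : (τ.lab w (ι q)).1 = 1 := hcov.fst_lab w (hιN q)
        ext1
        · simp [h4, h5, mul_assoc, -FreeGroup.mul_mk]
        · simp [mul_comm]
  have hrun1 : ∀ w : FreeWord n, w.length ≤ l →
      ∃ q : t, rightCoset K (FreeGroup.mk w) = q ∧ τ.pos w 0 = ι q ∧
        ((FreeGroup.mk w, 1) : FTA n m) * ((rep q, 1) * τ.lab w 0)⁻¹ ∈ H := by
    intro w hw
    have := hrun w ⟨_, hbase⟩ (by rw [hrep1 _ rfl]; exact staysIn_schreierBall hw)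
    rwa [hι0, hrep1 _ rfl, one_mul] at this
  refine ⟨τ, N, hcov, fun w hw => ?_, fun hu => ?_⟩
  · obtain ⟨q, hq, hq1, hq2⟩ := hrun1 _ (hproj w hw)
    have h1 : rightCoset K (FreeGroup.mk (proj w)) = rightCoset K 1 := by
      rw [rightCoset_eq_rightCoset, inv_one, mul_one, ← fst_eval]
      exact fst_mem_freePart (eval_mem_span hw)
    have h2 : q = ⟨_, hbase⟩ := Subtype.ext (hq.symm.trans h1)
    subst h2
    rw [hι0] at hq1
    refine ⟨hq1, ?_⟩
    rw [hrep1 _ rfl, Prod.mk_one_one, one_mul] at hq2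
    have h3 := H.mul_mem (H.inv_mem hq2) (eval_mem_span hw)
    rw [mul_inv_rev, inv_inv, mul_assoc] at h3
    convert h3 using 2
    ext1
    · simp [fst_eval, -FreeGroup.mul_mk, -FreeGroup.inv_mk]
    · simp
  · obtain ⟨q, hq, hq1, hq2⟩ := hrun1 u (by simp [l])
    have h1 : q = ⟨_, hbase⟩ := hι (by rw [← hq1, hu, hι0])
    rw [h1, rightCoset_eq_rightCoset, inv_one, mul_one] at hq
    exact hq

end CoverTable

end FTA

/-! ## Certificates for non-membership and for Smith normal forms -/

theorem Primrec.finArrow_app {α σ : Type*} [Primcodable α] [Primcodable σ] {k : ℕ}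
    {f : α → Fin k → σ} (hf : Primrec f) (i : Fin k) : Primrec fun a => f a i :=
  Primrec.fin_app.comp hf (Primrec.const i)

namespace FTA

open FreeGroup

variable {n m : ℕ}

/-! ### Checking covers effectively -/

namespace CoverTable

theorem primrec_step : Primrec fun x : CoverTable n m × ((Fin n × Bool) × ℕ) =>
    x.1.step x.2.1 x.2.2 := by
  refine (Primrec.option_getD.comp (Primrec.listLookup.comp Primrec.snd Primrec.fst)
    (Primrec.const (0, []))).of_eq fun x => ?_
  rfl

theorem primrec_run : Primrec fun x : CoverTable n m × FreeWord n => x.1.run x.2 (0, []) := by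
  have hs : Primrec fun x : (CoverTable n m × FreeWord n) × ((ℕ × Word n m) × (Fin n × Bool)) =>
      x.1.1.step x.2.2 x.2.1.1 :=
    primrec_step.comp ((Primrec.fst.comp Primrec.fst).pair ((Primrec.snd.comp Primrec.snd).pair
      (Primrec.fst.comp (Primrec.fst.comp Primrec.snd))))
  refine Primrec.list_foldl Primrec.snd (Primrec.const _) (h := fun (x : CoverTable n m × FreeWord n)
    (y : (ℕ × Word n m) × (Fin n × Bool)) =>
    ((x.1.step y.2 y.1.1).1, y.1.2 ++ (x.1.step y.2 y.1.1).2)) ?_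
  exact (Primrec.fst.comp hs).pair (Primrec.list_append.comp
    (Primrec.snd.comp (Primrec.fst.comp Primrec.snd)) (Primrec.snd.comp hs))

theorem semiDec_isCover : SemiDec fun x : CoverTable n m × ℕ => x.1.IsCover x.2 := by
  refine SemiDec.and (PrimrecPred.semiDec (Primrec.nat_lt.comp (Primrec.const 0) Primrec.snd)) ?_
  refine (SemiDec.ball (r := fun (x : CoverTable n m × ℕ) (a : Fin n × Bool) =>
    ∀ k < x.2, (x.1.step a k).1 < x.2 ∧
    (eval (x.1.step a k).2).1 = 1 ∧ (x.1.step (letterInv a) (x.1.step a k).1).1 = k ∧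
    eval ((x.1.step a k).2 ++ (x.1.step (letterInv a) (x.1.step a k).1).2) = 1)
    (Primrec.const (Finset.univ : Finset (Fin n × Bool)).toList) ?_).of_eq fun x => by simp
  refine SemiDec.ball_lt (Primrec.snd.comp Primrec.fst) ?_
  have h1 : Primrec fun x : ((CoverTable n m × ℕ) × (Fin n × Bool)) × ℕ =>
      x.1.1.1.step x.1.2 x.2 :=
    primrec_step.comp ((Primrec.fst.comp (Primrec.fst.comp Primrec.fst)).pair
      ((Primrec.snd.comp Primrec.fst).pair Primrec.snd))
  have h2 : Primrec fun x : ((CoverTable n m × ℕ) × (Fin n × Bool)) × ℕ =>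
      x.1.1.1.step (letterInv x.1.2) (x.1.1.1.step x.1.2 x.2).1 :=
    primrec_step.comp ((Primrec.fst.comp (Primrec.fst.comp Primrec.fst)).pair
      (((Primrec.dom_finite letterInv).comp (Primrec.snd.comp Primrec.fst)).pair
        (Primrec.fst.comp h1)))
  refine PrimrecPred.semiDec ?_
  refine (Primrec.nat_lt.comp (Primrec.fst.comp h1)
    (Primrec.snd.comp (Primrec.fst.comp Primrec.fst))).and ?_
  refine (primrecPred_fst_eval_eq_one.comp (Primrec.snd.comp h1)).and ?_
  refine (Primrec.eq.comp (Primrec.fst.comp h2) Primrec.snd).and ?_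
  exact primrecPred_eval_eq_one.comp
    (Primrec.list_append.comp (Primrec.snd.comp h1) (Primrec.snd.comp h2))

end CoverTable

/-- The certificate is a finite cover in which all generators are closed at the state `0` and the
given word is not. -/
theorem semiDec_not_mem_freePart :
    SemiDec fun x : List (Word n m) × FreeWord n => FreeGroup.mk x.2 ∉ freePart (span x.1) := by
  refine SemiDec.of_eq (p := fun x : List (Word n m) × FreeWord n =>
    ∃ y : CoverTable n m × ℕ, (y.1.IsCover y.2 ∧ (∀ w ∈ x.1, (y.1.run (proj w) (0, [])).1 = 0)) ∧
      (y.1.run x.2 (0, [])).1 ≠ 0) ?_ fun x => ?_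
  · refine SemiDec.ex (((CoverTable.semiDec_isCover.comp Primrec.snd).and ?_).and ?_)
    · refine SemiDec.ball (Primrec.fst.comp Primrec.fst) (PrimrecPred.semiDec ?_)
      exact Primrec.eq.comp (Primrec.fst.comp (CoverTable.primrec_run.comp
        ((Primrec.fst.comp (Primrec.snd.comp Primrec.fst)).pair (primrec_proj.comp Primrec.snd))))
        (Primrec.const 0)
    · refine PrimrecPred.semiDec (PrimrecPred.not ?_)
      exact Primrec.eq.comp (Primrec.fst.comp (CoverTable.primrec_run.comp
        ((Primrec.fst.comp Primrec.snd).pair (Primrec.snd.comp Primrec.fst))))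
        (Primrec.const 0)
  · constructor
    · rintro ⟨⟨τ, N⟩, ⟨hτ, hW⟩, hu⟩ hm
      obtain ⟨s, hs⟩ := mem_freePart.1 hm
      exact hu (hτ.sound (M := ⊤) (fun w hw => ⟨hW w hw, trivial⟩) hs rfl).1
    · intro hu
      obtain ⟨τ, N, hτ, hW, h⟩ := CoverTable.exists_complete x.1 x.2
      exact ⟨(τ, N), ⟨hτ, fun w hw => (hW w hw).1⟩, fun h0 => hu (h h0)⟩

theorem _root_.SemiDec.not_mem_freePart {α : Type*} [Primcodable α] {f : α → List (Word n m)}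
    {g : α → FreeWord n} (hf : Primrec f) (hg : Primrec g) :
    SemiDec fun a => FreeGroup.mk (g a) ∉ freePart (span (f a)) :=
  SemiDec.comp (f := fun a => (f a, g a)) semiDec_not_mem_freePart (hf.pair hg)

/-- The part of a word in the letters `t_j^{±1}`. -/
def basePart (w : Word n m) : Word n m := w.filter fun a => a.1.isRight

theorem primrec_basePart : Primrec (basePart : Word n m → Word n m) :=
  (Primrec.listFilter (p := fun a : Letter n m => a.1.isRight = true)
    (Primrec.primrecPred (Primrec.dom_finite _))).of_eq fun w => by simp [basePart]

theorem eval_basePart (w : Word n m) : eval (basePart w) = (1, (eval w).2) := by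
  induction w with
  | nil => rw [basePart, List.filter_nil, eval_nil]; rfl
  | cons a w ih =>
    rw [eval_cons a w]
    obtain ⟨i | j, b⟩ := a
    · have : basePart ((Sum.inl i, b) :: w) = basePart w := rfl
      rw [this, ih, eval_inl]
      simp
    · have : basePart ((Sum.inr j, b) :: w) = (Sum.inr j, b) :: basePart w := rfl
      rw [this, eval_cons, ih, eval_inr]
      simp

/-- A table `S` of words `q_i` in the free-abelian part and natural numbers `d_i` certifies a
diagonal form of `H ∩ ℤ ^ m`, where `H` is generated by `W`. -/
def IsDiagonalCert (W : List (Word n m)) (S : Fin m → Word n m × ℕ) : Prop :=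
  (∀ i, (eval (S i).1).1 = 1) ∧
  (∀ j : Fin m, eval ([(Sum.inr j, true)] : Word n m) ∈ span (List.ofFn fun i => (S i).1)) ∧
  (∀ i, eval (List.replicate (S i).2 (S i).1).flatten ∈ span W) ∧
  ∃ y : CoverTable n m × ℕ, y.1.IsCover y.2 ∧ ∀ w ∈ W, (y.1.run (proj w) (0, [])).1 = 0 ∧
    eval ((y.1.run (proj w) (0, [])).2 ++ basePart w) ∈
      span (List.ofFn fun i => (List.replicate (S i).2 (S i).1).flatten)

theorem semiDec_isDiagonalCert :
    SemiDec fun x : List (Word n m) × (Fin m → Word n m × ℕ) => IsDiagonalCert x.1 x.2 := by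
  have hS : ∀ i : Fin m, Primrec fun x : List (Word n m) × (Fin m → Word n m × ℕ) => x.2 i :=
    fun i => Primrec.finArrow_app Primrec.snd i
  have hp : ∀ i : Fin m, Primrec fun x : List (Word n m) × (Fin m → Word n m × ℕ) =>
      (List.replicate (x.2 i).2 (x.2 i).1).flatten := fun i =>
    primrec_flatten_replicate.comp (Primrec.snd.comp (hS i)) (Primrec.fst.comp (hS i))
  refine SemiDec.and (SemiDec.all_fin fun i => ?_) (SemiDec.and (SemiDec.all_fin fun j => ?_)
    (SemiDec.and (SemiDec.all_fin fun i => ?_) (SemiDec.ex (SemiDec.and ?_ (SemiDec.ball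
      (Primrec.fst.comp Primrec.fst) (SemiDec.and ?_ ?_))))))
  · exact (primrecPred_fst_eval_eq_one.comp (Primrec.fst.comp (hS i))).semiDec
  · exact SemiDec.mem_span (Primrec.list_ofFn fun i => Primrec.fst.comp (hS i)) (Primrec.const _)
  · exact SemiDec.mem_span Primrec.fst (hp i)
  · exact CoverTable.semiDec_isCover.comp Primrec.snd
  · exact (Primrec.eq.comp (Primrec.fst.comp (CoverTable.primrec_run.comp
        ((Primrec.fst.comp (Primrec.snd.comp Primrec.fst)).pair (primrec_proj.comp Primrec.snd))))
        (Primrec.const 0)).semiDec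
  · exact SemiDec.mem_span (Primrec.list_ofFn fun i =>
      (hp i).comp (Primrec.fst.comp Primrec.fst)) (Primrec.list_append.comp (Primrec.snd.comp
        (CoverTable.primrec_run.comp ((Primrec.fst.comp (Primrec.snd.comp Primrec.fst)).pair
          (primrec_proj.comp Primrec.snd)))) (primrec_basePart.comp Primrec.snd))

theorem _root_.SemiDec.isDiagonalCert {α : Type*} [Primcodable α] {f : α → List (Word n m)}
    {g : α → Fin m → Word n m × ℕ} (hf : Primrec f) (hg : Primrec g) :
    SemiDec fun a => IsDiagonalCert (f a) (g a) :=
  SemiDec.comp (f := fun a => (f a, g a)) semiDec_isDiagonalCert (hf.pair hg)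

theorem eq_inr {g : FTA n m} (hg : g.1 = 1) : g = (1, Multiplicative.ofAdd g.2.toAdd) :=
  Prod.ext hg rfl

theorem mem_baseSubmodule_of_fst {H : Subgroup (FTA n m)} {g : FTA n m} (hg : g.1 = 1) :
    g ∈ H ↔ g.2.toAdd ∈ baseSubmodule H := by
  rw [mem_baseSubmodule, mem_baseSubgroup, ← eq_inr hg]

/-- The `m` vectors generate `ℤ ^ m`, hence form a basis. The multiples by `d_i` lie in the
submodule by the third clause, and the cover shows that nothing else does. -/
theorem IsDiagonalCert.exists_basis {W : List (Word n m)} {S : Fin m → Word n m × ℕ}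
    (h : IsDiagonalCert W S) : ∃ b : Module.Basis (Fin m) ℤ (Fin m → ℤ),
      (∀ i, eval (S i).1 = (1, Multiplicative.ofAdd (b i))) ∧
        IsDiagonal (baseSubmodule (span W)) b fun i => (S i).2 := by
  obtain ⟨h1, h2, h3, ⟨τ, N⟩, hτ, h4⟩ := h
  let q : Fin m → Fin m → ℤ := fun i => (eval (S i).1).2.toAdd
  have hq : ∀ i, eval (S i).1 = (1, Multiplicative.ofAdd (q i)) := fun i => eq_inr (h1 i)
  have hspan : ⊤ ≤ Submodule.span ℤ (Set.range q) := by
    rw [← (Pi.basisFun ℤ (Fin m)).span_eq, Submodule.span_le]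
    rintro _ ⟨j, rfl⟩
    have key : ∀ g ∈ span (List.ofFn fun i => (S i).1),
        g.2.toAdd ∈ Submodule.span ℤ (Set.range q) := by
      intro g hg
      unfold span subgroupOfWords at hg
      induction hg using Subgroup.closure_induction with
      | mem x hx =>
        obtain ⟨w, hw, rfl⟩ := hx
        obtain ⟨i, rfl⟩ := (List.mem_ofFn' _ _).1 hw
        exact Submodule.subset_span ⟨i, rfl⟩
      | one => exact Submodule.zero_mem _
      | mul x y _ _ hx hy => exact Submodule.add_mem _ hx hy
      | inv x _ hx => exact Submodule.neg_mem _ hx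
    have := key _ (h2 j)
    rw [eval_inr] at this
    simpa using this
  let b := basisOfTopLeSpanOfCardEqFinrank q hspan (by simp)
  have hb : ∀ i, b i = q i := fun i => by simp [b]
  refine ⟨b, fun i => by rw [hb, hq], fun y => ?_⟩
  constructor
  · intro hy
    -- Reading the empty word collects nothing, so the element itself lies in the subgroup generated
    -- by the powers `q_i ^ d_i`.
    have h5 := (hτ.sound (u := []) (M := span (List.ofFn fun i =>
      (List.replicate (S i).2 (S i).1).flatten)) (fun w hw => ⟨(h4 w hw).1, by
        have := (h4 w hw).2
        rwa [eval_append, eval_basePart] at this⟩) (mem_baseSubgroup.1 (mem_baseSubmodule.1 hy))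
        FreeGroup.one_eq_mk.symm).2
    rw [CoverTable.lab_nil, one_mul] at h5
    have key : ∀ g ∈ span (List.ofFn fun i => (List.replicate (S i).2 (S i).1).flatten),
        ∀ i, ((S i).2 : ℤ) ∣ b.repr g.2.toAdd i := by
      intro g hg i
      unfold span subgroupOfWords at hg
      induction hg using Subgroup.closure_induction with
      | mem x hx =>
        obtain ⟨w, hw, rfl⟩ := hx
        obtain ⟨k, rfl⟩ := (List.mem_ofFn' _ _).1 hw
        have h6 : (eval (List.replicate (S k).2 (S k).1).flatten).2.toAdd = (S k).2 • b k := by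
          rw [eval_flatten_replicate, hb]
          rfl
        change ((S i).2 : ℤ) ∣ b.repr (eval (List.replicate (S k).2 (S k).1).flatten).2.toAdd i
        rw [h6, map_nsmul, Module.Basis.repr_self, Finsupp.smul_apply]
        by_cases hik : k = i
        · subst hik
          simp
        · simp [hik]
      | one => simp
      | mul x y _ _ hx hy =>
        rw [Prod.snd_mul, toAdd_mul, map_add, Finsupp.add_apply]
        exact dvd_add hx hy
      | inv x _ hx =>
        rw [Prod.snd_inv, toAdd_inv, map_neg, Finsupp.neg_apply]
        exact (dvd_neg).2 hx
    exact key _ h5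
  · intro hy
    rw [← b.sum_repr y]
    refine Submodule.sum_mem _ fun i _ => ?_
    obtain ⟨c, hc⟩ := hy i
    rw [hc, mul_comm, mul_smul]
    refine Submodule.smul_mem _ _ ?_
    have h6 := h3 i
    rw [mem_baseSubmodule_of_fst (by rw [eval_flatten_replicate, Prod.pow_fst, h1, one_pow]),
      eval_flatten_replicate] at h6
    rw [hb, natCast_zsmul]
    exact h6

/-- A chain basis supplies the table and Marshall Hall's cover the upper bound: its labels correct
the generators to elements of the intersection with `ℤ ^ m`. -/
theorem exists_isDiagonalCert (W : List (Word n m)) :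
    ∃ S : Fin m → Word n m × ℕ, IsDiagonalCert W S ∧ ∀ i j, i ≤ j → (S i).2 ∣ (S j).2 := by
  obtain ⟨b, d, hd, hb⟩ := exists_isDiagonal_chain (baseSubmodule (span W))
  choose wd hwd using eval_surjective (n := n) (m := m)
  let S : Fin m → Word n m × ℕ := fun i => (wd (1, Multiplicative.ofAdd (b i)), d i)
  have hS : ∀ i, eval (S i).1 = (1, Multiplicative.ofAdd (b i)) := fun i => hwd _
  have hmem : ∀ (V : List (Word n m)) (c : Fin m → ℕ) (y : Fin m → ℤ),
      (∀ i, (1, Multiplicative.ofAdd ((c i : ℤ) • b i)) ∈ span V) →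
      (∀ i, (c i : ℤ) ∣ b.repr y i) → ((1, Multiplicative.ofAdd y) : FTA n m) ∈ span V := by
    intro V c y hV hy
    change y ∈ baseSubmodule (span V)
    rw [← b.sum_repr y]
    refine Submodule.sum_mem _ fun i _ => ?_
    obtain ⟨e, he⟩ := hy i
    rw [he, mul_comm, mul_smul]
    exact Submodule.smul_mem _ _ (hV i)
  refine ⟨S, ⟨fun i => by rw [hS], fun j => ?_, fun i => ?_, ?_⟩, hd⟩
  · rw [eval_inr]
    refine hmem _ (fun _ => 1) _ (fun i => ?_) (fun i => by simp)
    have := eval_mem_span (W := List.ofFn fun i => (S i).1) (w := (S i).1)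
      ((List.mem_ofFn' _ _).2 ⟨i, rfl⟩)
    rw [hS] at this
    simpa using this
  · rw [eval_flatten_replicate, hS]
    have : (d i : ℤ) • b i ∈ baseSubmodule (span W) := hb.smul_basis_mem_iff.2 dvd_rfl
    rw [mem_baseSubmodule, mem_baseSubgroup] at this
    convert this using 1
    ext1
    · simp
    · simp [S, ← ofAdd_nsmul]
  · obtain ⟨τ, N, hτ, hW, -⟩ := CoverTable.exists_complete W []
    refine ⟨(τ, N), hτ, fun w hw => ⟨(hW w hw).1, ?_⟩⟩
    have h1 := (hW w hw).2
    have h2 : (τ.lab (proj w) 0 * (1, (eval w).2)).1 = 1 := by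
      rw [Prod.fst_mul, hτ.fst_lab _ hτ.1, one_mul]
    rw [eval_append, eval_basePart]
    change τ.lab (proj w) 0 * (1, (eval w).2) ∈ _
    rw [mem_baseSubmodule_of_fst h2, hb] at h1
    rw [eq_inr h2]
    refine hmem _ d _ (fun i => ?_) h1
    have := eval_mem_span (W := List.ofFn fun i => (List.replicate (S i).2 (S i).1).flatten)
      (w := (List.replicate (S i).2 (S i).1).flatten) ((List.mem_ofFn' _ _).2 ⟨i, rfl⟩)
    rw [eval_flatten_replicate, hS] at this
    convert this using 1
    ext1
    · simp
    · simp [S, ← ofAdd_nsmul]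

/-- The product of the powers `q_i ^ (a_i - b_i)`. -/
def combination (S : Fin m → Word n m × ℕ) (e : Fin m → ℕ × ℕ) : Word n m :=
  (List.ofFn fun i => (List.replicate (e i).1 (S i).1).flatten ++
    FreeGroup.invRev (List.replicate (e i).2 (S i).1).flatten).flatten

theorem primrec_combination {α : Type*} [Primcodable α] {S : α → Fin m → Word n m × ℕ}
    {e : α → Fin m → ℕ × ℕ} (hS : Primrec S) (he : Primrec e) :
    Primrec fun a => combination (S a) (e a) := by
  refine Primrec.list_flatten.comp (Primrec.list_ofFn fun i => ?_)
  have h1 := Primrec.fst.comp (Primrec.finArrow_app hS i)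
  have h2 := Primrec.finArrow_app he i
  exact Primrec.list_append.comp (primrec_flatten_replicate.comp (Primrec.fst.comp h2) h1)
    (primrec_invRev.comp (primrec_flatten_replicate.comp (Primrec.snd.comp h2) h1))

theorem eval_combination {S : Fin m → Word n m × ℕ} {q : Fin m → Fin m → ℤ}
    (hS : ∀ i, eval (S i).1 = (1, Multiplicative.ofAdd (q i))) (e : Fin m → ℕ × ℕ) :
    eval (combination S e) =
      (1, Multiplicative.ofAdd (∑ i, (((e i).1 : ℤ) - (e i).2) • q i)) := by
  have key : ∀ {k : ℕ} (w : Fin k → Word n m) (y : Fin k → Fin m → ℤ),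
      (∀ i, eval (w i) = (1, Multiplicative.ofAdd (y i))) →
      eval (List.ofFn w).flatten = (1, Multiplicative.ofAdd (∑ i, y i)) := by
    intro k
    induction k with
    | zero => intro w y _; simp; rfl
    | succ k ih =>
      intro w y h
      rw [List.ofFn_succ, List.flatten_cons, eval_append, h, ih _ _ fun i => h i.succ,
        Fin.sum_univ_succ, ofAdd_add]
      simp
  refine key _ _ fun i => ?_
  rw [eval_append, eval_invRev, eval_flatten_replicate, eval_flatten_replicate, hS]
  ext1
  · simp
  · simp [← ofAdd_nsmul, ← ofAdd_neg, ← ofAdd_add, sub_eq_add_neg, add_mul]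

theorem exists_combination {S : Fin m → Word n m × ℕ} {b : Module.Basis (Fin m) ℤ (Fin m → ℤ)}
    (hS : ∀ i, eval (S i).1 = (1, Multiplicative.ofAdd (b i))) {g : FTA n m} (hg : g.1 = 1) :
    ∃ e, eval (combination S e) = g := by
  refine ⟨fun i => ((b.repr g.2.toAdd i).toNat, (-b.repr g.2.toAdd i).toNat), ?_⟩
  rw [eval_combination hS]
  have : ∀ i, (((b.repr g.2.toAdd i).toNat : ℤ) - ((-b.repr g.2.toAdd i).toNat : ℤ)) =
      b.repr g.2.toAdd i := fun i => Int.toNat_sub_toNat_neg _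
  simp only [this, b.sum_repr]
  exact (eq_inr hg).symm

/-- For central elements a certified diagonal basis decides membership. The general case is reduced
to it by multiplying into `H` with a central element, unless the free part is already outside the
projection. -/
theorem semiDec_not_mem_span :
    SemiDec fun x : List (Word n m) × Word n m => eval x.2 ∉ span x.1 := by
  have hbase : SemiDec fun x : List (Word n m) × Word n m =>
      (eval x.2).1 = 1 ∧ eval x.2 ∉ span x.1 := by
    -- Coordinates are differences of natural numbers, tested by congruence modulo `d_i`. Remainders
    -- modulo `0` are the numbers themselves, so for `d_i = 0` the test is equality, as it should
    -- be.
    refine SemiDec.of_eq (p := fun x : List (Word n m) × Word n m =>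
      ∃ S : Fin m → Word n m × ℕ, IsDiagonalCert x.1 S ∧ ∃ e : Fin m → ℕ × ℕ,
        eval (combination S e) = eval x.2 ∧ ¬ ∀ i, (e i).1 % (S i).2 = (e i).2 % (S i).2) ?_
      fun x => ?_
    · refine SemiDec.ex (SemiDec.and (SemiDec.isDiagonalCert
        (Primrec.fst.comp Primrec.fst) Primrec.snd) (SemiDec.ex (PrimrecPred.semiDec
          (PrimrecPred.and ?_ (PrimrecPred.not ?_)))))
      · exact primrecRel_eval_eq.comp
          (primrec_combination (Primrec.snd.comp Primrec.fst) Primrec.snd)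
          (Primrec.snd.comp (Primrec.fst.comp Primrec.fst))
      · have h1 : ∀ i : Fin m, Primrec fun x : ((List (Word n m) × Word n m) ×
            (Fin m → Word n m × ℕ)) × (Fin m → ℕ × ℕ) => (x.1.2 i).2 := fun i =>
          Primrec.snd.comp (Primrec.finArrow_app (Primrec.snd.comp Primrec.fst) i)
        have h2 : ∀ i : Fin m, Primrec fun x : ((List (Word n m) × Word n m) ×
            (Fin m → Word n m × ℕ)) × (Fin m → ℕ × ℕ) => x.2 i := fun i =>
          Primrec.finArrow_app Primrec.snd i
        refine (Primrec.eq.comp (Primrec.list_ofFn fun i =>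
          Primrec.nat_mod.comp (Primrec.fst.comp (h2 i)) (h1 i)) (Primrec.list_ofFn fun i =>
          Primrec.nat_mod.comp (Primrec.snd.comp (h2 i)) (h1 i))).of_eq fun x => ?_
        rw [List.ofFn_injective.eq_iff, funext_iff]
    · have key : ∀ (S : Fin m → Word n m × ℕ), IsDiagonalCert x.1 S → ∀ e : Fin m → ℕ × ℕ,
          eval (combination S e) ∈ span x.1 ↔ ∀ i, (e i).1 % (S i).2 = (e i).2 % (S i).2 := by
        intro S hS e
        obtain ⟨b, hb, hd⟩ := hS.exists_basis
        rw [eval_combination hb, ← mem_baseSubgroup, ← mem_baseSubmodule, hd]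
        refine forall_congr' fun i => ?_
        rw [Module.Basis.repr_sum_self]
        exact Nat.modEq_iff_dvd.symm.trans ⟨Eq.symm, Eq.symm⟩
      constructor
      · rintro ⟨S, hS, e, he, hne⟩
        rw [← key S hS, he] at hne
        refine ⟨?_, hne⟩
        obtain ⟨b, hb, -⟩ := hS.exists_basis
        rw [← he, eval_combination hb]
      · rintro ⟨h1, h2⟩
        obtain ⟨S, hS, -⟩ := exists_isDiagonalCert x.1
        obtain ⟨b, hb, -⟩ := hS.exists_basis
        obtain ⟨e, he⟩ := exists_combination hb h1
        refine ⟨S, hS, e, he, ?_⟩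
        rwa [← key S hS, he]
  -- If `g z ∈ H` with `z` central, then `g ∉ H` is equivalent to `z ∉ H`; such a `z` exists once
  -- the free part of `g` lies in the projection.
  refine SemiDec.of_eq (p := fun x : List (Word n m) × Word n m =>
    FreeGroup.mk (proj x.2) ∉ freePart (span x.1) ∨ ∃ z : Word n m,
      eval (x.2 ++ z) ∈ span x.1 ∧ ((eval z).1 = 1 ∧ eval z ∉ span x.1)) ?_ fun x => ?_
  · refine SemiDec.or (SemiDec.not_mem_freePart Primrec.fst
      (primrec_proj.comp Primrec.snd)) (SemiDec.ex (SemiDec.and ?_ ?_))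
    · exact SemiDec.mem_span (Primrec.fst.comp Primrec.fst)
        (Primrec.list_append.comp (Primrec.snd.comp Primrec.fst) Primrec.snd)
    · exact hbase.comp (f := fun y : (List (Word n m) × Word n m) × Word n m => (y.1.1, y.2))
        ((Primrec.fst.comp Primrec.fst).pair Primrec.snd)
  · rw [← fst_eval]
    constructor
    · rintro (h | ⟨z, h1, h2, h3⟩) hx
      · exact h (fst_mem_freePart hx)
      · rw [eval_append, (span x.1).mul_mem_cancel_left hx] at h1
        exact h3 h1
    · intro hx
      by_cases hf : (eval x.2).1 ∈ freePart (span x.1)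
      · obtain ⟨s, hs⟩ := mem_freePart.1 hf
        obtain ⟨z, hz⟩ := eval_surjective ((1, (eval x.2).2⁻¹ * s) : FTA n m)
        have h1 : eval (x.2 ++ z) = ((eval x.2).1, s) := by
          rw [eval_append, hz]
          ext1 <;> simp
        refine Or.inr ⟨z, h1 ▸ hs, by rw [hz], fun h2 => hx ?_⟩
        rw [← h1, eval_append] at hs
        exact ((span x.1).mul_mem_cancel_right h2).1 hs
      · exact Or.inl hf

theorem _root_.SemiDec.not_mem_span {α : Type*} [Primcodable α] {f : α → List (Word n m)}
    {g : α → Word n m} (hf : Primrec f) (hg : Primrec g) :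
    SemiDec fun a => eval (g a) ∉ span (f a) :=
  SemiDec.comp (f := fun a => (f a, g a)) semiDec_not_mem_span (hf.pair hg)

/-- The graph of the largest elementary divisor is semi-decidable. -/
theorem semiDec_largestElementaryDivisor : SemiDec fun x : List (Word n m) × ℕ =>
    largestElementaryDivisor (baseSubmodule (span x.1)) = x.2 := by
  refine SemiDec.of_eq (p := fun x : List (Word n m) × ℕ =>
    ∃ S : Fin m → Word n m × ℕ, IsDiagonalCert x.1 S ∧
      ((x.2 = 1 ∨ ∃ y ∈ List.ofFn fun i => (S i).2, y ≠ 0 ∧ x.2 = y) ∧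
        ∀ i, (S i).2 ≠ 0 → (S i).2 ∣ x.2)) ?_ fun x => ?_
  · have hS : ∀ i : Fin m, Primrec fun x : (List (Word n m) × ℕ) × (Fin m → Word n m × ℕ) =>
        (x.2 i).2 := fun i => Primrec.snd.comp (Primrec.finArrow_app Primrec.snd i)
    have hx : Primrec fun x : (List (Word n m) × ℕ) × (Fin m → Word n m × ℕ) => x.1.2 :=
      Primrec.snd.comp Primrec.fst
    refine SemiDec.ex (SemiDec.and (SemiDec.isDiagonalCert
      (Primrec.fst.comp Primrec.fst) Primrec.snd) (SemiDec.and (SemiDec.or ?_ ?_)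
        (SemiDec.all_fin fun i => ?_)))
    · exact (Primrec.eq.comp hx (Primrec.const 1)).semiDec
    · refine SemiDec.bex (Primrec.list_ofFn hS) (PrimrecPred.semiDec (PrimrecPred.and
        (PrimrecPred.not (Primrec.eq.comp Primrec.snd (Primrec.const 0)))
        (Primrec.eq.comp (hx.comp Primrec.fst) Primrec.snd)))
    · refine PrimrecPred.semiDec (((Primrec.eq.comp (hS i) (Primrec.const 0)).or
        (Primrec.eq.comp (Primrec.nat_mod.comp hx (hS i)) (Primrec.const 0))).of_eq fun x => ?_)
      rw [Nat.dvd_iff_mod_eq_zero]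
      tauto
  · constructor
    · rintro ⟨S, hS, h1, h2⟩
      obtain ⟨b, -, hd⟩ := hS.exists_basis
      refine hd.largestElementaryDivisor_eq (h1.imp_right ?_) h2
      rintro ⟨y, hy, hy0, hxy⟩
      obtain ⟨i, rfl⟩ := (List.mem_ofFn' _ _).1 hy
      exact ⟨i, hy0, hxy⟩
    · intro hx
      obtain ⟨S, hS, hdvd⟩ := exists_isDiagonalCert x.1
      obtain ⟨b, -, hd⟩ := hS.exists_basis
      obtain ⟨D, hD1, hD⟩ := IsDiagonal.exists_largest hdvd
      have hDx : D = x.2 := by rw [← hx, hd.largestElementaryDivisor_eq hD1 hD]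
      rw [hDx] at hD1 hD
      refine ⟨S, hS, hD1.imp_right ?_, hD⟩
      rintro ⟨i, hi0, hi⟩
      exact ⟨_, (List.mem_ofFn' _ _).2 ⟨i, rfl⟩, hi0, hi⟩

end FTA

/-! ## The number of vertices of the restricted Stallings automaton -/

section ShortCycles

open FreeGroup

variable {X : Type*} {K : Subgroup (FreeGroup X)}

/-- Cutting between two occurrences of the same letter creates no new pair of adjacent letters, even
cyclically. -/
theorem _root_.FreeGroup.IsCyclicallyReduced.remove_infix {p s t : List (X × Bool)} {x : X × Bool}
    (h : IsCyclicallyReduced (p ++ x :: (s ++ x :: t))) : IsCyclicallyReduced (p ++ x :: t) := by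
  rw [isCyclicallyReduced_iff_append_self] at h ⊢
  have h1 : IsReduced (p ++ [x]) := h.infix ⟨[], s ++ x :: t ++ (p ++ x :: (s ++ x :: t)), by simp⟩
  have h2 : IsReduced (x :: t ++ p ++ [x]) :=
    h.infix ⟨p ++ x :: s, s ++ x :: t, by simp⟩
  have h3 : IsReduced (x :: t) := h.infix ⟨p ++ x :: s, p ++ x :: (s ++ x :: t), by simp⟩
  have h4 : IsReduced (x :: t ++ p ++ x :: t) := List.isChain_split.2 ⟨h2, h3⟩
  have h5 : p ++ x :: t ++ (p ++ x :: t) = p ++ x :: (t ++ p ++ x :: t) := by simp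
  rw [h5]
  exact List.isChain_split.2 ⟨h1, by simpa [FreeGroup.IsReduced] using h4⟩

theorem ncard_schreierBall_le {A : List (X × Bool)} (hA : ∀ a, a ∈ A) (l : ℕ) :
    ∃ t : Finset (RightCosets K), (∀ q, q ∈ t ↔ q ∈ schreierBall K l) ∧
      t.card ≤ (wordsUpTo A l).length := by
  classical
  refine ⟨((wordsUpTo A l).map fun w => rightCoset K (mk w)).toFinset, fun q => ?_, ?_⟩
  · rw [List.mem_toFinset, List.mem_map]
    constructor
    · rintro ⟨w, hw, rfl⟩
      exact ⟨w, (mem_wordsUpTo hA).1 hw, rfl⟩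
    · rintro ⟨w, hw, rfl⟩
      exact ⟨w, (mem_wordsUpTo hA).2 hw, rfl⟩
  · exact (List.toFinset_card_le _).trans (by rw [List.length_map])

/-- A vertex of the restricted Stallings automaton lies on a short cyclically reduced closed
walk. -/
theorem GeneratedInLength.exists_short_cycle {l : ℕ} (hK : GeneratedInLength K l)
    {A : List (X × Bool)} (hA : ∀ a, a ∈ A) {u : FreeGroup X}
    (hu : rightCoset K u ∈ cyclicVerts K) :
    ∃ z, z ≠ [] ∧ IsCyclicallyReduced z ∧ u * mk z * u⁻¹ ∈ K ∧
      z.length ≤ (wordsUpTo A l).length * A.length := by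
  classical
  have hball : rightCoset K u ∈ schreierBall K l :=
    hK.stallings_verts_subset (cyclicVerts_subset_stallings hu)
  -- A shortest walk is taken; if it were too long, a repeated state would allow a cut.
  obtain ⟨z, ⟨hz, hc, hm⟩, hmin⟩ := WellFounded.has_min
    (measure (List.length : List (X × Bool) → ℕ)).wf
    {z | z ≠ [] ∧ IsCyclicallyReduced z ∧ u * mk z * u⁻¹ ∈ K} (mem_cyclicVerts.1 hu)
  refine ⟨z, hz, hc, hm, ?_⟩
  by_contra! hlen
  have hclosed : rightCoset K (u * mk z) = rightCoset K u := rightCoset_eq_rightCoset.2 hm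
  have hstay : StaysIn (schreierBall K l) u z :=
    hK.staysIn hc.isReduced hball (by rwa [hclosed])
  obtain ⟨t, ht, htc⟩ := ncard_schreierBall_le (K := K) hA l
  -- The state records the vertex reached and the letter just read. Equal vertices keep the walk
  -- closed after the cut, and equal letters keep it cyclically reduced and nonempty.
  let state : Fin z.length → RightCosets K × (X × Bool) := fun i =>
    (rightCoset K (u * mk (z.take (i + 1))), z[i])
  have hcard : (t ×ˢ A.toFinset).card < (Finset.univ : Finset (Fin z.length)).card := by
    rw [Finset.card_product, Finset.card_univ, Fintype.card_fin]
    exact lt_of_le_of_lt (Nat.mul_le_mul htc (List.toFinset_card_le _)) hlen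
  obtain ⟨i, -, j, -, hij, hst⟩ := Finset.exists_ne_map_eq_of_card_lt_of_maps_to (f := state) hcard
    fun i _ => Finset.mem_coe.2 (Finset.mem_product.2 ⟨(ht _).2
      (hstay _ (z.drop (i + 1)) (List.take_append_drop _ _).symm), List.mem_toFinset.2 (hA _)⟩)
  wlog hlt : i < j generalizing i j
  · exact this j i hij.symm hst.symm (lt_of_le_of_ne (not_lt.1 hlt) hij.symm)
  obtain ⟨hst1, hst2⟩ := Prod.mk.inj hst
  have hi : z.take (i + 1) = z.take i ++ [z[i]] := by simp
  have hj : z.take (j + 1) = z.take j ++ [z[j]] := by simp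
  have hzj : z = z.take j ++ z[j] :: z.drop (j + 1) := by simp
  obtain ⟨s, hs⟩ : ∃ s, z.take j = z.take i ++ z[i] :: s := by
    refine ⟨(z.take j).drop (i + 1), ?_⟩
    conv_lhs => rw [← List.take_append_drop (i + 1) (z.take j)]
    rw [List.take_take, min_eq_left (by omega), hi, List.append_assoc]
    rfl
  set p := z.take i
  set x := z[i]
  set t' := z.drop (j + 1)
  rw [hj, hs] at hst1
  rw [hi] at hst1
  rw [hs] at hzj
  have hx : z[j] = x := hst2.symm
  rw [hx] at hzj hst1
  have hz2 : z = p ++ x :: (s ++ x :: t') := by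
    rw [hzj]
    simp
  refine hmin (p ++ x :: t') ⟨by simp, ?_, ?_⟩ ?_
  · rw [hz2] at hc
    exact hc.remove_infix
  · rw [← rightCoset_eq_rightCoset]
    have h1 := rightCoset_mul hst1 (mk t')
    have h2 : p ++ x :: t' = p ++ [x] ++ t' := by simp
    rw [h2, mk_append, ← mul_assoc, h1, mul_assoc, ← mk_append]
    have h3 : p ++ x :: s ++ [x] ++ t' = z := by
      rw [hz2]
      simp
    rw [h3, hclosed]
  · change (p ++ x :: t').length < z.length
    rw [hz2]
    simp

end ShortCycles

namespace FTA

open FreeGroup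

variable {n m : ℕ}

/-- The letters of the free part. -/
noncomputable def letters (n : ℕ) : List (Fin n × Bool) := (Finset.univ : Finset (Fin n × Bool)).toList

theorem mem_letters (a : Fin n × Bool) : a ∈ letters n := by simp [letters]

theorem generatedInLength_span (W : List (Word n m)) :
    GeneratedInLength (freePart (span W)) W.flatten.length := by
  have h : freePart (span W) = Subgroup.closure (FreeGroup.mk '' (proj '' {w | w ∈ W})) := by
    unfold freePart span subgroupOfWords
    rw [MonoidHom.map_closure]
    congr 1
    ext u
    constructor
    · rintro ⟨_, ⟨w, hw, rfl⟩, rfl⟩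
      exact ⟨_, ⟨w, hw, rfl⟩, (fst_eval w).symm⟩
    · rintro ⟨_, ⟨w, hw, rfl⟩, rfl⟩
      exact ⟨_, ⟨w, hw, rfl⟩, fst_eval w⟩
  rw [h]
  refine generatedInLength_closure ?_
  rintro _ ⟨w, hw, rfl⟩
  have h1 : (proj w).length ≤ w.length := List.length_filterMap_le _ _
  have h2 : w.length ≤ W.flatten.length := (List.sublist_flatten_of_mem hw).length_le
  omega

theorem freePart_span_eq_bot {W : List (Word n m)} :
    freePart (span W) = ⊥ ↔ ∀ w ∈ W, (eval w).1 = 1 := by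
  constructor
  · intro h w hw
    have := fst_mem_freePart (eval_mem_span hw)
    rwa [h, Subgroup.mem_bot] at this
  · intro h
    have h1 : span W ≤ (⊥ : Subgroup (FreeGroup (Fin n))).comap (MonoidHom.fst _ _) :=
      span_le.2 fun w hw => Subgroup.mem_bot.2 (h w hw)
    exact le_bot_iff.1 (Subgroup.map_le_iff_le_comap.2 h1)

/-- A central factor that brings the element into `H` is found by search. -/
theorem _root_.SemiDec.mem_freePart {α : Type*} [Primcodable α] {f : α → List (Word n m)}
    {g : α → FreeWord n} (hf : Primrec f) (hg : Primrec g) :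
    SemiDec fun a => FreeGroup.mk (g a) ∈ freePart (span (f a)) := by
  refine SemiDec.of_eq (p := fun a => ∃ z : Word n m, (eval z).1 = 1 ∧
    eval (emb (g a) ++ z) ∈ span (f a)) ?_ fun a => ?_
  · exact SemiDec.ex (SemiDec.and (primrecPred_fst_eval_eq_one.comp Primrec.snd).semiDec
      (SemiDec.mem_span (hf.comp Primrec.fst) (Primrec.list_append.comp
        (primrec_emb.comp (hg.comp Primrec.fst)) Primrec.snd)))
  · rw [FTA.mem_freePart]
    constructor
    · rintro ⟨z, hz, hm⟩
      refine ⟨(eval z).2, ?_⟩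
      convert hm using 1
      rw [eval_append, eval_emb]
      ext1 <;> simp [hz]
    · rintro ⟨s, hs⟩
      obtain ⟨z, hz⟩ := eval_surjective ((1, s) : FTA n m)
      refine ⟨z, by rw [hz], ?_⟩
      rw [eval_append, eval_emb, hz]
      simpa using hs

/-- A bound for the lengths of shortest cyclically reduced closed walks. -/
noncomputable def cycleBound (W : List (Word n m)) : ℕ :=
  (wordsUpTo (letters n) W.flatten.length).length * (letters n).length

theorem primrec_length_flatten : Primrec fun W : List (Word n m) => W.flatten.length :=
  Primrec.list_length.comp (Primrec.list_flatten.comp Primrec.id)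

theorem primrec_cycleBound : Primrec (cycleBound : List (Word n m) → ℕ) :=
  Primrec.nat_mul.comp (Primrec.list_length.comp ((primrec_wordsUpTo _).comp
    primrec_length_flatten)) (Primrec.const _)

/-- The list `C` represents the vertices of the restricted Stallings automaton. -/
def IsVertexList (W : List (Word n m)) (C : List (FreeWord n)) : Prop :=
  (∀ i < C.length, ∀ j < i,
    FreeGroup.mk (C.getD i [] ++ FreeGroup.invRev (C.getD j [])) ∉ freePart (span W)) ∧
  (∀ c ∈ C, ∃ z : FreeWord n, (z ≠ [] ∧ IsCyclicallyReduced z) ∧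
    FreeGroup.mk (c ++ z ++ FreeGroup.invRev c) ∈ freePart (span W)) ∧
  -- All candidates for vertices have representatives of this length. The bound on `z` turns the
  -- absence of a cycle into finitely many non-membership conditions.
  ∀ c ∈ wordsUpTo (letters n) W.flatten.length,
    (∃ c' ∈ C, FreeGroup.mk (c ++ FreeGroup.invRev c') ∈ freePart (span W)) ∨
    ∀ z ∈ wordsUpTo (letters n) (cycleBound W), (z = [] ∨ ¬ IsCyclicallyReduced z) ∨
      FreeGroup.mk (c ++ z ++ FreeGroup.invRev c) ∉ freePart (span W)

theorem semiDec_isVertexList : SemiDec fun x : List (Word n m) × List (FreeWord n) =>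
    IsVertexList x.1 x.2 := by
  refine SemiDec.and (SemiDec.ball_lt (Primrec.list_length.comp Primrec.snd)
    (SemiDec.ball_lt Primrec.snd ?_)) (SemiDec.and (SemiDec.ball Primrec.snd (SemiDec.ex
      (SemiDec.and ?_ ?_))) (SemiDec.ball ((primrec_wordsUpTo _).comp
        (primrec_length_flatten.comp Primrec.fst)) (SemiDec.or (SemiDec.bex
          (Primrec.snd.comp Primrec.fst) ?_) (SemiDec.ball ((primrec_wordsUpTo _).comp
            (primrec_cycleBound.comp (Primrec.fst.comp Primrec.fst))) (SemiDec.or ?_ ?_)))))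
  · refine SemiDec.not_mem_freePart (Primrec.fst.comp (Primrec.fst.comp Primrec.fst))
      (Primrec.list_append.comp ?_ (primrec_invRev.comp ?_))
    · exact (Primrec.list_getD []).comp (Primrec.snd.comp (Primrec.fst.comp Primrec.fst))
        (Primrec.snd.comp Primrec.fst)
    · exact (Primrec.list_getD []).comp (Primrec.snd.comp (Primrec.fst.comp Primrec.fst))
        Primrec.snd
  · exact (PrimrecPred.and (PrimrecPred.not (Primrec.eq.comp Primrec.snd (Primrec.const [])))
      (primrecPred_isCyclicallyReduced.comp Primrec.snd)).semiDec
  · exact SemiDec.mem_freePart (Primrec.fst.comp (Primrec.fst.comp Primrec.fst))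
      (Primrec.list_append.comp (Primrec.list_append.comp (Primrec.snd.comp Primrec.fst)
        Primrec.snd) (primrec_invRev.comp (Primrec.snd.comp Primrec.fst)))
  · exact SemiDec.mem_freePart (Primrec.fst.comp (Primrec.fst.comp Primrec.fst))
      (Primrec.list_append.comp (Primrec.snd.comp Primrec.fst) (primrec_invRev.comp Primrec.snd))
  · exact (PrimrecPred.or (Primrec.eq.comp Primrec.snd (Primrec.const []))
      (primrecPred_isCyclicallyReduced.comp Primrec.snd).not).semiDec
  · exact SemiDec.not_mem_freePart (Primrec.fst.comp (Primrec.fst.comp Primrec.fst))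
      (Primrec.list_append.comp (Primrec.list_append.comp (Primrec.snd.comp Primrec.fst)
        Primrec.snd) (primrec_invRev.comp (Primrec.snd.comp Primrec.fst)))

theorem mk_conj_word (c z : FreeWord n) : FreeGroup.mk (c ++ z ++ FreeGroup.invRev c) =
    FreeGroup.mk c * FreeGroup.mk z * (FreeGroup.mk c)⁻¹ := by
  rw [mk_append, mk_append, mk_invRev]

theorem mk_append_invRev_mem {K : Subgroup (FreeGroup (Fin n))} (c c' : FreeWord n) :
    FreeGroup.mk (c ++ FreeGroup.invRev c') ∈ K ↔
      rightCoset K (FreeGroup.mk c) = rightCoset K (FreeGroup.mk c') := by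
  rw [mk_append, mk_invRev, rightCoset_eq_rightCoset]

theorem IsVertexList.ncard_cyclicVerts {W : List (Word n m)} {C : List (FreeWord n)}
    (h : IsVertexList W C) : (cyclicVerts (freePart (span W))).ncard = C.length := by
  obtain ⟨h1, h2, h3⟩ := h
  set K := freePart (span W)
  let f : Fin C.length → RightCosets K := fun i => rightCoset K (FreeGroup.mk C[i])
  have hget : ∀ i : Fin C.length, C.getD i [] = C[i] := fun i => by simp
  have hinj : Function.Injective f := by
    intro i j hij
    by_contra hne
    wlog hlt : j < i generalizing i j
    · exact this hij.symm (Ne.symm hne) (lt_of_le_of_ne (not_lt.1 hlt) hne)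
    have := h1 i i.2 j hlt
    rw [hget, hget, mk_append_invRev_mem] at this
    exact this hij
  have hrange : Set.range f = cyclicVerts K := by
    ext q
    constructor
    · rintro ⟨i, rfl⟩
      obtain ⟨z, ⟨hz, hc⟩, hm⟩ := h2 C[i] (List.getElem_mem _)
      rw [mk_conj_word] at hm
      exact mem_cyclicVerts.2 ⟨z, hz, hc, hm⟩
    · intro hq
      obtain ⟨c, hc, rfl⟩ := (generatedInLength_span W).stallings_verts_subset
        (cyclicVerts_subset_stallings hq)
      rcases h3 c ((mem_wordsUpTo mem_letters).2 hc) with ⟨c', hc', hm⟩ | hz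
      · obtain ⟨i, hi, rfl⟩ := List.mem_iff_getElem.1 hc'
        exact ⟨⟨i, hi⟩, ((mk_append_invRev_mem _ _).1 hm).symm⟩
      · obtain ⟨z, hz0, hzc, hzm, hzl⟩ :=
          (generatedInLength_span W).exists_short_cycle mem_letters hq
        rw [← mk_conj_word] at hzm
        rcases hz z ((mem_wordsUpTo mem_letters).2 hzl) with (h | h) | h
        · exact absurd h hz0
        · exact absurd hzc h
        · exact absurd hzm h
  rw [← hrange, ← Set.image_univ, Set.ncard_image_of_injective _ hinj, Set.ncard_univ,
    Nat.card_eq_fintype_card, Fintype.card_fin]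

theorem exists_isVertexList (W : List (Word n m)) : ∃ C, IsVertexList W C := by
  set K := freePart (span W) with hK
  have hfin : (cyclicVerts K).Finite := (generatedInLength_span W).restrictedStallings_verts_finite.subset
    cyclicVerts_subset_restrictedStallings
  choose wd hwd using exists_rightCoset_mk (K := K)
  have hmem : ∀ c, c ∈ hfin.toFinset.toList.map wd ↔ ∃ q ∈ cyclicVerts K, wd q = c := by
    intro c
    simp
  refine ⟨hfin.toFinset.toList.map wd, ?_, ?_, ?_⟩
  · intro i hi j hji hm
    rw [mk_append_invRev_mem, List.getD_eq_getElem _ _ hi,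
      List.getD_eq_getElem _ _ (hji.trans hi), List.getElem_map, List.getElem_map, ← hwd,
      ← hwd] at hm
    have := (Finset.nodup_toList hfin.toFinset).getElem_inj_iff.1 hm
    omega
  · intro c hc
    obtain ⟨q, hq, rfl⟩ := (hmem c).1 hc
    rw [hwd q] at hq
    obtain ⟨z, hz, hzc, hzm⟩ := mem_cyclicVerts.1 hq
    exact ⟨z, ⟨hz, hzc⟩, by rwa [mk_conj_word]⟩
  · intro c _
    by_cases hc : rightCoset K (FreeGroup.mk c) ∈ cyclicVerts K
    · refine Or.inl ⟨_, (hmem _).2 ⟨_, hc, rfl⟩, ?_⟩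
      rw [mk_append_invRev_mem, ← hwd]
    · refine Or.inr fun z _ => ?_
      by_contra! hcon
      obtain ⟨⟨hz, hzc⟩, hzm⟩ := hcon
      rw [mk_conj_word] at hzm
      exact hc (mem_cyclicVerts.2 ⟨z, hz, hzc, hzm⟩)

theorem semiDec_ncard_verts : SemiDec fun x : List (Word n m) × ℕ =>
    (restrictedStallings (freePart (span x.1))).verts.ncard = x.2 := by
  -- The trivial projection is separate: its automaton has one vertex, which lies on no nontrivial
  -- cycle.
  refine SemiDec.of_eq (p := fun x : List (Word n m) × ℕ =>
    ((∀ w ∈ x.1, (eval w).1 = 1) ∧ x.2 = 1) ∨ ((∃ w ∈ x.1, (eval w).1 ≠ 1) ∧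
      ∃ C, IsVertexList x.1 C ∧ C.length = x.2)) ?_ fun x => ?_
  · refine SemiDec.or (SemiDec.and (SemiDec.ball Primrec.fst ?_) ?_)
      (SemiDec.and (SemiDec.bex Primrec.fst ?_) (SemiDec.ex (SemiDec.and ?_ ?_)))
    · exact (primrecPred_fst_eval_eq_one.comp Primrec.snd).semiDec
    · exact (Primrec.eq.comp Primrec.snd (Primrec.const 1)).semiDec
    · exact (primrecPred_fst_eval_eq_one.comp Primrec.snd).not.semiDec
    · exact semiDec_isVertexList.comp
        (f := fun y : (List (Word n m) × ℕ) × List (FreeWord n) => (y.1.1, y.2))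
        ((Primrec.fst.comp Primrec.fst).pair Primrec.snd)
    · exact (Primrec.eq.comp (Primrec.list_length.comp Primrec.snd)
        (Primrec.snd.comp Primrec.fst)).semiDec
  · by_cases hK : freePart (span x.1) = ⊥
    · have h1 := freePart_span_eq_bot.1 hK
      rw [restrictedStallings_verts_bot hK, Set.ncard_singleton]
      constructor
      · rintro (⟨-, h⟩ | ⟨⟨w, hw, h⟩, -⟩)
        · exact h.symm
        · exact absurd (h1 w hw) h
      · intro h
        exact Or.inl ⟨h1, h.symm⟩
    · have h1 : ∃ w ∈ x.1, (eval w).1 ≠ 1 := by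
        by_contra! h
        exact hK (freePart_span_eq_bot.2 h)
      rw [restrictedStallings_verts hK]
      constructor
      · rintro (⟨h, -⟩ | ⟨-, C, hC, h⟩)
        · obtain ⟨w, hw, hne⟩ := h1
          exact absurd (h w hw) hne
        · rw [hC.ncard_cyclicVerts, h]
      · intro h
        obtain ⟨C, hC⟩ := exists_isVertexList x.1
        exact Or.inr ⟨h1, C, hC, by rw [← hC.ncard_cyclicVerts, h]⟩

theorem semiDec_spectrumBound : SemiDec fun x : List (Word n m) × ℕ =>
    spectrumBound (span x.1) = x.2 := by
  refine SemiDec.of_eq (p := fun x : List (Word n m) × ℕ => ∃ y : ℕ × ℕ,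
    ((restrictedStallings (freePart (span x.1))).verts.ncard = y.1 ∧
      largestElementaryDivisor (baseSubmodule (span x.1)) = y.2) ∧ y.1 * y.2 = x.2) ?_ fun x => ?_
  · refine SemiDec.ex (SemiDec.and (SemiDec.and ?_ ?_) ?_)
    · exact semiDec_ncard_verts.comp
        (f := fun y : (List (Word n m) × ℕ) × (ℕ × ℕ) => (y.1.1, y.2.1))
        ((Primrec.fst.comp Primrec.fst).pair (Primrec.fst.comp Primrec.snd))
    · exact semiDec_largestElementaryDivisor.comp
        (f := fun y : (List (Word n m) × ℕ) × (ℕ × ℕ) => (y.1.1, y.2.2))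
        ((Primrec.fst.comp Primrec.fst).pair (Primrec.snd.comp Primrec.snd))
    · exact (Primrec.eq.comp (Primrec.nat_mul.comp (Primrec.fst.comp Primrec.snd)
        (Primrec.snd.comp Primrec.snd)) (Primrec.snd.comp Primrec.fst)).semiDec
  · constructor
    · rintro ⟨⟨a, b⟩, ⟨rfl, rfl⟩, h⟩
      exact h
    · intro h
      exact ⟨(_, _), ⟨rfl, rfl⟩, h⟩

end FTA

/-! ## Short representatives of the elements of the spectrum -/

namespace FTA

open FreeGroup

variable {n m : ℕ}

/-- The subgroup generated by `H` and the `k`-th powers of elements of the free-abelian part. -/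
def extendByPowers (H : Subgroup (FTA n m)) (k : ℕ) : Subgroup (FTA n m) where
  carrier := {g | ∃ s : Multiplicative (Fin m → ℤ), g * (1, s ^ k) ∈ H}
  one_mem' := ⟨1, by simp [Prod.mk_one_one, H.one_mem]⟩
  mul_mem' := by
    rintro x y ⟨s, hs⟩ ⟨t, ht⟩
    refine ⟨s * t, ?_⟩
    convert H.mul_mem hs ht using 1
    ext1
    · simp
    · simp only [Prod.snd_mul, mul_pow]
      exact mul_mul_mul_comm _ _ _ _
  inv_mem' := by
    rintro x ⟨s, hs⟩
    refine ⟨s⁻¹, ?_⟩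
    convert H.inv_mem hs using 1
    ext1
    · simp
    · simp [mul_comm]

theorem mem_extendByPowers {H : Subgroup (FTA n m)} {k : ℕ} {g : FTA n m} :
    g ∈ extendByPowers H k ↔ ∃ s : Multiplicative (Fin m → ℤ), g * (1, s ^ k) ∈ H := Iff.rfl

theorem le_extendByPowers (H : Subgroup (FTA n m)) (k : ℕ) : H ≤ extendByPowers H k :=
  fun g hg => ⟨1, by simpa [Prod.mk_one_one] using hg⟩

theorem fst_mem_of_mem_extendByPowers {H : Subgroup (FTA n m)} {k : ℕ} {g : FTA n m}
    (hg : g ∈ extendByPowers H k) : g.1 ∈ freePart H := by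
  obtain ⟨s, hs⟩ := mem_extendByPowers.1 hg
  have := fst_mem_freePart hs
  simpa using this

/-! ### Pumping: words with the same action modulo `k`-th powers -/

section Action

variable (H : Subgroup (FTA n m)) (l k : ℕ)

/-- The words `c` and `c'` act in the same way on the cosets of `extendByPowers H k` that lie over
the ball of radius `l`. -/
def ActsAlike (c c' : FreeWord n) : Prop :=
  ∀ p : FreeWord n, p.length ≤ l →
    (StaysIn (schreierBall (freePart H) l) (FreeGroup.mk p) c ↔
      StaysIn (schreierBall (freePart H) l) (FreeGroup.mk p) c') ∧
    (StaysIn (schreierBall (freePart H) l) (FreeGroup.mk p) c →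
      ((FreeGroup.mk p * FreeGroup.mk c * (FreeGroup.mk c')⁻¹ * (FreeGroup.mk p)⁻¹, 1) : FTA n m) ∈
        extendByPowers H k)

variable {H l k}

theorem ActsAlike.refl (c : FreeWord n) : ActsAlike H l k c c := fun p _ =>
  ⟨Iff.rfl, fun _ => by
    rw [mul_inv_cancel_right, mul_inv_cancel, Prod.mk_one_one]
    exact Subgroup.one_mem _⟩

theorem ActsAlike.trans {c c' c'' : FreeWord n} (h : ActsAlike H l k c c')
    (h' : ActsAlike H l k c' c'') : ActsAlike H l k c c'' := by
  intro p hp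
  refine ⟨(h p hp).1.trans (h' p hp).1, fun hs => ?_⟩
  convert Subgroup.mul_mem _ ((h p hp).2 hs) ((h' p hp).2 ((h p hp).1.1 hs)) using 1
  ext1
  · simp only [Prod.fst_mul]
    group
  · simp

theorem ActsAlike.rightCoset_eq {c c' p : FreeWord n} (h : ActsAlike H l k c c')
    (hp : p.length ≤ l) (hs : StaysIn (schreierBall (freePart H) l) (FreeGroup.mk p) c) :
    rightCoset (freePart H) (FreeGroup.mk p * FreeGroup.mk c) =
      rightCoset (freePart H) (FreeGroup.mk p * FreeGroup.mk c') := by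
  rw [rightCoset_eq_rightCoset, mul_inv_rev, ← mul_assoc]
  exact fst_mem_of_mem_extendByPowers ((h p hp).2 hs)

/-- Both words lead to the same coset, so the common suffix continues alike. This is what allows a
prefix to be replaced. -/
theorem ActsAlike.append {c c' : FreeWord n} (h : ActsAlike H l k c c') (d : FreeWord n) :
    ActsAlike H l k (c ++ d) (c' ++ d) := by
  intro p hp
  refine ⟨⟨fun hs => ?_, fun hs => ?_⟩, fun hs => ?_⟩
  · exact StaysIn.append ((h p hp).1.1 hs.left)
      (StaysIn.congr_left (h.rightCoset_eq hp hs.left) hs.right)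
  · have h1 := (h p hp).1.2 hs.left
    exact StaysIn.append h1 (StaysIn.congr_left (h.rightCoset_eq hp h1).symm hs.right)
  · convert (h p hp).2 hs.left using 2
    rw [mk_append, mk_append]
    group

/-- Every element of the free part that leads from a vertex of the ball to another one can be
corrected by a vector with entries less than `k`. -/
theorem exists_mem_extendByPowers (hk : 0 < k) {u : FreeGroup (Fin n)} (hu : u ∈ freePart H) :
    ∃ y : Fin m → Fin k, ((u, Multiplicative.ofAdd fun j => ((y j : ℕ) : ℤ)) : FTA n m) ∈
      extendByPowers H k := by
  obtain ⟨s, hs⟩ := mem_freePart.1 hu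
  have hk' : (0 : ℤ) < k := by exact_mod_cast hk
  refine ⟨fun j => ⟨(s.toAdd j % k).toNat, ?_⟩, mem_extendByPowers.2
    ⟨Multiplicative.ofAdd fun j => s.toAdd j / k, ?_⟩⟩
  · have := Int.emod_lt_of_pos (s.toAdd j) hk'
    have := Int.emod_nonneg (s.toAdd j) hk'.ne'
    omega
  · convert hs using 1
    ext1
    · simp
    · rw [Prod.snd_mul, ← ofAdd_nsmul, ← ofAdd_add, ← ofAdd_toAdd s]
      congr 1
      ext j
      have := Int.emod_nonneg (s.toAdd j) hk'.ne'
      simp only [Pi.add_apply, Int.toNat_of_nonneg this, toAdd_ofAdd, nsmul_eq_mul]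
      exact Int.emod_add_mul_ediv _ _

/-- Modulo `k`-th powers, central parts have `k ^ m` residues, so the action on the ball is
described by a subset of a finite set. In a long word two prefixes have the same description, and
the part between them can be cut out. -/
theorem exists_actsAlike_length_lt (hk : 0 < k) (c : FreeWord n) :
    ∃ c', ActsAlike H l k c c' ∧
      c'.length < 2 ^ ((wordsUpTo (letters n) l).length ^ 2 * k ^ m) := by
  classical
  obtain ⟨c', hc', hmin⟩ := WellFounded.has_min
    (measure (List.length : FreeWord n → ℕ)).wf {c' | ActsAlike H l k c c'} ⟨c, ActsAlike.refl c⟩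
  refine ⟨c', hc', ?_⟩
  by_contra! hlen
  let P := (wordsUpTo (letters n) l).toFinset
  let I : Finset (FreeWord n × FreeWord n × (Fin m → Fin k)) := P ×ˢ P ×ˢ Finset.univ
  have hP : ∀ p, p ∈ P ↔ p.length ≤ l := fun p => by
    rw [List.mem_toFinset, mem_wordsUpTo mem_letters]
  have hI : I.card ≤ (wordsUpTo (letters n) l).length ^ 2 * k ^ m := by
    rw [Finset.card_product, Finset.card_product, Finset.card_univ, Fintype.card_fun,
      Fintype.card_fin, Fintype.card_fin, ← mul_assoc, sq]
    have := List.toFinset_card_le (wordsUpTo (letters n) l)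
    gcongr
  -- Triples of a start, an end and a residue vector. By `exists_mem_extendByPowers`, every start
  -- from which the walk stays in the ball occurs, so equal descriptions give equal actions.
  let R : FreeWord n → Finset (FreeWord n × FreeWord n × (Fin m → Fin k)) := fun c =>
    I.filter fun x => StaysIn (schreierBall (freePart H) l) (FreeGroup.mk x.1) c ∧
      ((FreeGroup.mk x.1 * FreeGroup.mk c * (FreeGroup.mk x.2.1)⁻¹,
        Multiplicative.ofAdd fun j => ((x.2.2 j : ℕ) : ℤ)) : FTA n m) ∈ extendByPowers H k
  have hR : ∀ c d, R c = R d → ∀ p : FreeWord n, p.length ≤ l →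
      StaysIn (schreierBall (freePart H) l) (FreeGroup.mk p) c →
      StaysIn (schreierBall (freePart H) l) (FreeGroup.mk p) d ∧
      ((FreeGroup.mk p * FreeGroup.mk c * (FreeGroup.mk d)⁻¹ * (FreeGroup.mk p)⁻¹, 1) : FTA n m) ∈
        extendByPowers H k := by
    intro c d hcd p hp hs
    obtain ⟨p', hp', hpp'⟩ := hs c [] (List.append_nil _).symm
    obtain ⟨y, hy⟩ := exists_mem_extendByPowers hk (rightCoset_eq_rightCoset.1 hpp')
    have h1 : (p, p', y) ∈ R c := Finset.mem_filter.2 ⟨by simp [I, hP, hp, hp'], hs, hy⟩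
    rw [hcd] at h1
    obtain ⟨-, h2, h3⟩ := Finset.mem_filter.1 h1
    refine ⟨h2, ?_⟩
    convert Subgroup.mul_mem _ hy (Subgroup.inv_mem _ h3) using 1
    ext1
    · simp only [Prod.fst_mul, Prod.fst_inv]
      group
    · simp
  -- A word has one more prefix than letters, which exceeds the number of subsets of `I`.
  have hcard : I.powerset.card < (Finset.univ : Finset (Fin (c'.length + 1))).card := by
    rw [Finset.card_powerset, Finset.card_univ, Fintype.card_fin]
    have := Nat.pow_le_pow_right (n := 2) (by norm_num) hI
    omega
  obtain ⟨i, -, j, -, hij, hst⟩ := Finset.exists_ne_map_eq_of_card_lt_of_maps_to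
    (f := fun i : Fin (c'.length + 1) => R (c'.take i)) hcard
    fun i _ => Finset.mem_coe.2 (Finset.mem_powerset.2 (Finset.filter_subset _ _))
  wlog hlt : i < j generalizing i j
  · exact this j i hij.symm hst.symm (lt_of_le_of_ne (not_lt.1 hlt) hij.symm)
  have h1 : ActsAlike H l k (c'.take j) (c'.take i) := fun p hp =>
    ⟨⟨fun h => (hR _ _ hst.symm p hp h).1, fun h => (hR _ _ hst p hp h).1⟩,
      fun h => (hR _ _ hst.symm p hp h).2⟩
  have h2 := h1.append (c'.drop j)
  rw [List.take_append_drop] at h2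
  refine hmin _ (ActsAlike.trans hc' h2) ?_
  change (c'.take i ++ c'.drop j).length < c'.length
  rw [List.length_append, List.length_take, List.length_drop]
  have := i.2
  have := j.2
  have : (i : ℕ) < j := hlt
  omega

/-- After `i` copies of `c` the walk is at a vertex of the ball. The comparison holds at a short
representative of it and is transported by conjugation with an element of `H`. -/
theorem ActsAlike.pow {c c' p : FreeWord n} (h : ActsAlike H l k c c')
    (hs : ∀ i, StaysIn (schreierBall (freePart H) l) (FreeGroup.mk p) (List.replicate i c).flatten)
    (i : ℕ) : ((FreeGroup.mk p * FreeGroup.mk c' ^ i * (FreeGroup.mk c ^ i)⁻¹ * (FreeGroup.mk p)⁻¹,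
      1) : FTA n m) ∈ extendByPowers H k := by
  induction i with
  | zero =>
    rw [pow_zero, pow_zero, inv_one, mul_one, mul_one, mul_inv_cancel, Prod.mk_one_one]
    exact Subgroup.one_mem _
  | succ i ih =>
    obtain ⟨q, hq, hpq⟩ := hs i _ [] (List.append_nil _).symm
    rw [mk_flatten_replicate] at hpq
    have h1 : StaysIn (schreierBall (freePart H) l) (FreeGroup.mk q) c := by
      refine StaysIn.congr_left hpq ?_
      have := hs (i + 1)
      rw [List.replicate_succ', List.flatten_append] at this
      have := this.right
      rw [mk_flatten_replicate] at this
      simpa using this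
    obtain ⟨σ, hσ⟩ := mem_freePart.1 (rightCoset_eq_rightCoset.1 hpq)
    have h2 := Subgroup.inv_mem _ ((h q hq).2 h1)
    have h3 := le_extendByPowers H k hσ
    have h4 := Subgroup.mul_mem _ ih (Subgroup.mul_mem _ h3 (Subgroup.mul_mem _ h2
      (Subgroup.inv_mem _ h3)))
    convert h4 using 1
    ext1
    · simp only [Prod.fst_mul, Prod.fst_inv]
      rw [pow_succ, pow_succ]
      group
    · simp

/-- Words acting alike can be exchanged in elements of a given order. -/
theorem ActsAlike.exists_relOrder_eq {c c' p : FreeWord n} (h : ActsAlike H l k c c')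
    (hs : ∀ i, StaysIn (schreierBall (freePart H) l) (FreeGroup.mk p) (List.replicate i c).flatten)
    {s : Multiplicative (Fin m → ℤ)} (hord : relOrder (H : Set (FTA n m))
      (FreeGroup.mk p * FreeGroup.mk c * (FreeGroup.mk p)⁻¹, s) = k) :
    ∃ s', relOrder (H : Set (FTA n m))
      (FreeGroup.mk p * FreeGroup.mk c' * (FreeGroup.mk p)⁻¹, s') = k := by
  set K := freePart H with hK
  have hconj : ∀ (d : FreeWord n) (i : ℕ),
      (FreeGroup.mk p * FreeGroup.mk d * (FreeGroup.mk p)⁻¹) ^ i =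
      FreeGroup.mk p * FreeGroup.mk d ^ i * (FreeGroup.mk p)⁻¹ := fun d i => conj_pow
  have hpow : ∀ i, (FreeGroup.mk p * FreeGroup.mk c' ^ i * (FreeGroup.mk p)⁻¹) *
      (FreeGroup.mk p * FreeGroup.mk c ^ i * (FreeGroup.mk p)⁻¹)⁻¹ ∈ K := by
    intro i
    have := fst_mem_of_mem_extendByPowers (h.pow hs i)
    convert this using 1
    group
  set g : FTA n m := (FreeGroup.mk p * FreeGroup.mk c * (FreeGroup.mk p)⁻¹, s) with hg
  set a := relOrder (K : Set (FreeGroup (Fin n))) g.1 with ha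
  have ha' : relOrder (K : Set (FreeGroup (Fin n)))
      (FreeGroup.mk p * FreeGroup.mk c' * (FreeGroup.mk p)⁻¹) = a := by
    refine relOrder_congr fun i => ?_
    change _ ↔ (FreeGroup.mk p * FreeGroup.mk c * (FreeGroup.mk p)⁻¹) ^ i ∈ K
    rw [hconj, hconj]
    have := hpow i
    constructor
    · intro h1
      have h2 := K.mul_mem (K.inv_mem this) h1
      rwa [mul_inv_rev, inv_inv, inv_mul_cancel_right] at h2
    · intro h1
      have h2 := K.mul_mem this h1
      rwa [inv_mul_cancel_right] at h2
  obtain ⟨h₀, hh₀, y, hy⟩ := exists_pow_eq H g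
  have hmul := relOrder_eq_mul hh₀ hy
  rw [hord] at hmul
  obtain ⟨e, he⟩ : a ∣ k := ⟨_, hmul⟩
  -- At the exponent `a` the two elements differ, modulo `H`, by `z ^ k`. As `k = a * e`,
  -- multiplying the central part by `z ^ e` changes the `a`-th power by exactly this amount.
  obtain ⟨z, hz⟩ := mem_extendByPowers.1 (h.pow hs a)
  refine ⟨s * z ^ e, ?_⟩
  rw [relOrder_eq_mul (h := ((FreeGroup.mk p * FreeGroup.mk c' ^ a * (FreeGroup.mk c ^ a)⁻¹ *
    (FreeGroup.mk p)⁻¹, 1) : FTA n m) * (1, z ^ k) * h₀) (H.mul_mem hz hh₀) (y := y)]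
  · rw [ha', ← hmul]
  · change ((FreeGroup.mk p * FreeGroup.mk c' * (FreeGroup.mk p)⁻¹, s * z ^ e) : FTA n m) ^
      (relOrder (K : Set (FreeGroup (Fin n)))
        (FreeGroup.mk p * FreeGroup.mk c' * (FreeGroup.mk p)⁻¹)) = _
    change g ^ a = h₀ * (1, y) at hy
    rw [ha', mul_assoc _ h₀, ← hy]
    ext1
    · simp only [Prod.pow_fst, Prod.fst_mul, hconj, hg]
      group
    · simp only [Prod.pow_snd, Prod.snd_mul, hg]
      rw [mul_pow, ← pow_mul, mul_comm e a, ← he, one_mul, mul_comm]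

end Action

/-- Every positive element of the spectrum is the order of an element with short free part. -/
theorem exists_short_of_mem_relSpectrum {H : Subgroup (FTA n m)} {l k : ℕ}
    (hl : GeneratedInLength (freePart H) l) (hk : 1 ≤ k)
    (hmem : k ∈ relSpectrum (H : Set (FTA n m))) :
    ∃ (v c : FreeWord n) (s : Multiplicative (Fin m → ℤ)), v.length ≤ l ∧
      c.length ≤ 2 ^ ((wordsUpTo (letters n) l).length ^ 2 * k ^ m) ∧
      relOrder (H : Set (FTA n m))
        (FreeGroup.mk v * FreeGroup.mk c * (FreeGroup.mk v)⁻¹, s) = k := by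
  obtain ⟨⟨u, s⟩, hg⟩ := hmem
  obtain ⟨v₀, c, hc, rfl⟩ := exists_conj_isCyclicallyReduced u
  by_cases hc0 : c = []
  · subst hc0
    refine ⟨[], [], s, by simp, by simp, ?_⟩
    rw [← hg]
    rw [← FreeGroup.one_eq_mk, mul_one, mul_one, mul_inv_cancel, mul_inv_cancel]
  have hkK : FreeGroup.mk v₀ * FreeGroup.mk (List.replicate k c).flatten * (FreeGroup.mk v₀)⁻¹ ∈
      freePart H := by
    have h1 := pow_relOrder_mem (H := H)
      (g := (FreeGroup.mk v₀ * FreeGroup.mk c * (FreeGroup.mk v₀)⁻¹, s))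
    rw [hg] at h1
    have h2 := fst_mem_freePart h1
    rwa [Prod.pow_fst, conj_pow, ← mk_flatten_replicate] at h2
  have hred : ∀ i, FreeGroup.IsReduced (List.replicate i c).flatten := fun i =>
    (hc.flatten_replicate i).isReduced
  -- The coset of the conjugator lies on a cyclically reduced closed walk, hence in the ball, and
  -- may be represented by a word of length at most `l`.
  have hcyc : rightCoset (freePart H) (FreeGroup.mk v₀) ∈ cyclicVerts (freePart H) := by
    refine mem_cyclicVerts.2 ⟨_, ?_, hc.flatten_replicate k, hkK⟩
    simp only [ne_eq, List.flatten_eq_nil_iff, List.mem_replicate, not_forall]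
    exact ⟨c, ⟨by omega, rfl⟩, hc0⟩
  have hball := hl.stallings_verts_subset (cyclicVerts_subset_stallings hcyc)
  obtain ⟨v, hv, hvv⟩ := hball
  obtain ⟨σ, hσ⟩ := mem_freePart.1 (rightCoset_eq_rightCoset.1 hvv)
  have hord : relOrder (H : Set (FTA n m))
      (FreeGroup.mk v * FreeGroup.mk c * (FreeGroup.mk v)⁻¹, s) = k := by
    rw [← hg]
    refine relOrder_congr fun j => ?_
    have h1 : ((FreeGroup.mk v * FreeGroup.mk c * (FreeGroup.mk v)⁻¹, s) : FTA n m) =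
        (FreeGroup.mk v₀ * (FreeGroup.mk v)⁻¹, σ)⁻¹ *
          (FreeGroup.mk v₀ * FreeGroup.mk c * (FreeGroup.mk v₀)⁻¹, s) *
          (FreeGroup.mk v₀ * (FreeGroup.mk v)⁻¹, σ) := by
      ext1
      · simp only [Prod.fst_mul, Prod.fst_inv]
        group
      · simp only [Prod.snd_mul, Prod.snd_inv]
        rw [mul_comm σ⁻¹, inv_mul_cancel_right]
    have h2 := conj_pow (i := j)
      (a := ((FreeGroup.mk v₀ * (FreeGroup.mk v)⁻¹, σ)⁻¹ : FTA n m))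
      (b := (FreeGroup.mk v₀ * FreeGroup.mk c * (FreeGroup.mk v₀)⁻¹, s))
    rw [inv_inv] at h2
    rw [h1, h2, H.mul_mem_cancel_right hσ, H.mul_mem_cancel_left (H.inv_mem hσ)]
  -- The walk labelled `c ^ i` is an initial segment of the reduced closed walk labelled `c ^ (k
  -- i)`.
  have hstay : ∀ i, StaysIn (schreierBall (freePart H) l) (FreeGroup.mk v)
      (List.replicate i c).flatten := by
    intro i
    have h1 : StaysIn (schreierBall (freePart H) l) (FreeGroup.mk v)
        (List.replicate (k * i) c).flatten := by
      refine hl.staysIn (hred _) ⟨v, hv, rfl⟩ ⟨v, hv, ?_⟩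
      rw [rightCoset_eq_rightCoset, mk_flatten_replicate, pow_mul, ← conj_pow]
      rw [mk_flatten_replicate] at hkK
      exact Subgroup.pow_mem _ ((conj_mem_iff hvv _).1 hkK) i
    have h2 : k * i = i + (k * i - i) := by
      have : i ≤ k * i := Nat.le_mul_of_pos_left i hk
      omega
    rw [h2, List.replicate_add, List.flatten_append] at h1
    exact h1.left
  obtain ⟨c', hcc', hlen⟩ := exists_actsAlike_length_lt (H := H) (l := l) (k := k) hk c
  obtain ⟨s', hs'⟩ := hcc'.exists_relOrder_eq hstay hord
  exact ⟨v, c', s', hv, hlen.le, hs'⟩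

end FTA

/-! ## The algorithmic problems -/

theorem mem_wordsUpTo_iff {α : Type*} {A : List α} {l : ℕ} {w : List α} :
    w ∈ wordsUpTo A l ↔ w.length ≤ l ∧ ∀ a ∈ w, a ∈ A := by
  induction l generalizing w with
  | zero =>
    rw [wordsUpTo, List.mem_singleton, Nat.le_zero, List.length_eq_zero_iff]
    constructor
    · rintro rfl
      simp
    · exact fun h => h.1
  | succ l ih =>
    rcases w with _ | ⟨a, w⟩
    · simp [wordsUpTo]
    · simp [wordsUpTo, ih]
      tauto

theorem primrec_wordsUpTo_left {α : Type*} [Primcodable α] (l : ℕ) :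
    Primrec fun A : List α => wordsUpTo A l := by
  induction l with
  | zero => exact Primrec.const [[]]
  | succ l ih =>
    refine Primrec.list_cons.comp (Primrec.const []) (Primrec.list_flatMap Primrec.id ?_)
    exact Primrec.list_map (ih.comp Primrec.fst)
      (Primrec.list_cons.comp (Primrec.snd.comp Primrec.fst) Primrec.snd)

namespace FTA

open FreeGroup

variable {n m : ℕ}

theorem primrec_word_pow {α : Type*} [Primcodable α] {f : α → ℕ} {g : α → Word n m}
    (hf : Primrec f) (hg : Primrec g) : Primrec fun a => (List.replicate (f a) (g a)).flatten :=
  primrec_flatten_replicate.comp hf hg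

/-- The graph of the order function is semi-decidable. -/
theorem semiDec_relOrder_eq : SemiDec fun x : (List (Word n m) × Word n m) × ℕ =>
    relOrder (span x.1.1 : Set (FTA n m)) (eval x.1.2) = x.2 := by
  refine SemiDec.of_eq (p := fun x : (List (Word n m) × Word n m) × ℕ =>
    (x.2 ≠ 0 ∧ eval (List.replicate x.2 x.1.2).flatten ∈ span x.1.1 ∧
      ∀ j < x.2, j = 0 ∨ eval (List.replicate j x.1.2).flatten ∉ span x.1.1) ∨
    -- Order `0` becomes a finite check: no positive order exceeds the computed bound.
    (x.2 = 0 ∧ ∃ B : ℕ, spectrumBound (span x.1.1) = B ∧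
      ∀ j < B + 1, j = 0 ∨ eval (List.replicate j x.1.2).flatten ∉ span x.1.1)) ?_ fun x => ?_
  · have h0 : PrimrecPred fun x : (List (Word n m) × Word n m) × ℕ => x.2 = 0 :=
      Primrec.eq.comp Primrec.snd (Primrec.const 0)
    have hW : Primrec fun x : (List (Word n m) × Word n m) × ℕ => x.1.1 :=
      Primrec.fst.comp Primrec.fst
    have hw : Primrec fun x : (List (Word n m) × Word n m) × ℕ => x.1.2 :=
      Primrec.snd.comp Primrec.fst
    have hj : PrimrecPred fun y : ((List (Word n m) × Word n m) × ℕ) × ℕ => y.2 = 0 :=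
      Primrec.eq.comp Primrec.snd (Primrec.const 0)
    refine SemiDec.or (SemiDec.and h0.not.semiDec (SemiDec.and ?_ (SemiDec.ball_lt Primrec.snd
      (SemiDec.or hj.semiDec ?_)))) (SemiDec.and h0.semiDec (SemiDec.ex (SemiDec.and ?_
        (SemiDec.ball_lt (Primrec.succ.comp Primrec.snd) (SemiDec.or ?_ ?_)))))
    · exact SemiDec.mem_span hW (primrec_word_pow Primrec.snd hw)
    · exact SemiDec.not_mem_span (hW.comp Primrec.fst)
        (primrec_word_pow Primrec.snd (hw.comp Primrec.fst))
    · exact semiDec_spectrumBound.comp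
        (f := fun y : ((List (Word n m) × Word n m) × ℕ) × ℕ => (y.1.1.1, y.2))
        ((hW.comp Primrec.fst).pair Primrec.snd)
    · exact (Primrec.eq.comp Primrec.snd (Primrec.const 0)).semiDec
    · exact SemiDec.not_mem_span (hW.comp (Primrec.fst.comp Primrec.fst))
        (primrec_word_pow Primrec.snd (hw.comp (Primrec.fst.comp Primrec.fst)))
  · obtain ⟨⟨W, w⟩, k⟩ := x
    simp only [eval_flatten_replicate]
    rcases Nat.eq_zero_or_pos k with rfl | hk
    · constructor
      · rintro (⟨h, -⟩ | ⟨-, B, hB, h⟩)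
        · exact absurd rfl h
        · rw [relOrder_eq_zero_iff]
          intro j hj hm
          have h1 := relOrder_le hj hm
          have h2 := relOrder_le_spectrumBound (span_fg W) (eval w)
          rcases Nat.eq_zero_or_pos (relOrder (span W : Set (FTA n m)) (eval w)) with h3 | h3
          · exact relOrder_eq_zero_iff.1 h3 j hj hm
          · rcases h (relOrder (span W : Set (FTA n m)) (eval w)) (by omega) with h4 | h4
            · omega
            · exact h4 pow_relOrder_mem
      · intro h
        refine Or.inr ⟨rfl, _, rfl, fun j _ => ?_⟩
        rcases Nat.eq_zero_or_pos j with h0 | h0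
        · exact Or.inl h0
        · exact Or.inr (relOrder_eq_zero_iff.1 h j h0)
    · rw [relOrder_eq_succ_iff hk]
      constructor
      · rintro (⟨-, h1, h2⟩ | ⟨h, -⟩)
        · refine ⟨h1, fun j hj hj1 => ?_⟩
          rcases h2 j hj with h | h
          · omega
          · exact h
        · exact absurd h hk.ne'
      · rintro ⟨h1, h2⟩
        refine Or.inl ⟨hk.ne', h1, fun j hj => ?_⟩
        rcases Nat.eq_zero_or_pos j with h0 | h0
        · exact Or.inl h0
        · exact Or.inr (h2 j hj h0)

/-- The order is always defined, so a different value is confirmed by finding the actual one. -/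
theorem _root_.SemiDec.relOrder_ne {α : Type*} [Primcodable α] {f : α → List (Word n m)}
    {g : α → Word n m} {h : α → ℕ} (hf : Primrec f) (hg : Primrec g) (hh : Primrec h) :
    SemiDec fun a => relOrder (span (f a) : Set (FTA n m)) (eval (g a)) ≠ h a := by
  refine SemiDec.of_eq (p := fun a => ∃ j : ℕ,
    relOrder (span (f a) : Set (FTA n m)) (eval (g a)) = j ∧ j ≠ h a) ?_ fun a => by simp
  refine SemiDec.ex (SemiDec.and ?_ ?_)
  · exact semiDec_relOrder_eq.comp (f := fun y : α × ℕ => ((f y.1, g y.1), y.2))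
      (((hf.comp Primrec.fst).pair (hg.comp Primrec.fst)).pair Primrec.snd)
  · exact (Primrec.eq.comp Primrec.snd (hh.comp Primrec.fst)).not.semiDec

theorem semiDec_mem_relSpectrum : SemiDec fun x : List (Word n m) × ℕ =>
    x.2 ∈ relSpectrum (span x.1 : Set (FTA n m)) := by
  refine SemiDec.of_eq (p := fun x : List (Word n m) × ℕ => ∃ w : Word n m,
    relOrder (span x.1 : Set (FTA n m)) (eval w) = x.2) ?_ fun x => ?_
  · exact SemiDec.ex (semiDec_relOrder_eq.comp
      (f := fun y : (List (Word n m) × ℕ) × Word n m => ((y.1.1, y.2), y.1.2))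
      (((Primrec.fst.comp Primrec.fst).pair Primrec.snd).pair (Primrec.snd.comp Primrec.fst)))
  · constructor
    · rintro ⟨w, h⟩
      exact ⟨_, h⟩
    · rintro ⟨g, h⟩
      obtain ⟨w, rfl⟩ := eval_surjective g
      exact ⟨w, h⟩

/-! ### The order `0` -/

/-- The list `R` contains representatives of all the right cosets. -/
def IsCosetList (W R : List (Word n m)) : Prop :=
  (∃ r ∈ R, eval r ∈ span W) ∧
  ∀ r ∈ R, ∀ a ∈ (Finset.univ : Finset (Letter n m)).toList, ∃ r' ∈ R,
    eval (r ++ [a] ++ FreeGroup.invRev r') ∈ span W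

theorem semiDec_isCosetList :
    SemiDec fun x : List (Word n m) × List (Word n m) => IsCosetList x.1 x.2 := by
  refine SemiDec.and (SemiDec.bex Primrec.snd ?_) (SemiDec.ball Primrec.snd (SemiDec.ball
    (Primrec.const _) (SemiDec.bex (Primrec.snd.comp (Primrec.fst.comp Primrec.fst)) ?_)))
  · exact SemiDec.mem_span (Primrec.fst.comp Primrec.fst) Primrec.snd
  · refine SemiDec.mem_span (Primrec.fst.comp (Primrec.fst.comp (Primrec.fst.comp Primrec.fst)))
      (Primrec.list_append.comp (Primrec.list_append.comp
        (Primrec.snd.comp (Primrec.fst.comp Primrec.fst)) (Primrec.list_cons.comp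
          (Primrec.snd.comp Primrec.fst) (Primrec.const []))) (primrec_invRev.comp Primrec.snd))

theorem IsCosetList.exists_mem {W R : List (Word n m)} (h : IsCosetList W R) (w : Word n m) :
    ∃ r ∈ R, eval w * (eval r)⁻¹ ∈ span W := by
  induction w using List.reverseRecOn with
  | nil =>
    obtain ⟨r, hr, hm⟩ := h.1
    exact ⟨r, hr, by simpa using hm⟩
  | append_singleton w a ih =>
    obtain ⟨r, hr, hm⟩ := ih
    obtain ⟨r', hr', hm'⟩ := h.2 r hr a (by simp)
    refine ⟨r', hr', ?_⟩
    convert Subgroup.mul_mem _ hm hm' using 1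
    rw [eval_append, eval_append, eval_append, eval_invRev]
    group

/-- With finitely many cosets, two powers of `g` lie in the same one. -/
theorem IsCosetList.relOrder_ne_zero {W R : List (Word n m)} (h : IsCosetList W R)
    (g : FTA n m) : relOrder (span W : Set (FTA n m)) g ≠ 0 := by
  classical
  obtain ⟨w, rfl⟩ := eval_surjective g
  have h1 : ∀ i : ℕ, ∃ r ∈ R, eval w ^ i * (eval r)⁻¹ ∈ span W := fun i => by
    rw [← eval_flatten_replicate]
    exact h.exists_mem _
  choose f hf hfm using h1
  obtain ⟨i, -, j, -, hij, hfij⟩ := Finset.exists_ne_map_eq_of_card_lt_of_maps_to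
    (s := Finset.range (R.toFinset.card + 1)) (t := R.toFinset) (f := f) (by simp)
    fun i _ => Finset.mem_coe.2 (List.mem_toFinset.2 (hf i))
  wlog hlt : i < j generalizing i j
  · exact this j i hij.symm hfij.symm (lt_of_le_of_ne (not_lt.1 hlt) hij.symm)
  have h2 := Subgroup.mul_mem _ (hfm j) (Subgroup.inv_mem _ (hfm i))
  rw [hfij] at h2
  have h3 : eval w ^ j * (eval (f j))⁻¹ * (eval w ^ i * (eval (f j))⁻¹)⁻¹ = eval w ^ (j - i) := by
    rw [mul_inv_rev, inv_inv, mul_assoc, inv_mul_cancel_left, pow_sub _ hlt.le]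
  rw [h3] at h2
  intro h4
  exact relOrder_eq_zero_iff.1 h4 (j - i) (by omega) h2

/-- If all orders are positive, the index is finite: the ball exhausts the Schreier automaton and
the quotient in `ℤ ^ m` is finite. -/
theorem exists_isCosetList {W : List (Word n m)}
    (h : 0 ∉ relSpectrum (span W : Set (FTA n m))) : ∃ R, IsCosetList W R := by
  have hpos : ∀ g, ∃ k, 1 ≤ k ∧ g ^ k ∈ span W := by
    intro g
    by_contra! hcon
    exact h ⟨g, relOrder_eq_zero_iff.2 hcon⟩
  set K := freePart (span W)
  set l := W.flatten.length
  have hl : GeneratedInLength K l := generatedInLength_span W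
  -- The ball is closed under neighbours: some power of the letter `a` is closed at the vertex, and
  -- this reduced walk stays in the ball, in particular after its first step.
  have hball : ∀ u : FreeWord n, rightCoset K (FreeGroup.mk u) ∈ schreierBall K l := by
    intro u
    induction u using List.reverseRecOn with
    | nil => exact ⟨[], by simp, rfl⟩
    | append_singleton u a ih =>
      obtain ⟨k, hk, hm⟩ := hpos (FreeGroup.mk u * FreeGroup.mk [a] * (FreeGroup.mk u)⁻¹, 1)
      have hm' := fst_mem_freePart hm
      rw [Prod.pow_fst, conj_pow, ← mk_flatten_replicate] at hm'
      have hred : FreeGroup.IsReduced (List.replicate k [a]).flatten := by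
        have : FreeGroup.IsCyclicallyReduced [a] := by
          rw [isCyclicallyReduced_iff_append_self]
          simp [FreeGroup.IsReduced]
        exact (this.flatten_replicate k).isReduced
      have hs := hl.staysIn hred ih (by rwa [rightCoset_eq_rightCoset.2 hm'])
      obtain ⟨k, rfl⟩ := Nat.exists_eq_add_of_le hk
      rw [mk_append]
      refine hs [a] (List.replicate k [a]).flatten ?_
      rw [List.replicate_add, List.flatten_append]
      rfl
  set L := baseSubmodule (span W)
  -- Every vector is torsion modulo `L`, so the largest elementary divisor annihilates the whole
  -- quotient.
  have hD : ∀ y : Fin m → ℤ, largestElementaryDivisor L • y ∈ L := by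
    intro y
    obtain ⟨k, hk, hm⟩ := hpos (1, Multiplicative.ofAdd y)
    refine largestElementaryDivisor_smul_mem (c := k) (by omega) ?_
    rw [mem_baseSubmodule, mem_baseSubgroup]
    simpa [← ofAdd_nsmul] using hm
  have hD0 := largestElementaryDivisor_pos L
  set D := largestElementaryDivisor L
  -- Representatives: a short word for the free part and residues modulo `D` for the central part.
  have hfin : (Set.range fun x : {p : FreeWord n // p.length ≤ l} × (Fin m → Fin D) =>
      ((FreeGroup.mk x.1.1, Multiplicative.ofAdd fun j => ((x.2 j : ℕ) : ℤ)) : FTA n m)).Finite := by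
    have : Finite {p : FreeWord n // p.length ≤ l} := List.finite_length_le _ _
    exact Set.finite_range _
  choose wd hwd using eval_surjective (n := n) (m := m)
  have hcos : ∀ g : FTA n m, ∃ r ∈ hfin.toFinset.toList.map wd, g * (eval r)⁻¹ ∈ span W := by
    intro g
    obtain ⟨p, hp, hgp⟩ := hball g.1.toWord
    rw [mk_toWord] at hgp
    obtain ⟨s, hs⟩ := mem_freePart.1 (rightCoset_eq_rightCoset.1 hgp)
    have hDpos : (0 : ℤ) < D := by exact_mod_cast hD0
    let y : Fin m → ℤ := (s⁻¹ * g.2).toAdd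
    let e : Fin m → Fin D := fun j => ⟨(y j % D).toNat, by
      have := Int.emod_lt_of_pos (y j) hDpos
      have := Int.emod_nonneg (y j) hDpos.ne'
      omega⟩
    refine ⟨wd (FreeGroup.mk p, Multiplicative.ofAdd fun j => ((e j : ℕ) : ℤ)), ?_, ?_⟩
    · rw [List.mem_map]
      exact ⟨_, Finset.mem_toList.2 (hfin.mem_toFinset.2 ⟨(⟨p, hp⟩, e), rfl⟩), rfl⟩
    · rw [hwd]
      have h1 : Multiplicative.ofAdd (D • fun j => y j / (D : ℤ)) ∈ baseSubgroup (span W) := hD _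
      have h2 := Subgroup.mul_mem _ hs (mem_baseSubgroup.1 h1)
      convert h2 using 1
      ext1
      · simp
      · apply Multiplicative.toAdd.injective
        ext j
        have h3 := Int.emod_nonneg (y j) hDpos.ne'
        have h4 := Int.emod_add_mul_ediv (y j) D
        have h5 : y j = -(s.toAdd j) + g.2.toAdd j := rfl
        simp [e, max_eq_left h3]
        linarith
  refine ⟨hfin.toFinset.toList.map wd, ?_, fun r _ a _ => ?_⟩
  · obtain ⟨r, hr, hm⟩ := hcos 1
    exact ⟨r, hr, by simpa using hm⟩
  · obtain ⟨r', hr', hm⟩ := hcos (eval (r ++ [a]))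
    exact ⟨r', hr', by rwa [eval_append _ (FreeGroup.invRev r'), eval_invRev]⟩

/-! ### Positive orders -/

/-- The words `t_j ^ k`. -/
def powerWords (n m k : ℕ) : List (Word n m) :=
  List.ofFn fun j : Fin m => (List.replicate k [((Sum.inr j : Fin n ⊕ Fin m), true)]).flatten

theorem primrec_powerWords : Primrec (powerWords n m) :=
  Primrec.list_ofFn fun _ => primrec_flatten_replicate.comp Primrec.id (Primrec.const _)

theorem span_append_powerWords (W : List (Word n m)) (k : ℕ) :
    span (W ++ powerWords n m k) = extendByPowers (span W) k := by
  have ht : ∀ j : Fin m, eval (List.replicate k [((Sum.inr j : Fin n ⊕ Fin m), true)]).flatten =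
      (1, Multiplicative.ofAdd (k • Pi.single j (1 : ℤ))) := by
    intro j
    rw [eval_flatten_replicate, eval_inr, ofAdd_nsmul]
    ext1 <;> simp
  refine le_antisymm (span_le.2 fun w hw => ?_) ?_
  · rcases List.mem_append.1 hw with h | h
    · exact le_extendByPowers _ _ (eval_mem_span h)
    · obtain ⟨j, rfl⟩ := (List.mem_ofFn' _ _).1 h
      rw [ht]
      refine ⟨Multiplicative.ofAdd (-Pi.single j (1 : ℤ)), ?_⟩
      convert Subgroup.one_mem _ using 1
      ext1
      · simp
      · rw [Prod.snd_mul, ofAdd_nsmul, ofAdd_neg, inv_pow, mul_inv_cancel]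
        rfl
  · rintro g ⟨s, hs⟩
    have hW : span W ≤ span (W ++ powerWords n m k) :=
      span_le.2 fun w hw => eval_mem_span (List.mem_append_left _ hw)
    have h1 : k • s.toAdd ∈ baseSubmodule (span (W ++ powerWords n m k)) := by
      have h2 : k • s.toAdd = ∑ j, s.toAdd j • (k • Pi.single j (1 : ℤ)) := by
        ext i
        simp [Finset.sum_apply, Pi.single_apply, mul_comm]
      rw [h2]
      refine Submodule.sum_mem _ fun j _ => Submodule.smul_mem _ _ ?_
      rw [mem_baseSubmodule, mem_baseSubgroup, ← ht]
      exact eval_mem_span (List.mem_append_right _ ((List.mem_ofFn' _ _).2 ⟨j, rfl⟩))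
    exact (Subgroup.mul_mem_cancel_right _ (mem_baseSubgroup.1 (mem_baseSubmodule.1 h1))).1 (hW hs)

/-- A certificate that no product of the element of `u` with an element of the free-abelian part
has order `k`. -/
def OmitsOrder (W : List (Word n m)) (u : Word n m) (k : ℕ) : Prop :=
  eval (List.replicate k u).flatten ∉ span (W ++ powerWords n m k) ∨
  ∃ y : Word n m × (Fin m → Word n m × ℕ), ((eval y.1).1 = 1 ∧
    eval (List.replicate k (u ++ y.1)).flatten ∈ span W ∧ IsDiagonalCert W y.2) ∧
    -- The sum of the `d_i` is a common bound for all residues; short lists are padded with zeros.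
    ∀ e ∈ wordsUpTo (List.range ((List.ofFn fun i => (y.2 i).2).sum + 1)) m,
      relOrder (span W : Set (FTA n m))
        (eval (u ++ y.1 ++ combination y.2 fun i => (e.getD i 0, 0))) ≠ k

theorem semiDec_omitsOrder : SemiDec fun x : (List (Word n m) × Word n m) × ℕ =>
    OmitsOrder x.1.1 x.1.2 x.2 := by
  have hW : Primrec fun x : (List (Word n m) × Word n m) × ℕ => x.1.1 :=
    Primrec.fst.comp Primrec.fst
  have hu : Primrec fun x : (List (Word n m) × Word n m) × ℕ => x.1.2 :=
    Primrec.snd.comp Primrec.fst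
  refine SemiDec.or (SemiDec.not_mem_span (Primrec.list_append.comp hW
    (primrec_powerWords.comp Primrec.snd)) (primrec_word_pow Primrec.snd hu))
    (SemiDec.ex (SemiDec.and (SemiDec.and ?_ (SemiDec.and ?_ ?_)) (SemiDec.ball ?_ ?_)))
  · exact (primrecPred_fst_eval_eq_one.comp (Primrec.fst.comp Primrec.snd)).semiDec
  · exact SemiDec.mem_span (hW.comp Primrec.fst) (primrec_word_pow (Primrec.snd.comp Primrec.fst)
      (Primrec.list_append.comp (hu.comp Primrec.fst) (Primrec.fst.comp Primrec.snd)))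
  · exact SemiDec.isDiagonalCert (hW.comp Primrec.fst) (Primrec.snd.comp Primrec.snd)
  · refine (primrec_wordsUpTo_left m).comp (Primrec.list_range.comp (Primrec.succ.comp ?_))
    have hsum : Primrec (List.sum : List ℕ → ℕ) :=
      (Primrec.list_foldr Primrec.id (Primrec.const 0) (h := fun _ x => x.1 + x.2)
        (Primrec.nat_add.comp (Primrec.fst.comp Primrec.snd)
          (Primrec.snd.comp Primrec.snd))).of_eq fun l => rfl
    exact hsum.comp (Primrec.list_ofFn fun i =>
      Primrec.snd.comp (Primrec.finArrow_app (Primrec.snd.comp Primrec.snd) i))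
  · refine SemiDec.relOrder_ne (hW.comp (Primrec.fst.comp Primrec.fst))
      (Primrec.list_append.comp (Primrec.list_append.comp (hu.comp (Primrec.fst.comp Primrec.fst))
        (Primrec.fst.comp (Primrec.snd.comp Primrec.fst))) (primrec_combination
          (Primrec.snd.comp (Primrec.snd.comp Primrec.fst)) ?_))
      (Primrec.snd.comp (Primrec.fst.comp Primrec.fst))
    refine Primrec.fin_curry.2 (Primrec.pair ?_ (Primrec.const 0))
    exact (Primrec.list_getD 0).comp (Primrec.snd.comp Primrec.fst)
      (Primrec.fin_val.comp Primrec.snd)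

/-- If `(u z) ^ k` and `(u s) ^ k` both lie in `H`, with `z` and `s` central, then `s` and `z`
differ by torsion modulo `H`. So finitely many classes remain, and the order depends only on the
class. If there is no such `z`, the first alternative excludes the order `k` at once. -/
theorem omitsOrder_iff {W : List (Word n m)} {u : Word n m} {k : ℕ} (hk : 1 ≤ k) :
    OmitsOrder W u k ↔ ∀ s : Multiplicative (Fin m → ℤ),
      relOrder (span W : Set (FTA n m)) (eval u * (1, s)) ≠ k := by
  set H := span W
  have hpow : ∀ (s : Multiplicative (Fin m → ℤ)) (j : ℕ),
      (eval u * (1, s)) ^ j = eval u ^ j * (1, s ^ j) := by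
    intro s j
    rw [(commute_inr _ _).mul_pow]
    congr 1
    ext1 <;> simp
  unfold OmitsOrder
  rw [span_append_powerWords, eval_flatten_replicate, mem_extendByPowers]
  constructor
  · rintro (hno | ⟨⟨z, S⟩, ⟨hz, hm, hS⟩, hne⟩) s hs
    · refine hno ⟨s, ?_⟩
      rw [← hpow]
      have := pow_relOrder_mem (H := H) (g := eval u * (1, s))
      rwa [hs] at this
    · obtain ⟨b, hb, hd⟩ := hS.exists_basis
      have hsk : (eval u * (1, s)) ^ k ∈ H := by
        have := pow_relOrder_mem (H := H) (g := eval u * (1, s))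
        rwa [hs] at this
      rw [eval_flatten_replicate, eval_append, eq_inr hz, ofAdd_toAdd] at hm
      set t := (eval z).2
      rw [hpow] at hm hsk
      let y : Fin m → ℤ := (t⁻¹ * s).toAdd
      have hy : (k : ℤ) • y ∈ baseSubmodule H := by
        rw [natCast_zsmul, mem_baseSubmodule, mem_baseSubgroup]
        convert H.mul_mem (H.inv_mem hm) hsk using 1
        ext1
        · simp
        · simp only [Prod.snd_mul, Prod.snd_inv, Prod.pow_snd, y, ofAdd_nsmul, ofAdd_toAdd]
          rw [mul_pow, inv_pow, mul_inv, mul_mul_mul_comm, inv_mul_cancel, one_mul]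
      have hrepr : ∀ i, ((S i).2 : ℤ) ∣ k * b.repr y i := by
        intro i
        have := (hd _).1 hy i
        rwa [map_smul, Finsupp.smul_apply, smul_eq_mul] at this
      -- Torsion has no component in the directions with `d_i = 0`, where residues would be
      -- unbounded.
      have hzero : ∀ i, (S i).2 = 0 → b.repr y i = 0 := by
        intro i hi
        have := hrepr i
        rw [hi, Nat.cast_zero, zero_dvd_iff, mul_eq_zero] at this
        exact this.resolve_left (by exact_mod_cast (by omega : k ≠ 0))
      let e : Fin m → ℕ := fun i => (b.repr y i % (S i).2).toNat
      have he0 : ∀ i, 0 ≤ b.repr y i % (S i).2 := by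
        intro i
        by_cases hi : (S i).2 = 0
        · simp [hzero i hi]
        · exact Int.emod_nonneg _ (by exact_mod_cast hi)
      have he : List.ofFn e ∈ wordsUpTo (List.range ((List.ofFn fun i => (S i).2).sum + 1)) m := by
        refine mem_wordsUpTo_iff.2 ⟨by simp, fun c hc => ?_⟩
        obtain ⟨i, rfl⟩ := (List.mem_ofFn' _ _).1 hc
        rw [List.mem_range]
        have h1 : (S i).2 ≤ (List.ofFn fun i => (S i).2).sum :=
          List.le_sum_of_mem ((List.mem_ofFn' _ _).2 ⟨i, rfl⟩)
        have h2 : e i ≤ (S i).2 := by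
          by_cases hi : (S i).2 = 0
          · simp [e, hzero i hi]
          · have := Int.emod_lt_of_pos (b.repr y i) (b := (S i).2) (by positivity)
            have := he0 i
            change (b.repr y i % (S i).2).toNat ≤ _
            omega
        omega
      refine hne _ he ?_
      rw [← hs]
      have hcomb : eval (combination S fun i => ((List.ofFn e).getD i 0, 0)) =
          (1, Multiplicative.ofAdd (∑ i, (e i : ℤ) • b i)) := by
        rw [eval_combination hb]
        simp
      have hdiff : y - ∑ i, (e i : ℤ) • b i ∈ baseSubmodule H := by
        rw [hd]
        intro i
        rw [map_sub, Finsupp.sub_apply, Module.Basis.repr_sum_self]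
        change ((S i).2 : ℤ) ∣ b.repr y i - ((b.repr y i % (S i).2).toNat : ℤ)
        rw [Int.toNat_of_nonneg (he0 i)]
        exact Int.dvd_self_sub_emod
      refine relOrder_congr fun j => ?_
      have hz' : eval z = (1, t) := by rw [eq_inr hz, ofAdd_toAdd]
      have h1 : eval u * (1, s) = eval (u ++ z ++ combination S fun i =>
          ((List.ofFn e).getD i 0, 0)) * (1, Multiplicative.ofAdd (y - ∑ i, (e i : ℤ) • b i)) := by
        rw [eval_append, eval_append, hcomb, hz']
        ext1
        · simp
        · simp [y, mul_assoc]
      have h2 : ((1, Multiplicative.ofAdd (y - ∑ i, (e i : ℤ) • b i)) : FTA n m) ∈ H := hdiff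
      rw [h1, (commute_inr _ _).mul_pow, H.mul_mem_cancel_right (H.pow_mem h2 j)]
  · intro h
    by_cases hno : ∃ s : Multiplicative (Fin m → ℤ), eval u ^ k * (1, s ^ k) ∈ H
    · obtain ⟨s, hs⟩ := hno
      obtain ⟨z, hz⟩ := eval_surjective ((1, s) : FTA n m)
      obtain ⟨S, hS, -⟩ := exists_isDiagonalCert W
      obtain ⟨b, hb, -⟩ := hS.exists_basis
      refine Or.inr ⟨(z, S), ⟨by rw [hz], ?_, hS⟩, fun e _ => ?_⟩
      · rwa [eval_flatten_replicate, eval_append, hz, hpow]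
      · rw [eval_append, eval_append, hz, eval_combination hb, mul_assoc]
        have hmul : ∀ s t : Multiplicative (Fin m → ℤ),
            ((1, s) : FTA n m) * (1, t) = (1, s * t) := fun s t => by ext1 <;> simp
        rw [hmul]
        exact h _
    · exact Or.inl hno

/-- Order `0` is refuted by finite index. A positive `k` is refuted by examining every short free
part, which suffices by `exists_short_of_mem_relSpectrum`. -/
theorem semiDec_not_mem_relSpectrum : SemiDec fun x : List (Word n m) × ℕ =>
    x.2 ∉ relSpectrum (span x.1 : Set (FTA n m)) := by
  refine SemiDec.of_eq (p := fun x : List (Word n m) × ℕ =>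
    (x.2 = 0 ∧ ∃ R, IsCosetList x.1 R) ∨ (x.2 ≠ 0 ∧
      ∀ v ∈ wordsUpTo (letters n) x.1.flatten.length,
      ∀ c ∈ wordsUpTo (letters n)
        (2 ^ ((wordsUpTo (letters n) x.1.flatten.length).length ^ 2 * x.2 ^ m)),
      OmitsOrder x.1 (emb (v ++ c ++ FreeGroup.invRev v)) x.2)) ?_ fun x => ?_
  · have h0 : PrimrecPred fun x : List (Word n m) × ℕ => x.2 = 0 :=
      Primrec.eq.comp Primrec.snd (Primrec.const 0)
    have hball : Primrec fun x : List (Word n m) × ℕ =>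
        wordsUpTo (letters n) x.1.flatten.length :=
      (primrec_wordsUpTo _).comp (primrec_length_flatten.comp Primrec.fst)
    refine SemiDec.or (SemiDec.and h0.semiDec (SemiDec.ex ?_)) (SemiDec.and h0.not.semiDec
      (SemiDec.ball hball (SemiDec.ball ?_ ?_)))
    · exact semiDec_isCosetList.comp
        (f := fun y : (List (Word n m) × ℕ) × List (Word n m) => (y.1.1, y.2))
        ((Primrec.fst.comp Primrec.fst).pair Primrec.snd)
    · refine (primrec_wordsUpTo _).comp (primrec_pow.comp (Primrec.const 2) ?_)
      exact Primrec.nat_mul.comp (primrec_pow.comp (Primrec.list_length.comp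
        (hball.comp Primrec.fst)) (Primrec.const 2)) (primrec_pow.comp
          (Primrec.snd.comp Primrec.fst) (Primrec.const m))
    · exact semiDec_omitsOrder.comp
        (f := fun y : ((List (Word n m) × ℕ) × FreeWord n) × FreeWord n =>
          ((y.1.1.1, emb (y.1.2 ++ y.2 ++ FreeGroup.invRev y.1.2)), y.1.1.2))
        (((Primrec.fst.comp (Primrec.fst.comp Primrec.fst)).pair (primrec_emb.comp
          (Primrec.list_append.comp (Primrec.list_append.comp (Primrec.snd.comp Primrec.fst)
            Primrec.snd) (primrec_invRev.comp (Primrec.snd.comp Primrec.fst))))).pair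
          (Primrec.snd.comp (Primrec.fst.comp Primrec.fst)))
  · obtain ⟨W, k⟩ := x
    rcases Nat.eq_zero_or_pos k with rfl | hk
    · constructor
      · rintro (⟨-, R, hR⟩ | ⟨h, -⟩)
        · rintro ⟨g, hg⟩
          exact hR.relOrder_ne_zero g hg
        · exact absurd rfl h
      · intro h
        exact Or.inl ⟨rfl, exists_isCosetList h⟩
    · have hu : ∀ (v c : FreeWord n) (s : Multiplicative (Fin m → ℤ)),
          eval (emb (v ++ c ++ FreeGroup.invRev v)) * (1, s) =
            (FreeGroup.mk v * FreeGroup.mk c * (FreeGroup.mk v)⁻¹, s) := by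
        intro v c s
        rw [eval_emb, mk_conj_word, Prod.mk_mul_mk, mul_one, one_mul]
      constructor
      · rintro (⟨h, -⟩ | ⟨-, h⟩) hmem
        · exact hk.ne' h
        · obtain ⟨v, c, s, hv, hc, hs⟩ :=
            exists_short_of_mem_relSpectrum (generatedInLength_span W) hk hmem
          refine (omitsOrder_iff hk).1 (h v ((mem_wordsUpTo mem_letters).2 hv) c
            ((mem_wordsUpTo mem_letters).2 hc)) s ?_
          rwa [hu]
      · intro h
        refine Or.inr ⟨hk.ne', fun v _ c _ => (omitsOrder_iff hk).2 fun s hs => h ⟨_, hs⟩⟩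

/-- The search is for a list whose entries are confirmed to be orders while every other number up to
the bound is refuted. Finiteness of the spectrum makes the search succeed. -/
theorem exists_computable_relSpectrum : ∃ f : List (Word n m) → List ℕ, Computable f ∧
    ∀ (W : List (Word n m)) (k : ℕ), k ∈ f W ↔ k ∈ relSpectrum (span W : Set (FTA n m)) := by
  have hle : ∀ (W : List (Word n m)) (k : ℕ), k ∈ relSpectrum (span W : Set (FTA n m)) →
      k ≤ spectrumBound (span W) := by
    rintro W _ ⟨g, rfl⟩
    exact relOrder_le_spectrumBound (span_fg W) g
  obtain ⟨f, hf, hfr⟩ := SemiDec.exists_computable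
    (r := fun (W : List (Word n m)) (F : List ℕ) =>
      (∀ k ∈ F, k ∈ relSpectrum (span W : Set (FTA n m))) ∧
      ∃ B : ℕ, spectrumBound (span W) = B ∧ ∀ k < B + 1,
        (∃ j ∈ F, j = k) ∨ k ∉ relSpectrum (span W : Set (FTA n m))) (by
    refine SemiDec.and (SemiDec.ball Primrec.snd ?_) (SemiDec.ex (SemiDec.and ?_
      (SemiDec.ball_lt (Primrec.succ.comp Primrec.snd) (SemiDec.or
        (SemiDec.bex (Primrec.snd.comp (Primrec.fst.comp Primrec.fst)) ?_) ?_))))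
    · exact semiDec_mem_relSpectrum.comp
        (f := fun y : (List (Word n m) × List ℕ) × ℕ => (y.1.1, y.2))
        ((Primrec.fst.comp Primrec.fst).pair Primrec.snd)
    · exact semiDec_spectrumBound.comp
        (f := fun y : (List (Word n m) × List ℕ) × ℕ => (y.1.1, y.2))
        ((Primrec.fst.comp Primrec.fst).pair Primrec.snd)
    · exact (Primrec.eq.comp Primrec.snd (Primrec.snd.comp Primrec.fst)).semiDec
    · exact semiDec_not_mem_relSpectrum.comp
        (f := fun y : ((List (Word n m) × List ℕ) × ℕ) × ℕ => (y.1.1.1, y.2))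
        ((Primrec.fst.comp (Primrec.fst.comp Primrec.fst)).pair Primrec.snd)) (by
    intro W
    have hfin : (relSpectrum (span W : Set (FTA n m))).Finite :=
      (Set.finite_Iic (spectrumBound (span W))).subset (hle W)
    refine ⟨hfin.toFinset.toList, fun k hk => by simpa using hk, _, rfl, fun k _ => ?_⟩
    by_cases hk : k ∈ relSpectrum (span W : Set (FTA n m))
    · exact Or.inl ⟨k, by simpa using hk, rfl⟩
    · exact Or.inr hk)
  refine ⟨f, hf, fun W k => ⟨(hfr W).1 k, fun hk => ?_⟩⟩
  obtain ⟨B, hB, h⟩ := (hfr W).2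
  rcases h k (by have := hle W k hk; omega) with ⟨j, hj, rfl⟩ | h
  · exact hj
  · exact absurd hk h

end FTA

theorem mainTheorem12 (n m : ℕ) :
    (∀ H : Subgroup (FTA n m), H.FG →
      relSpectrum (H : Set (FTA n m)) ⊆
          relSpectrum (FTA.freePart H : Set (FreeGroup (Fin n))) *
            relSpectrum (FTA.baseSubgroup H : Set (Multiplicative (Fin m → ℤ))) ∧
        (restrictedStallings (FTA.freePart H)).verts.Finite ∧
        ∀ k ∈ relSpectrum (H : Set (FTA n m)),
          k ≤ (restrictedStallings (FTA.freePart H)).verts.ncard *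
            largestElementaryDivisor (FTA.baseSubmodule H)) ∧
      HasBoundedSubgroupSpectra (FTA n m) ∧
      (Computable fun W : List (List ((Fin n ⊕ Fin m) × Bool)) =>
        FTA.spectrumBound (subgroupOfWords (FTA.gen n m) W)) ∧
      SpectrumBoundabilityComputable (FTA.gen n m) ∧
      OrderProblemComputable (FTA.gen n m) ∧
      SpectrumMembershipComputable (FTA.gen n m) ∧
      (∃ f : List (List ((Fin n ⊕ Fin m) × Bool)) → List ℕ, Computable f ∧
        ∀ (W : List (List ((Fin n ⊕ Fin m) × Bool))) (k : ℕ),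
          k ∈ f W ↔ k ∈ relSpectrum (subgroupOfWords (FTA.gen n m) W : Set (FTA n m))) ∧
      FiniteSpectrumComputable (FTA.gen n m) := by
  have hbound : ∀ H : Subgroup (FTA n m), H.FG → ∀ k ∈ relSpectrum (H : Set (FTA n m)),
      k ≤ FTA.spectrumBound H := by
    rintro H hH _ ⟨g, rfl⟩
    exact FTA.relOrder_le_spectrumBound hH g
  have hcomp : Computable fun W : List (List ((Fin n ⊕ Fin m) × Bool)) =>
      FTA.spectrumBound (subgroupOfWords (FTA.gen n m) W) :=
    SemiDec.computable FTA.semiDec_spectrumBound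
  have hfin : ∀ W : List (List ((Fin n ⊕ Fin m) × Bool)),
      (relSpectrum (subgroupOfWords (FTA.gen n m) W : Set (FTA n m))).Finite := fun W =>
    (Set.finite_Iic _).subset (hbound _ (FTA.span_fg W))
  obtain ⟨f, hf, hfr⟩ := FTA.exists_computable_relSpectrum (n := n) (m := m)
  -- All spectra are finite, so the answer `none` never occurs and the computed values are wrapped
  -- in `some`.
  refine ⟨fun H hH => ⟨FTA.relSpectrum_subset H, FTA.restrictedStallings_finite hH, hbound H hH⟩,
    fun H hH => ⟨_, hbound H hH⟩, hcomp, ⟨_, Computable.option_some.comp hcomp, fun W => ⟨?_, ?_⟩⟩,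
    SemiDec.computable FTA.semiDec_relOrder_eq,
    SemiDec.computablePred FTA.semiDec_mem_relSpectrum FTA.semiDec_not_mem_relSpectrum,
    ⟨f, hf, hfr⟩, ⟨_, Computable.option_some.comp hf, fun W => ⟨?_, ?_⟩⟩⟩
  · simpa using hfin W
  · rintro b hb k hk
    rw [← Option.some.inj hb]
    exact hbound _ (FTA.span_fg W) k hk
  · simpa using hfin W
  · rintro l hl k
    rw [← Option.some.inj hl]
    exact hfr W k
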